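/- For $k,n\in\mathbb Z$ and each dyadic interval $\omega=[2^kn,2^k(n+1))$, of length $|\omega|=2^k$, let $\phi_\omega$ be a complex-valued Schwartz function on $\mathbb R$ whose Fourier transform $\hat\phi_\omega(\xi)=\int\phi_\omega(x)e^{-2\pi i x\xi}\,dx$ is supported on $\omega$. Let $\xi_1<\dots<\xi_N$ ($N\ge 1$) be real numbers, $X=\{\xi_1,\dots,\xi_N\}$, and put $$\Delta_k[f]=\sum_{|\omega|=2^k,\ \omega\cap X\ne\emptyset} f*\phi_\omega ,\qquad D_1=\sup_{\omega,x}|\omega|\,|\hat\phi_\omega'(x)|\in[0,\infty],$$ the supremum being over all dyadic intervals $\omega$ and all $x\in\mathbb R$. For a sequence $(g_k)_{k\le 0}$ of complex numbers and $1<s<\infty$ let $$\|g_k\|_{V^s_{k\le 0}}=\sup_{k\le 0}|g_k|+\sup_{M,\ k_0<\dots<k_M\le 0}\Big(\sum_{j=1}^M|g_{k_j}-g_{k_{j-1}}|^s\Big)^{1/s}\in[0,\infty],$$ with the sum replaced by a supremum over $j$ when $s=\infty$. Let $2<r<q\le\infty$. Then there is a constant $C_{q,r}<\infty$, depending only on $q$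 and $r$, such that for every $N\ge 1$, all $\xi_1,\dots,\xi_N$ with $\xi_{j+1}>\xi_j+1$ for $1\le j<N$, every family $(\phi_\omega)$ as above and every $f\in L^2(\mathbb R)$, $$\Big\|\,\|\Delta_k[f](x)\|_{V^q_{k\le 0}}\Big\|_{L^2_x}\le C_{q,r}\,N^{\left(\frac12-\frac1r\right)\frac{q}{q-2}}\Big(D_1+\sup_{1\le j\le N}\Big\|\sum_{|\omega|=2^k}\hat\phi_\omega(\xi_j)\Big\|_{V^r_{k\le 0}}\Big)\|f\|_{L^2},$$ where $\frac{q}{q-2}$ is read as $1$ if $q=\infty$ (and $\infty\cdot 0=0$ on the right-hand side). -/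

import Mathlib

open MeasureTheory
open scoped ENNReal NNReal FourierTransform SchwartzMap

namespace MultiFreq

/-- The `r`-variation seminorm (`0 < r ≤ ∞`) of `g` restricted to the index set `K`: the supremum,
over all finite strictly increasing sequences `u 0 < ... < u M` in `K`, of the `ℓ^r` norm of the
increments `g (u (j + 1)) - g (u j)`. It takes the value `∞` if the supremum is not finite. -/
noncomputable def variationSeminorm {ι E : Type*} [LinearOrder ι] [NormedAddCommGroup E]
    (r : ℝ≥0∞) (K : Set ι) (g : ι → E) : ℝ≥0∞ :=
  ⨆ (M : ℕ) (u : Fin (M + 1) → ι) (_ : StrictMono u) (_ : ∀ i, u i ∈ K),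
    if r = ∞ then ⨆ j : Fin M, ‖g (u j.succ) - g (u j.castSucc)‖ₑ
    else (∑ j : Fin M, ‖g (u j.succ) - g (u j.castSucc)‖ₑ ^ r.toReal) ^ (1 / r.toReal)

/-- The `r`-variation norm of `g` restricted to `K`: supremum norm plus `r`-variation seminorm. -/
noncomputable def variationNorm {ι E : Type*} [LinearOrder ι] [NormedAddCommGroup E]
    (r : ℝ≥0∞) (K : Set ι) (g : ι → E) : ℝ≥0∞ :=
  (⨆ k ∈ K, ‖g k‖ₑ) + variationSeminorm r K g

/-- The dyadic interval `[2^k n, 2^k (n + 1))`, of length `2^k`. -/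
def dyadic (k n : ℤ) : Set ℝ :=
  Set.Ico ((2 : ℝ) ^ k * n) ((2 : ℝ) ^ k * (n + 1))

/-- Only finitely many dyadic intervals of a given length meet a finite set, so that the sum
defining `Delta` below is a genuine finite sum. -/
theorem finite_setOf_dyadic_inter_nonempty (k : ℤ) {X : Set ℝ} (hX : X.Finite) :
    {n : ℤ | (dyadic k n ∩ X).Nonempty}.Finite := by
  refine (hX.image fun x => ⌊x / (2 : ℝ) ^ k⌋).subset ?_
  rintro n ⟨x, ⟨h1, h2⟩, hx⟩
  have h : (0 : ℝ) < (2 : ℝ) ^ k := by positivity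
  refine ⟨x, hx, Int.floor_eq_iff.2 ⟨?_, ?_⟩⟩
  · rw [le_div_iff₀ h]; linarith
  · rw [div_lt_iff₀ h]; linarith

/-- `Δ_k[f](x) = ∑ (f * φ_ω)(x)`, the sum being over the dyadic intervals `ω` of length `2^k`
that meet `X`. Here `φ k n` is the function attached to the dyadic interval `dyadic k n`. -/
noncomputable def Delta (φ : ℤ → ℤ → 𝓢(ℝ, ℂ)) (X : Set ℝ) (k : ℤ) (f : ℝ → ℂ) (x : ℝ) : ℂ :=
  ∑ᶠ (n : ℤ) (_ : (dyadic k n ∩ X).Nonempty),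
    convolution f (φ k n) (ContinuousLinearMap.mul ℂ ℂ) volume x

/-- `D_M = sup |ω|^M |(φ_ω^)^(M) (x)|` over all dyadic intervals `ω` and all real `x`, where
`φ_ω^` is the Fourier transform of `φ_ω`; the value may be `∞`. -/
noncomputable def derivBound (φ : ℤ → ℤ → 𝓢(ℝ, ℂ)) (M : ℕ) : ℝ≥0∞ :=
  ⨆ (k : ℤ) (n : ℤ) (x : ℝ),
    ENNReal.ofReal (((2 : ℝ) ^ k) ^ M * ‖iteratedDeriv M (𝓕 (φ k n : ℝ → ℂ)) x‖)

/-- `∑ φ_ω^(ξ)` over all dyadic intervals `ω` of length `2^k`. When each `φ_ω^` vanishes off `ω`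
at most one term is nonzero. -/
noncomputable def symbolSum (φ : ℤ → ℤ → 𝓢(ℝ, ℂ)) (k : ℤ) (ξ : ℝ) : ℂ :=
  ∑ᶠ n : ℤ, 𝓕 (φ k n : ℝ → ℂ) ξ

/-- The number `(1/2 - 1/r) q/(q-2)`, with `q/(q-2)` read as its limit `1` for `q = ∞`. -/
noncomputable def growthExponent (q r : ℝ≥0∞) : ℝ :=
  (1 / 2 - 1 / r.toReal) * if q = ∞ then 1 else q.toReal / (q.toReal - 2)

end MultiFreq

/-!
For scales `k ≤ 0` every dyadic interval contains at most one of the frequencies `ξ j`, so `Δ_k` is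
a sum over `j` of multiplier operators whose symbols live near `ξ j` at scale `2 ^ k`. The proof
gives the estimate with the power `N ^ (1/2 - 1/r)`, which is at most the stated one; the case
`q = ∞` follows from the case `q = r + 1`.

*Reduction to averages.* Near `ξ j` the symbol is replaced by its value `a_{k,j}` at `ξ j` times the
symbol of an averaging operator of length `2 ^ (-k)`. With `t = 2 ^ (-k) |η - ξ j|`, the error is
`O(D₁ min (t, 1/t))`. This is square summable over the scales, so by Plancherel's identity the
variation of the errors is bounded on `L²` (`lintegral_variationSeminorm_error_le`). The averaging
operator is chosen to be the mean of the dyadic averages over all translates of the dyadic grid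
(`integral_shiftMeasure_dyadicAvg`). Since the variation norm is convex, a bound for a fixed grid
suffices (`lintegral_variationSeminorm_main_le`).

*A fixed grid.* There the functions `∑ j, a_{k,j} E_k g_j(x) e(ξ j x)` have to be estimated, where
`E_k` is a dyadic average. The coefficients are constant on unit intervals, and on a unit interval
the `L²` norm of the `q`-variation of an exponential sum with separated frequencies is at most
`C N ^ (1/2 - 1/r)` times the `r`-variation of its vector of coefficients
(`eLpNorm_variationSeminorm_expSum_le`). Finally the `r`-variation of the coefficients
`a_{k,j} E_k g_j` is controlled by the `r`-variation of the `a_{k,j}` and by the inequalities of Doob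
and Lépingle for the dyadic martingale.

*The two variational inequalities* have a common mechanism. A sequence is approximated at the levels
`2 ^ (-m)` by greedy step sequences, which jump only when they are too far from it, and it is the sum
of the differences of successive approximations (`layer`). A layer is small, and its number of
changes of value is controlled by the jumps of the greedy sequences. For Lépingle's inequality
(`eLpNorm_variationSeminorm_dyadicAvg_le`) the thresholds follow the running maximum, and the squares
of the jumps sum to at most `‖g‖²`, because the greedy sequence is adapted (`sum_greedy_sq_add`). For
exponential sums the thresholds are multiples of the `r`-variation, which bounds the number of jumps,
and each layer is bounded by almost orthogonality on unit intervals
(`lintegral_exponential_sum_sq_le`), either alone or together with the trivial bound by `√N`; the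
first bound grows in `m`, the second decays, and they balance at `2 ^ (m r) = N`.

The estimate is proved for Schwartz functions and finitely many scales, and Fatou's lemma extends it
to `L²` and to all scales.
-/

namespace MultiFreq

/-! ### The variation seminorm -/

section Variation

variable {ι E : Type*} [LinearOrder ι] [NormedAddCommGroup E]

theorem sum_rpow_le_variationSeminorm {r : ℝ≥0∞} (hr : r ≠ ∞) {K : Set ι} (g : ι → E) {M : ℕ}
    {u : Fin (M + 1) → ι} (hu : StrictMono u) (huK : ∀ i, u i ∈ K) :
    (∑ j : Fin M, ‖g (u j.succ) - g (u j.castSucc)‖ₑ ^ r.toReal) ^ (1 / r.toReal)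
      ≤ variationSeminorm r K g := by
  unfold variationSeminorm
  simp only [if_neg hr]
  exact le_iSup₂_of_le M u (le_iSup₂_of_le hu huK le_rfl)

theorem variationSeminorm_le {r : ℝ≥0∞} (hr : r ≠ ∞) {K : Set ι} {g : ι → E} {B : ℝ≥0∞}
    (h : ∀ (M : ℕ) (u : Fin (M + 1) → ι), StrictMono u → (∀ i, u i ∈ K) →
      (∑ j : Fin M, ‖g (u j.succ) - g (u j.castSucc)‖ₑ ^ r.toReal) ^ (1 / r.toReal) ≤ B) :
    variationSeminorm r K g ≤ B := by
  unfold variationSeminorm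
  simp only [if_neg hr]
  exact iSup₂_le fun M u => iSup₂_le fun hu huK => h M u hu huK

theorem toReal_pos_of_one_le {r : ℝ≥0∞} (hr : r ≠ ∞) (hr1 : 1 ≤ r) : 0 < r.toReal :=
  ENNReal.toReal_pos (zero_lt_one.trans_le hr1).ne' hr

theorem one_le_toReal {r : ℝ≥0∞} (hr : r ≠ ∞) (hr1 : 1 ≤ r) : 1 ≤ r.toReal := by
  simpa using (ENNReal.toReal_le_toReal ENNReal.one_ne_top hr).2 hr1

theorem sum_rpow_le_variationSeminorm_rpow {r : ℝ≥0∞} (hr : r ≠ ∞) (hr1 : 1 ≤ r) {K : Set ι}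
    (g : ι → E) {M : ℕ} {u : Fin (M + 1) → ι} (hu : StrictMono u) (huK : ∀ i, u i ∈ K) :
    ∑ j : Fin M, ‖g (u j.succ) - g (u j.castSucc)‖ₑ ^ r.toReal
      ≤ variationSeminorm r K g ^ r.toReal := by
  have h0 := toReal_pos_of_one_le hr hr1
  have := ENNReal.rpow_le_rpow (sum_rpow_le_variationSeminorm hr g hu huK) h0.le
  rwa [← ENNReal.rpow_mul, one_div_mul_cancel h0.ne', ENNReal.rpow_one] at this

theorem variationSeminorm_le_of_rpow {r : ℝ≥0∞} (hr : r ≠ ∞) (hr1 : 1 ≤ r) {K : Set ι} {g : ι → E}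
    {B : ℝ≥0∞}
    (h : ∀ (M : ℕ) (u : Fin (M + 1) → ι), StrictMono u → (∀ i, u i ∈ K) →
      ∑ j : Fin M, ‖g (u j.succ) - g (u j.castSucc)‖ₑ ^ r.toReal ≤ B) :
    variationSeminorm r K g ^ r.toReal ≤ B := by
  have h0 := toReal_pos_of_one_le hr hr1
  rw [← ENNReal.le_rpow_inv_iff h0]
  refine variationSeminorm_le hr fun M u hu huK => ?_
  rw [one_div]
  gcongr
  exact h M u hu huK

theorem variationSeminorm_add_le {r : ℝ≥0∞} (hr : r ≠ ∞) (hr1 : 1 ≤ r) (K : Set ι) (f g : ι → E) :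
    variationSeminorm r K (fun n => f n + g n)
      ≤ variationSeminorm r K f + variationSeminorm r K g := by
  refine variationSeminorm_le hr fun M u hu huK => ?_
  refine le_trans ?_ (add_le_add (sum_rpow_le_variationSeminorm hr f hu huK)
    (sum_rpow_le_variationSeminorm hr g hu huK))
  refine le_trans ?_ (ENNReal.Lp_add_le _ _ _ (one_le_toReal hr hr1))
  gcongr with j
  rw [add_sub_add_comm]
  exact enorm_add_le _ _

theorem variationSeminorm_const {r : ℝ≥0∞} (hr : r ≠ ∞) (hr1 : 1 ≤ r) (K : Set ι) (c : E) :
    variationSeminorm r K (fun _ => c) = 0 := by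
  have h0 := toReal_pos_of_one_le hr hr1
  refine le_antisymm (variationSeminorm_le hr fun M u hu huK => ?_) zero_le
  simp [h0]

theorem variationSeminorm_sum_le {r : ℝ≥0∞} (hr : r ≠ ∞) (hr1 : 1 ≤ r) (K : Set ι) {α : Type*}
    (s : Finset α) (f : α → ι → E) :
    variationSeminorm r K (fun n => ∑ a ∈ s, f a n)
      ≤ ∑ a ∈ s, variationSeminorm r K (f a) := by
  classical
  induction s using Finset.induction_on with
  | empty => simp [variationSeminorm_const hr hr1]
  | insert a s ha ih =>
    simp only [Finset.sum_insert ha]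
    exact (variationSeminorm_add_le hr hr1 K _ _).trans (add_le_add le_rfl ih)

/-- The variation seminorm is lower semicontinuous for pointwise convergence, also when the index
sets exhaust the limiting index set. -/
theorem variationSeminorm_le_liminf {r : ℝ≥0∞} (hr : r ≠ ∞) {K : Set ι} {K' : ℕ → Set ι}
    (hK : ∀ n ∈ K, ∀ᶠ m in Filter.atTop, n ∈ K' m) {G : ℕ → ι → E}
    {g : ι → E} (h : ∀ n ∈ K, Filter.Tendsto (fun m => G m n) Filter.atTop (nhds (g n))) :
    variationSeminorm r K g
      ≤ Filter.liminf (fun m => variationSeminorm r (K' m) (G m)) Filter.atTop := by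
  refine variationSeminorm_le hr fun M u hu huK => ?_
  have ht : Filter.Tendsto (fun m => (∑ j : Fin M, ‖G m (u j.succ) - G m (u j.castSucc)‖ₑ ^ r.toReal)
      ^ (1 / r.toReal)) Filter.atTop
      (nhds ((∑ j : Fin M, ‖g (u j.succ) - g (u j.castSucc)‖ₑ ^ r.toReal) ^ (1 / r.toReal))) := by
    refine (ENNReal.continuous_rpow_const.tendsto _).comp (tendsto_finsetSum _ fun j _ => ?_)
    refine (ENNReal.continuous_rpow_const.tendsto _).comp ?_
    exact ((continuous_enorm.tendsto _).comp ((h _ (huK _)).sub (h _ (huK _))))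
  rw [← ht.liminf_eq]
  refine Filter.liminf_le_liminf ?_
  filter_upwards [Filter.eventually_all.2 fun i => hK _ (huK i)] with m hm
  exact sum_rpow_le_variationSeminorm hr (G m) hu hm

theorem enorm_sub_le_variationSeminorm {r : ℝ≥0∞} (hr : r ≠ ∞) (hr1 : 1 ≤ r) {K : Set ι} (g : ι → E)
    {m n : ι} (hm : m ∈ K) (hn : n ∈ K) : ‖g m - g n‖ₑ ≤ variationSeminorm r K g := by
  have h0 := toReal_pos_of_one_le hr hr1
  have key : ∀ m n : ι, m ∈ K → n ∈ K → m < n → ‖g n - g m‖ₑ ≤ variationSeminorm r K g := by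
    intro m n hm hn hmn
    have := sum_rpow_le_variationSeminorm (r := r) hr (K := K) g (M := 1) (u := ![m, n])
      (by
        intro i j hij
        fin_cases i <;> fin_cases j <;> simp_all)
      (by intro i; fin_cases i <;> simp_all)
    simpa [← ENNReal.rpow_mul, h0.ne'] using this
  rcases lt_trichotomy m n with h | h | h
  · rw [← enorm_neg, neg_sub]; exact key m n hm hn h
  · simp [h]
  · exact key n m hn hm h

/-- The variation seminorm decreases as the exponent increases. -/
theorem variationSeminorm_anti {q r : ℝ≥0∞} (hr1 : 1 ≤ r) (hrq : r ≤ q) (K : Set ι) (g : ι → E) :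
    variationSeminorm q K g ≤ variationSeminorm r K g := by
  by_cases hq : q = ∞
  · by_cases hr : r = ∞
    · rw [hq, hr]
    · have h0 := toReal_pos_of_one_le hr hr1
      unfold variationSeminorm
      simp only [if_neg hr, if_pos hq]
      refine iSup₂_mono fun M u => iSup₂_mono fun hu huK => iSup_le fun j => ?_
      calc ‖g (u j.succ) - g (u j.castSucc)‖ₑ
          = (‖g (u j.succ) - g (u j.castSucc)‖ₑ ^ r.toReal) ^ (1 / r.toReal) := by
            rw [← ENNReal.rpow_mul, mul_one_div_cancel h0.ne', ENNReal.rpow_one]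
        _ ≤ _ := by
            gcongr
            exact Finset.single_le_sum
              (f := fun j : Fin M => ‖g (u j.succ) - g (u j.castSucc)‖ₑ ^ r.toReal)
              (fun _ _ => zero_le) (Finset.mem_univ j)
  · have hr : r ≠ ∞ := ne_top_of_le_ne_top hq hrq
    have h0 := toReal_pos_of_one_le hr hr1
    have h1 : r.toReal ≤ q.toReal := ENNReal.toReal_mono hq hrq
    refine variationSeminorm_le hq fun M u hu huK => ?_
    refine le_trans ?_ (sum_rpow_le_variationSeminorm hr g hu huK)
    generalize hw : (fun j : Fin M => ‖g (u j.succ) - g (u j.castSucc)‖ₑ) = w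
    have hw' : ∀ j : Fin M, ‖g (u j.succ) - g (u j.castSucc)‖ₑ = w j := fun j => by rw [← hw]
    simp only [hw']
    have hq0 : 0 < q.toReal := h0.trans_le h1
    rw [one_div, ENNReal.rpow_inv_le_iff hq0]
    -- `w j ^ q ≤ (∑ w ^ r) ^ ((q - r) / r) * w j ^ r`
    have hj : ∀ j, w j ≤ (∑ i, w i ^ r.toReal) ^ (1 / r.toReal) := fun j => by
      calc w j = (w j ^ r.toReal) ^ (1 / r.toReal) := by
            rw [← ENNReal.rpow_mul, mul_one_div_cancel h0.ne', ENNReal.rpow_one]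
        _ ≤ _ := by
            gcongr
            exact Finset.single_le_sum (f := fun j => w j ^ r.toReal)
              (fun _ _ => zero_le) (Finset.mem_univ j)
    calc ∑ j, w j ^ q.toReal
        = ∑ j, w j ^ (q.toReal - r.toReal) * w j ^ r.toReal := by
          refine Finset.sum_congr rfl fun j _ => ?_
          rw [← ENNReal.rpow_add_of_nonneg _ _ (sub_nonneg.2 h1) h0.le, sub_add_cancel]
      _ ≤ ∑ j, ((∑ i, w i ^ r.toReal) ^ (1 / r.toReal)) ^ (q.toReal - r.toReal) * w j ^ r.toReal := by
          gcongr with j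
          exact hj j
      _ = ((∑ i, w i ^ r.toReal) ^ (1 / r.toReal)) ^ (q.toReal - r.toReal)
            * ((∑ i, w i ^ r.toReal) ^ (1 / r.toReal)) ^ r.toReal := by
          rw [← Finset.mul_sum]
          congr 1
          rw [← ENNReal.rpow_mul, one_div_mul_cancel h0.ne', ENNReal.rpow_one]
      _ = _ := by
          rw [← ENNReal.rpow_add_of_nonneg _ _ (sub_nonneg.2 h1) h0.le, sub_add_cancel]

theorem variationSeminorm_comp_le {κ : Type*} [LinearOrder κ] {r : ℝ≥0∞} (hr : r ≠ ∞)
    {K : Set ι} {K' : Set κ} {e : ι → κ} (he : StrictMonoOn e K) (heK : Set.MapsTo e K K')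
    {f : ι → E} {g : κ → E} (hfg : ∀ n ∈ K, f n = g (e n)) :
    variationSeminorm r K f ≤ variationSeminorm r K' g := by
  refine variationSeminorm_le hr fun M u hu huK => ?_
  simp only [hfg _ (huK _)]
  exact sum_rpow_le_variationSeminorm hr g (u := fun i => e (u i))
    (fun i j hij => he (huK i) (huK j) (hu hij)) (fun i => heK (huK i))

theorem variationSeminorm_congr {r : ℝ≥0∞} {K : Set ι} {f g : ι → E}
    (hfg : ∀ n ∈ K, f n = g n) : variationSeminorm r K f = variationSeminorm r K g := by
  unfold variationSeminorm
  refine iSup_congr fun M => iSup_congr fun u => iSup_congr fun hu => iSup_congr fun huK => ?_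
  simp only [hfg _ (huK _)]

/-- Lipschitz maps, with constant `C`, increase the variation by a factor at most `C`. -/
theorem variationSeminorm_le_mul {F : Type*} [NormedAddCommGroup F] {r : ℝ≥0∞} (hr : r ≠ ∞)
    (hr1 : 1 ≤ r) {K : Set ι} {f : ι → F} {g : ι → E} {C : ℝ≥0∞}
    (h : ∀ m ∈ K, ∀ n ∈ K, ‖f m - f n‖ₑ ≤ C * ‖g m - g n‖ₑ) :
    variationSeminorm r K f ≤ C * variationSeminorm r K g := by
  have h0 := toReal_pos_of_one_le hr hr1
  refine variationSeminorm_le hr fun M u hu huK => ?_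
  refine le_trans ?_ (mul_le_mul_right (sum_rpow_le_variationSeminorm hr g hu huK) C)
  calc (∑ j : Fin M, ‖f (u j.succ) - f (u j.castSucc)‖ₑ ^ r.toReal) ^ (1 / r.toReal)
      ≤ (∑ j : Fin M, (C * ‖g (u j.succ) - g (u j.castSucc)‖ₑ) ^ r.toReal) ^ (1 / r.toReal) := by
        gcongr with j
        exact h _ (huK _) _ (huK _)
    _ = _ := by
        simp only [ENNReal.mul_rpow_of_nonneg _ _ h0.le]
        rw [← Finset.mul_sum, ENNReal.mul_rpow_of_nonneg _ _ (by positivity),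
          ← ENNReal.rpow_mul, mul_one_div_cancel h0.ne', ENNReal.rpow_one]

theorem variationSeminorm_mul_le {𝕜 : Type*} [NormedField 𝕜] {r : ℝ≥0∞} (hr : r ≠ ∞)
    (hr1 : 1 ≤ r) {K : Set ι} {a F : ι → 𝕜} {A B : ℝ≥0∞} (ha : ∀ n ∈ K, ‖a n‖ₑ ≤ A)
    (hF : ∀ n ∈ K, ‖F n‖ₑ ≤ B) :
    variationSeminorm r K (fun n => a n * F n)
      ≤ A * variationSeminorm r K F + B * variationSeminorm r K a := by
  have h0 := toReal_pos_of_one_le hr hr1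
  refine variationSeminorm_le hr fun M u hu huK => ?_
  have hpull : ∀ (C : ℝ≥0∞) (w : Fin M → ℝ≥0∞),
      (∑ j : Fin M, (C * w j) ^ r.toReal) ^ (1 / r.toReal)
        = C * (∑ j : Fin M, w j ^ r.toReal) ^ (1 / r.toReal) := fun C w => by
    simp only [ENNReal.mul_rpow_of_nonneg _ _ h0.le]
    rw [← Finset.mul_sum, ENNReal.mul_rpow_of_nonneg _ _ (by positivity),
      ← ENNReal.rpow_mul, mul_one_div_cancel h0.ne', ENNReal.rpow_one]
  refine le_trans ?_ (add_le_add
    (mul_le_mul_right (sum_rpow_le_variationSeminorm hr F hu huK) A)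
    (mul_le_mul_right (sum_rpow_le_variationSeminorm hr a hu huK) B))
  rw [← hpull, ← hpull]
  refine le_trans ?_ (ENNReal.Lp_add_le _ _ _ (one_le_toReal hr hr1))
  gcongr with j
  calc ‖a (u j.succ) * F (u j.succ) - a (u j.castSucc) * F (u j.castSucc)‖ₑ
      = ‖a (u j.succ) * (F (u j.succ) - F (u j.castSucc))
          + F (u j.castSucc) * (a (u j.succ) - a (u j.castSucc))‖ₑ := by congr 1; ring
    _ ≤ _ := (enorm_add_le _ _).trans (by
          rw [enorm_mul, enorm_mul]
          gcongr
          · exact ha _ (huK _)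
          · exact hF _ (huK _))

theorem measurable_variationSeminorm [Countable ι] {α : Type*} [MeasurableSpace α]
    [MeasurableSpace E] [BorelSpace E] [SecondCountableTopology E] {r : ℝ≥0∞} (hr : r ≠ ∞)
    (K : Set ι) {F : ι → α → E} (hF : ∀ n, Measurable (F n)) :
    Measurable fun x => variationSeminorm r K (fun n => F n x) := by
  unfold variationSeminorm
  simp only [if_neg hr]
  refine .iSup fun M => .iSup fun u => .iSup fun hu => .iSup fun huK => ?_
  refine (Finset.measurable_sum _ fun j _ => ?_).pow_const _
  exact ((hF _).sub (hF _)).enorm.pow_const _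

/-- By Minkowski's inequality in `ℓ^{r/2}`, the `r`-variation of a vector valued sequence is at most
the `ℓ²` norm of the `r`-variations of its coordinates, provided `r ≥ 2`. -/
theorem variationSeminorm_euclidean_le {N : ℕ} {r : ℝ≥0∞} (hr : r ≠ ∞) (hr2 : 2 ≤ r) {K : Set ι}
    (c : ι → EuclideanSpace ℂ (Fin N)) :
    variationSeminorm r K c ^ 2 ≤ ∑ j, variationSeminorm r K (fun n => c n j) ^ 2 := by
  have hr1 : 1 ≤ r := one_le_two.trans hr2
  have h0 := toReal_pos_of_one_le hr hr1
  have h2 : 2 ≤ r.toReal := by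
    simpa using (ENNReal.toReal_le_toReal ENNReal.ofNat_ne_top hr).2 hr2
  have hmink : ∀ (M : ℕ) (s : Finset (Fin N)) (w : Fin N → Fin M → ℝ≥0∞),
      (∑ i, (∑ j ∈ s, w j i) ^ (r.toReal / 2)) ^ (1 / (r.toReal / 2))
        ≤ ∑ j ∈ s, (∑ i, w j i ^ (r.toReal / 2)) ^ (1 / (r.toReal / 2)) := by
    intro M s w
    have h0' : 0 < r.toReal / 2 := by positivity
    induction s using Finset.induction_on with
    | empty => simp [h0]
    | insert a s ha ih =>
      simp only [Finset.sum_insert ha]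
      exact (ENNReal.Lp_add_le _ _ _ (by linarith)).trans (add_le_add le_rfl ih)
  have hsq : ∀ x : ℝ≥0∞, x ^ (2 : ℕ) = x ^ (2 : ℝ) := fun x => by norm_cast
  rw [hsq, ← ENNReal.le_rpow_inv_iff two_pos]
  refine variationSeminorm_le hr fun M u hu huK => ?_
  rw [ENNReal.le_rpow_inv_iff two_pos, ← ENNReal.rpow_mul]
  have e1 : 1 / r.toReal * 2 = 1 / (r.toReal / 2) := by field_simp
  rw [e1]
  have e2 : ∀ i : Fin M, ‖c (u i.succ) - c (u i.castSucc)‖ₑ ^ r.toReal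
      = (∑ j, ‖c (u i.succ) j - c (u i.castSucc) j‖ₑ ^ 2) ^ (r.toReal / 2) := by
    intro i
    have : ‖c (u i.succ) - c (u i.castSucc)‖ₑ ^ (2 : ℝ)
        = ∑ j, ‖c (u i.succ) j - c (u i.castSucc) j‖ₑ ^ 2 := by
      rw [← hsq, ← ofReal_norm, ← ENNReal.ofReal_pow (norm_nonneg _),
        EuclideanSpace.norm_sq_eq, ENNReal.ofReal_sum_of_nonneg (fun _ _ => by positivity)]
      refine Finset.sum_congr rfl fun j _ => ?_
      rw [ENNReal.ofReal_pow (norm_nonneg _), ofReal_norm]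
      rfl
    rw [← this, ← ENNReal.rpow_mul]
    congr 1
    ring
  simp only [e2]
  refine (hmink M _ _).trans (Finset.sum_le_sum fun j _ => ?_)
  have e3 : ∀ i : Fin M, (‖c (u i.succ) j - c (u i.castSucc) j‖ₑ ^ 2) ^ (r.toReal / 2)
      = ‖c (u i.succ) j - c (u i.castSucc) j‖ₑ ^ r.toReal := fun i => by
    rw [hsq, ← ENNReal.rpow_mul]
    congr 1
    ring
  simp only [e3]
  rw [← e1, ENNReal.rpow_mul, hsq]
  gcongr
  exact sum_rpow_le_variationSeminorm hr (fun n => c n j) hu huK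

/-- The variation seminorm is convex: the variation of an average is at most the average of the
variations. -/
theorem variationSeminorm_integral_le {α : Type*} [MeasurableSpace α] {μ : Measure α} {r : ℝ≥0∞}
    (hr : r ≠ ∞) (hr1 : 1 ≤ r) {K : Set ι} {F : ι → α → ℂ} (hF : ∀ n, Integrable (F n) μ) :
    variationSeminorm r K (fun n => ∫ a, F n a ∂μ)
      ≤ ∫⁻ a, variationSeminorm r K (fun n => F n a) ∂μ := by
  have h0 := toReal_pos_of_one_le hr hr1
  have : Fact (1 ≤ r) := ⟨hr1⟩
  refine variationSeminorm_le hr fun M u hu huK => ?_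
  have hnorm : ∀ v : Fin M → ℂ, (∑ j, ‖v j‖ₑ ^ r.toReal) ^ (1 / r.toReal)
      = ‖(WithLp.toLp r v : PiLp r fun _ : Fin M => ℂ)‖ₑ := by
    intro v
    rw [← ofReal_norm, PiLp.norm_eq_sum h0, ← ENNReal.ofReal_rpow_of_nonneg
      (Finset.sum_nonneg fun _ _ => by positivity) (by positivity),
      ENNReal.ofReal_sum_of_nonneg (fun _ _ => by positivity)]
    congr 2
    ext j
    rw [← ENNReal.ofReal_rpow_of_nonneg (norm_nonneg _) h0.le, ofReal_norm]
  have hint : Integrable (fun a => (WithLp.toLp r fun j : Fin M =>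
      F (u j.succ) a - F (u j.castSucc) a : PiLp r fun _ : Fin M => ℂ)) μ := by
    have h1 : Integrable (fun a => fun j : Fin M => F (u j.succ) a - F (u j.castSucc) a) μ :=
      Integrable.of_eval fun j => (hF _).sub (hF _)
    exact (PiLp.continuousLinearEquiv r ℂ (fun _ : Fin M => ℂ)).symm.toContinuousLinearMap.integrable_comp h1
  have heval : ∫ a, (WithLp.toLp r fun j : Fin M =>
      F (u j.succ) a - F (u j.castSucc) a : PiLp r fun _ : Fin M => ℂ) ∂μ
      = WithLp.toLp r fun j : Fin M => ∫ a, F (u j.succ) a ∂μ - ∫ a, F (u j.castSucc) a ∂μ := by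
    ext j
    have := (PiLp.proj (𝕜 := ℂ) r (fun _ : Fin M => ℂ) j).integral_comp_comm hint
    rw [PiLp.proj_apply] at this
    rw [← this]
    simp only [PiLp.proj_apply]
    exact integral_sub (hF _) (hF _)
  rw [hnorm, ← heval]
  refine (enorm_integral_le_lintegral_enorm _).trans (lintegral_mono fun a => ?_)
  rw [← hnorm]
  exact sum_rpow_le_variationSeminorm hr (fun n => F n a) hu huK

open Classical in
/-- If `b n ≠ b m`, then `b n` is the value taken at some change of the sequence between `m` and `n`. -/
theorem rpow_enorm_le_sum_changes (b : ℕ → E) (p : ℝ) {m n : ℕ} (hmn : m ≤ n) (hb : b n ≠ b m) :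
    ‖b n‖ₑ ^ p ≤ ∑ s ∈ Finset.Ico m n, if b (s + 1) ≠ b s then ‖b (s + 1)‖ₑ ^ p else 0 := by
  induction n, hmn using Nat.le_induction with
  | base => exact absurd rfl hb
  | succ n hmn ih =>
    rw [Finset.sum_Ico_succ_top hmn]
    by_cases h : b (n + 1) = b n
    · rw [h] at hb ⊢
      exact (ih hb).trans le_self_add
    · rw [if_pos h]
      exact le_add_self

open Classical in
/-- The variation of a sequence is controlled by the `ℓ^p` norm of the values which it takes after
each change of value: it is not necessary to count repeated values. -/
theorem variationSeminorm_rpow_le_sum_changes {r : ℝ≥0∞} (hr : r ≠ ∞) (hr1 : 1 ≤ r) (K : ℕ)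
    (b : ℕ → E) :
    variationSeminorm r (Set.Iic K) b ^ r.toReal
      ≤ 2 ^ r.toReal * (‖b 0‖ₑ ^ r.toReal + ∑ s ∈ Finset.range K,
          if b (s + 1) ≠ b s then ‖b (s + 1)‖ₑ ^ r.toReal else 0) := by
  refine variationSeminorm_le_of_rpow hr hr1 fun M u hu huK => ?_
  have hp := one_le_toReal hr hr1
  set p := r.toReal
  set w : ℕ → ℝ≥0∞ := fun s => if b (s + 1) ≠ b s then ‖b (s + 1)‖ₑ ^ p else 0 with hw
  set W : ℕ → ℝ≥0∞ := fun n => ‖b 0‖ₑ ^ p + ∑ s ∈ Finset.range n, w s with hW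
  have hWadd : ∀ m n, m ≤ n → W n = W m + ∑ s ∈ Finset.Ico m n, w s := fun m n hmn => by
    simp only [hW]
    rw [add_assoc, Finset.sum_range_add_sum_Ico _ hmn]
  have h2 : (2 : ℝ≥0∞) ^ p = 2 ^ (p - 1) * 2 := by
    nth_rewrite 3 [← ENNReal.rpow_one 2]
    rw [← ENNReal.rpow_add _ _ two_ne_zero ENNReal.ofNat_ne_top, sub_add_cancel]
  have hWb : ∀ n, ‖b n‖ₑ ^ p ≤ W n := fun n => by
    by_cases h : b n = b 0
    · rw [h]; exact le_self_add
    · have := rpow_enorm_le_sum_changes b p (Nat.zero_le n) h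
      rw [Nat.Ico_zero_eq_range] at this
      exact this.trans le_add_self
  -- The last value is carried along on the left so that the induction telescopes.
  have key : ∀ (M : ℕ) (u : Fin (M + 1) → ℕ), StrictMono u →
      ∑ j : Fin M, ‖b (u j.succ) - b (u j.castSucc)‖ₑ ^ p
          + 2 ^ (p - 1) * ‖b (u (Fin.last M))‖ₑ ^ p ≤ 2 ^ p * W (u (Fin.last M)) := by
    intro M
    induction M with
    | zero =>
      intro u _
      rw [Finset.univ_eq_empty, Finset.sum_empty, zero_add]
      gcongr
      · exact one_le_two
      · linarith
      · exact hWb _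
    | succ M ih =>
      intro u hu
      have hlt : u (Fin.last M).castSucc < u (Fin.last (M + 1)) :=
        hu (Fin.castSucc_lt_last _)
      have ih' := ih (fun i => u i.castSucc) fun i j hij => hu (Fin.castSucc_lt_castSucc_iff.2 hij)
      rw [Fin.sum_univ_castSucc, hWadd _ _ hlt.le, mul_add]
      simp only [Fin.succ_castSucc, Fin.succ_last] at ih' ⊢
      set m := u (Fin.last M).castSucc
      set n := u (Fin.last (M + 1))
      set S := ∑ j : Fin M, ‖b (u j.succ.castSucc) - b (u j.castSucc.castSucc)‖ₑ ^ p
      by_cases h : b n = b m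
      · rw [h, sub_self, enorm_zero, ENNReal.zero_rpow_of_pos (by linarith), add_zero]
        exact ih'.trans le_self_add
      · calc S + ‖b n - b m‖ₑ ^ p + 2 ^ (p - 1) * ‖b n‖ₑ ^ p
            ≤ S + 2 ^ (p - 1) * (‖b n‖ₑ ^ p + ‖b m‖ₑ ^ p) + 2 ^ (p - 1) * ‖b n‖ₑ ^ p := by
              gcongr
              refine le_trans ?_ (ENNReal.rpow_add_le_mul_rpow_add_rpow _ _ hp)
              gcongr
              exact enorm_sub_le
          _ = (S + 2 ^ (p - 1) * ‖b m‖ₑ ^ p) + 2 ^ p * ‖b n‖ₑ ^ p := by rw [h2]; ring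
          _ ≤ _ := by
              gcongr
              exact rpow_enorm_le_sum_changes b p hlt.le h
  refine (le_self_add.trans (key M u hu)).trans ?_
  gcongr
  exact (le_self_add.trans (hWadd _ _ (huK (Fin.last M))).ge)

theorem variationSeminorm_rpow_le_sum {r : ℝ≥0∞} (hr : r ≠ ∞) (hr1 : 1 ≤ r) (K : ℕ) (b : ℕ → E) :
    variationSeminorm r (Set.Iic K) b ^ r.toReal
      ≤ 2 ^ r.toReal * ∑ n ∈ Finset.range (K + 1), ‖b n‖ₑ ^ r.toReal := by
  classical
  refine (variationSeminorm_rpow_le_sum_changes hr hr1 K b).trans ?_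
  rw [Finset.sum_range_succ', add_comm]
  gcongr
  split_ifs
  · exact le_rfl
  · exact zero_le

end Variation

section SquareNorm

variable {α : Type*} [MeasurableSpace α] {μ : Measure α}

theorem eLpNorm_two_sq (F : α → ℝ≥0∞) : eLpNorm F 2 μ ^ 2 = ∫⁻ x, F x ^ 2 ∂μ := by
  rw [eLpNorm_eq_lintegral_rpow_enorm_toReal two_ne_zero ENNReal.ofNat_ne_top]
  simp only [enorm_eq_self, ENNReal.toReal_ofNat]
  rw [← ENNReal.rpow_natCast, ← ENNReal.rpow_mul]
  norm_num

theorem eLpNorm_two_le_iff {F : α → ℝ≥0∞} {B : ℝ≥0∞} :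
    eLpNorm F 2 μ ≤ B ↔ ∫⁻ x, F x ^ 2 ∂μ ≤ B ^ 2 := by
  rw [← eLpNorm_two_sq, ENNReal.pow_le_pow_left_iff two_ne_zero]

/-- Fatou's lemma for the `L²` norm. -/
theorem eLpNorm_two_le_liminf {F : α → ℝ≥0∞} {G : ℕ → α → ℝ≥0∞}
    (hG : ∀ m, Measurable (G m)) (h : ∀ x, F x ≤ Filter.liminf (fun m => G m x) Filter.atTop) :
    eLpNorm F 2 μ ≤ Filter.liminf (fun m => eLpNorm (G m) 2 μ) Filter.atTop := by
  have hmono : Monotone fun y : ℝ≥0∞ => y ^ 2 := fun a b hab => pow_le_pow_left' hab 2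
  have hpow : ∀ u : ℕ → ℝ≥0∞, Filter.liminf u Filter.atTop ^ 2
      = Filter.liminf (fun m => u m ^ 2) Filter.atTop := fun u =>
    hmono.map_liminf_of_continuousAt (F := Filter.atTop) u (ENNReal.continuous_pow 2).continuousAt
  rw [eLpNorm_two_le_iff, hpow]
  simp only [eLpNorm_two_sq]
  calc ∫⁻ x, F x ^ 2 ∂μ ≤ ∫⁻ x, Filter.liminf (fun m => G m x ^ 2) Filter.atTop ∂μ :=
        lintegral_mono fun x => (pow_le_pow_left' (h x) 2).trans (hpow _).le
    _ ≤ Filter.liminf (fun m => ∫⁻ x, G m x ^ 2 ∂μ) Filter.atTop :=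
        lintegral_liminf_le fun m => (hG m).pow_const 2

end SquareNorm

/-! ### Greedy approximation of a sequence -/

section Greedy

variable {E : Type*} [NormedAddCommGroup E]

open Classical in
/-- The greedy step approximation of the sequence `F` with thresholds `T`: it keeps its value until
the distance to `F` exceeds the current threshold, and then it jumps to the current value of `F`. -/
noncomputable def greedy (F : ℕ → E) (T : ℕ → ℝ) : ℕ → E
  | 0 => F 0
  | n + 1 => if T (n + 1) < ‖F (n + 1) - greedy F T n‖ then F (n + 1) else greedy F T n

theorem norm_sub_greedy_le (F : ℕ → E) {T : ℕ → ℝ} (hT : ∀ n, 0 ≤ T n) (n : ℕ) :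
    ‖F n - greedy F T n‖ ≤ T n := by
  cases n with
  | zero => simpa [greedy] using hT 0
  | succ n =>
    rw [greedy]
    split_ifs with h
    · simpa using hT (n + 1)
    · exact not_lt.1 h

theorem greedy_succ_eq_or (F : ℕ → E) (T : ℕ → ℝ) (n : ℕ) :
    greedy F T (n + 1) = F (n + 1) ∨ greedy F T (n + 1) = greedy F T n := by
  rw [greedy]
  split_ifs <;> simp

theorem lt_norm_greedy_sub {F : ℕ → E} {T : ℕ → ℝ} {n : ℕ}
    (h : greedy F T (n + 1) ≠ greedy F T n) :
    T (n + 1) < ‖greedy F T (n + 1) - greedy F T n‖ := by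
  rw [greedy] at h ⊢
  split_ifs at h ⊢ with h1
  · exact h1
  · exact absurd rfl h

theorem greedy_eq_zero_index {F : ℕ → E} {T : ℕ → ℝ} (h : ∀ n, ‖F n - F 0‖ ≤ T n) (n : ℕ) :
    greedy F T n = F 0 := by
  induction n with
  | zero => rfl
  | succ n ih => rw [greedy, ih, if_neg (not_lt.2 (h _))]

/-- The greedy approximation at level `m`, with thresholds `2 * 2⁻ᵐ * T`. -/
noncomputable def approx (F : ℕ → E) (T : ℕ → ℝ) (m : ℕ) : ℕ → E :=
  greedy F fun n => 2 * (1 / 2) ^ m * T n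

/-- The difference of two successive greedy approximations. -/
noncomputable def layer (F : ℕ → E) (T : ℕ → ℝ) (m n : ℕ) : E :=
  approx F T (m + 1) n - approx F T m n

@[simp] theorem layer_zero_index (F : ℕ → E) (T : ℕ → ℝ) (m : ℕ) : layer F T m 0 = 0 := by
  simp [layer, approx, greedy]

theorem norm_layer_le (F : ℕ → E) {T : ℕ → ℝ} (hT : ∀ n, 0 ≤ T n) (m n : ℕ) :
    ‖layer F T m n‖ ≤ 3 * (1 / 2) ^ m * T n := by
  have hp : ∀ m : ℕ, ∀ n, 0 ≤ 2 * (1 / 2 : ℝ) ^ m * T n := fun m n => by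
    have := hT n; positivity
  have h1 := norm_sub_greedy_le F (hp (m + 1)) n
  have h2 := norm_sub_greedy_le F (hp m) n
  calc ‖layer F T m n‖ = ‖(F n - approx F T m n) - (F n - approx F T (m + 1) n)‖ := by
        rw [layer]; congr 1; abel
    _ ≤ _ := (norm_sub_le _ _).trans (add_le_add h2 h1)
    _ = _ := by ring

/-- When a layer changes its value, one of the two greedy approximations of which it is the difference
jumps, and a jump is larger than the threshold. -/
theorem rpow_le_of_layer_ne {F : ℕ → E} {T : ℕ → ℝ} (hT : ∀ n, 0 ≤ T n) {m n : ℕ}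
    (h : layer F T m (n + 1) ≠ layer F T m n) {p : ℝ} (hp : 0 ≤ p) :
    ENNReal.ofReal ((1 / 2) ^ m * T (n + 1)) ^ p
      ≤ ‖approx F T (m + 1) (n + 1) - approx F T (m + 1) n‖ₑ ^ p
        + ‖approx F T m (n + 1) - approx F T m n‖ₑ ^ p := by
  by_cases h1 : approx F T (m + 1) (n + 1) = approx F T (m + 1) n
  · by_cases h2 : approx F T m (n + 1) = approx F T m n
    · exact absurd (by rw [layer, layer, h1, h2]) h
    · refine le_trans ?_ le_add_self
      gcongr
      rw [← ofReal_norm]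
      gcongr
      refine le_trans ?_ (lt_norm_greedy_sub h2).le
      have : 0 ≤ (1 / 2 : ℝ) ^ m * T (n + 1) := mul_nonneg (by positivity) (hT _)
      linarith
  · refine le_trans ?_ le_self_add
    gcongr
    rw [← ofReal_norm]
    gcongr
    refine le_trans (le_of_eq ?_) (lt_norm_greedy_sub h1).le
    ring

theorem tendsto_approx (F : ℕ → E) {T : ℕ → ℝ} (hT : ∀ n, 0 ≤ T n) (n : ℕ) :
    Filter.Tendsto (fun m => approx F T m n) Filter.atTop (nhds (F n)) := by
  rw [tendsto_iff_norm_sub_tendsto_zero]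
  have h0 : Filter.Tendsto (fun m : ℕ => 2 * (1 / 2 : ℝ) ^ m * T n) Filter.atTop (nhds 0) := by
    have := ((tendsto_pow_atTop_nhds_zero_of_lt_one (r := (1 / 2 : ℝ)) (by norm_num)
      (by norm_num)).const_mul 2).mul_const (T n)
    simpa using this
  refine squeeze_zero (fun _ => norm_nonneg _) (fun m => ?_) h0
  rw [norm_sub_rev]
  exact norm_sub_greedy_le F (fun n => by have := hT n; positivity) n

/-- The coarsest approximation is constant, since no oscillation exceeds its thresholds. -/
theorem approx_zero_level {F : ℕ → E} {T : ℕ → ℝ} (h : ∀ n, ‖F n - F 0‖ ≤ 2 * T n) (n : ℕ) :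
    approx F T 0 n = F 0 :=
  greedy_eq_zero_index (fun n => by simpa using h n) n

theorem approx_eq_add_sum_layer {F : ℕ → E} {T : ℕ → ℝ} (h : ∀ n, ‖F n - F 0‖ ≤ 2 * T n)
    (m n : ℕ) : approx F T m n = F 0 + ∑ i ∈ Finset.range m, layer F T i n := by
  simp only [layer]
  rw [Finset.sum_range_sub (fun i => approx F T i n), approx_zero_level h]
  abel

end Greedy

section GreedyInner

/-- Each jump of the greedy approximation is one square of an orthogonal expansion: jumping resets
the distance `‖F n - A n‖` to zero. -/
theorem sum_greedy_sq_add (F : ℕ → ℂ) (T : ℕ → ℝ) (n : ℕ) :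
    ∑ i ∈ Finset.range n, ‖greedy F T (i + 1) - greedy F T i‖ ^ 2 + ‖F n - greedy F T n‖ ^ 2
      = ‖F n‖ ^ 2 - ‖F 0‖ ^ 2
        - 2 * ∑ i ∈ Finset.range n, (starRingEnd ℂ (greedy F T i) * (F (i + 1) - F i)).re := by
  induction n with
  | zero => simp [greedy]
  | succ n ih =>
    have key : ‖greedy F T (n + 1) - greedy F T n‖ ^ 2 + ‖F (n + 1) - greedy F T (n + 1)‖ ^ 2
        = ‖F (n + 1) - greedy F T n‖ ^ 2 := by
      rcases greedy_succ_eq_or F T n with h | h <;> rw [h] <;> simp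
    have hexp : ‖F (n + 1) - greedy F T n‖ ^ 2 - ‖F n - greedy F T n‖ ^ 2
        = ‖F (n + 1)‖ ^ 2 - ‖F n‖ ^ 2
          - 2 * (starRingEnd ℂ (greedy F T n) * (F (n + 1) - F n)).re := by
      simp only [← Complex.normSq_eq_norm_sq, Complex.normSq_apply, Complex.sub_re, Complex.sub_im,
        Complex.mul_re, Complex.conj_re, Complex.conj_im]
      ring
    rw [Finset.sum_range_succ, Finset.sum_range_succ]
    linarith

/-- The running maximum of the norms of a sequence. -/
noncomputable def runMax (F : ℕ → ℂ) : ℕ → ℝ := partialSups fun n => ‖F n‖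

theorem norm_le_runMax (F : ℕ → ℂ) {m n : ℕ} (h : m ≤ n) : ‖F m‖ ≤ runMax F n :=
  le_partialSups_of_le (fun n => ‖F n‖) h

theorem runMax_succ (F : ℕ → ℂ) (n : ℕ) : runMax F (n + 1) = max (runMax F n) ‖F (n + 1)‖ :=
  partialSups_add_one _ _

theorem runMax_nonneg (F : ℕ → ℂ) (n : ℕ) : 0 ≤ runMax F n :=
  (norm_nonneg _).trans (norm_le_runMax F le_rfl)

theorem runMax_mono (F : ℕ → ℂ) : Monotone (runMax F) := (partialSups _).monotone

theorem runMax_le_sum (F : ℕ → ℂ) (n : ℕ) : runMax F n ≤ ∑ i ∈ Finset.range (n + 1), ‖F i‖ := by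
  refine partialSups_le _ _ _ fun i hi => ?_
  exact Finset.single_le_sum (f := fun i => ‖F i‖) (fun _ _ => norm_nonneg _)
    (Finset.mem_range.2 (Nat.lt_succ_of_le hi))

/-- Summation by parts for the running maximum, which increases only when it is attained. -/
theorem runMax_sq_half_add (F : ℕ → ℂ) (n : ℕ) :
    runMax F n ^ 2 / 2 + ∑ i ∈ Finset.range n, runMax F i * (‖F (i + 1)‖ - ‖F i‖)
      ≤ runMax F n * ‖F n‖ := by
  induction n with
  | zero =>
    have : runMax F 0 = ‖F 0‖ := partialSups_zero _
    simp only [Finset.range_zero, Finset.sum_empty, this]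
    nlinarith [norm_nonneg (F 0)]
  | succ n ih =>
    rw [Finset.sum_range_succ, runMax_succ]
    rcases le_total ‖F (n + 1)‖ (runMax F n) with h | h
    · rw [max_eq_left h]
      linarith
    · rw [max_eq_right h]
      nlinarith [sq_nonneg (‖F (n + 1)‖ - runMax F n)]

/-- Pathwise form of Doob's `L²` maximal inequality: the sum on the right has mean zero when `F` is
a martingale. -/
theorem runMax_sq_le (F : ℕ → ℂ) (n : ℕ) :
    runMax F n ^ 2 ≤ 4 * ‖F n‖ ^ 2 - 4 * ∑ i ∈ Finset.range n,
      ((runMax F i : ℂ) * starRingEnd ℂ (F i / ‖F i‖) * (F (i + 1) - F i)).re := by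
  have h1 := runMax_sq_half_add F n
  have h2 : ∑ i ∈ Finset.range n,
      ((runMax F i : ℂ) * starRingEnd ℂ (F i / ‖F i‖) * (F (i + 1) - F i)).re
      ≤ ∑ i ∈ Finset.range n, runMax F i * (‖F (i + 1)‖ - ‖F i‖) := by
    refine Finset.sum_le_sum fun i _ => ?_
    rw [mul_assoc, Complex.re_ofReal_mul]
    refine mul_le_mul_of_nonneg_left ?_ (runMax_nonneg F i)
    rw [mul_sub, Complex.sub_re]
    have e1 : (starRingEnd ℂ (F i / ‖F i‖) * F i).re = ‖F i‖ := by
      rw [map_div₀, Complex.conj_ofReal, div_mul_eq_mul_div, Complex.conj_mul']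
      by_cases h : F i = 0
      · simp [h]
      · have : (‖F i‖ : ℂ) ≠ 0 := by simpa using h
        rw [pow_two, mul_div_assoc, div_self this, mul_one, Complex.ofReal_re]
    rw [e1]
    gcongr
    refine (Complex.re_le_norm _).trans ?_
    rw [norm_mul, RCLike.norm_conj]
    refine mul_le_of_le_one_left (norm_nonneg _) ?_
    rw [norm_div, Complex.norm_real, norm_norm]
    exact div_self_le_one _
  nlinarith [sq_nonneg (runMax F n / 2 - ‖F n‖)]

end GreedyInner

/-! ### Dyadic averages and Lépingle's inequality -/

section Grid

/-- The `i`-th interval of the grid of mesh `L`. -/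
def cell (L : ℝ) (i : ℤ) : Set ℝ := Set.Ico (L * i) (L * (i + 1))

theorem mem_cell {L : ℝ} (hL : 0 < L) {x : ℝ} {i : ℤ} : x ∈ cell L i ↔ ⌊x / L⌋ = i := by
  rw [cell, Set.mem_Ico, Int.floor_eq_iff, le_div_iff₀ hL, div_lt_iff₀ hL, mul_comm L, mul_comm L]

theorem measurableSet_cell (L : ℝ) (i : ℤ) : MeasurableSet (cell L i) := measurableSet_Ico

theorem volume_cell (L : ℝ) (i : ℤ) : volume (cell L i) = ENNReal.ofReal L := by
  rw [cell, Real.volume_Ico]; congr 1; ring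

theorem iUnion_cell {L : ℝ} (hL : 0 < L) : ⋃ i, cell L i = Set.univ :=
  Set.eq_univ_of_forall fun x => Set.mem_iUnion.2 ⟨⌊x / L⌋, (mem_cell hL).2 rfl⟩

theorem pairwise_disjoint_cell {L : ℝ} (hL : 0 < L) :
    Pairwise (Function.onFun Disjoint (cell L)) := by
  intro i j hij
  refine Set.disjoint_left.2 fun x hi hj => hij ?_
  rw [← (mem_cell hL).1 hi, (mem_cell hL).1 hj]

theorem lintegral_eq_tsum_cell {L : ℝ} (hL : 0 < L) (F : ℝ → ℝ≥0∞) :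
    ∫⁻ x, F x = ∑' i, ∫⁻ x in cell L i, F x := by
  rw [← lintegral_iUnion (measurableSet_cell L) (pairwise_disjoint_cell hL), iUnion_cell hL,
    setLIntegral_univ]

theorem integral_eq_tsum_cell {L : ℝ} (hL : 0 < L) {F : ℝ → ℂ} (hF : Integrable F) :
    ∫ x, F x = ∑' i, ∫ x in cell L i, F x := by
  rw [← integral_iUnion (measurableSet_cell L) (pairwise_disjoint_cell hL) hF.integrableOn,
    iUnion_cell hL, setIntegral_univ]

/-- `H` is constant on each interval of the grid of mesh `L`. -/
def GridConst {β : Type*} (L : ℝ) (H : ℝ → β) : Prop := ∃ η : ℤ → β, ∀ x, H x = η ⌊x / L⌋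

theorem GridConst.measurable {β : Type*} [MeasurableSpace β] {L : ℝ} {H : ℝ → β}
    (h : GridConst L H) : Measurable H := by
  obtain ⟨η, hη⟩ := h
  have : H = η ∘ fun x => ⌊x / L⌋ := funext hη
  rw [this]
  exact (measurable_from_top (f := η)).comp (Int.measurable_floor.comp (measurable_id.div_const L))

theorem GridConst.comp {β γ : Type*} {L : ℝ} {H : ℝ → β} (h : GridConst L H) (f : β → γ) :
    GridConst L fun x => f (H x) := by
  obtain ⟨η, hη⟩ := h
  exact ⟨fun i => f (η i), fun x => by simp only [hη]⟩

theorem GridConst.prodMk {β γ : Type*} {L : ℝ} {H : ℝ → β} {G : ℝ → γ} (h : GridConst L H)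
    (h' : GridConst L G) : GridConst L fun x => (H x, G x) := by
  obtain ⟨η, hη⟩ := h
  obtain ⟨ζ, hζ⟩ := h'
  exact ⟨fun i => (η i, ζ i), fun x => by simp only [hη, hζ]⟩

theorem GridConst.refine {β : Type*} {L L' : ℝ} {H : ℝ → β} (h : GridConst L' H) {d : ℕ}
    (hL : L' = L * d) : GridConst L H := by
  obtain ⟨η, hη⟩ := h
  refine ⟨fun i => η (i / d), fun x => ?_⟩
  rw [hη, hL, ← div_div, Int.floor_div_natCast]

/-- The average of `g` over the interval of the grid of mesh `L` containing `x`: the conditional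
expectation of `g` on that grid. -/
noncomputable def gridAvg (L : ℝ) (g : ℝ → ℂ) (x : ℝ) : ℂ :=
  (L : ℂ)⁻¹ * ∫ t in cell L ⌊x / L⌋, g t

theorem gridConst_gridAvg (L : ℝ) (g : ℝ → ℂ) : GridConst L (gridAvg L g) :=
  ⟨fun i => (L : ℂ)⁻¹ * ∫ t in cell L i, g t, fun _ => rfl⟩

theorem lintegral_gridAvg_sq_le {L : ℝ} (hL : 0 < L) {g : ℝ → ℂ} (hg : AEStronglyMeasurable g) :
    ∫⁻ x, ‖gridAvg L g x‖ₑ ^ 2 ≤ ∫⁻ x, ‖g x‖ₑ ^ 2 := by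
  rw [lintegral_eq_tsum_cell hL, lintegral_eq_tsum_cell hL (fun x => ‖g x‖ₑ ^ 2)]
  refine ENNReal.tsum_le_tsum fun i => ?_
  have h1 : ∀ x ∈ cell L i, ‖gridAvg L g x‖ₑ ^ 2
      = ‖(L : ℂ)⁻¹ * ∫ t in cell L i, g t‖ₑ ^ 2 := fun x hx => by
    rw [gridAvg, (mem_cell hL).1 hx]
  rw [setLIntegral_congr_fun (measurableSet_cell L i) h1, setLIntegral_const, volume_cell,
    enorm_mul, mul_pow]
  have hcs : ‖∫ t in cell L i, g t‖ₑ ^ 2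
      ≤ (∫⁻ t in cell L i, ‖g t‖ₑ ^ 2) * ENNReal.ofReal L := by
    have h2 := ENNReal.lintegral_mul_norm_pow_le (μ := volume.restrict (cell L i))
      (f := fun t => ‖g t‖ₑ ^ 2) (g := fun _ => 1) (hg.restrict.enorm.pow_const 2)
      aemeasurable_const (p := 1 / 2) (q := 1 / 2) (by norm_num) (by norm_num) (by norm_num)
    have h3 : ∀ y : ℝ≥0∞, (y ^ 2) ^ (1 / 2 : ℝ) = y := fun y => by
      rw [← ENNReal.rpow_natCast, ← ENNReal.rpow_mul]; norm_num
    have h4 : ∀ y : ℝ≥0∞, (y ^ (1 / 2 : ℝ)) ^ 2 = y := fun y => by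
      rw [← ENNReal.rpow_natCast, ← ENNReal.rpow_mul]; norm_num
    simp only [h3, ENNReal.one_rpow, mul_one, lintegral_const, one_mul, Measure.restrict_apply_univ,
      volume_cell] at h2
    calc ‖∫ t in cell L i, g t‖ₑ ^ 2 ≤ (∫⁻ t in cell L i, ‖g t‖ₑ) ^ 2 := by
          gcongr; exact enorm_integral_le_lintegral_enorm _
      _ ≤ _ := pow_le_pow_left' h2 2
      _ = _ := by rw [mul_pow, h4, h4]
  have hinv : ‖(L : ℂ)⁻¹‖ₑ = (ENNReal.ofReal L)⁻¹ := by
    rw [← ofReal_norm, norm_inv, Complex.norm_real, Real.norm_of_nonneg hL.le,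
      ENNReal.ofReal_inv_of_pos hL]
  have hL0 : ENNReal.ofReal L ≠ 0 := by simpa using hL
  have hc := ENNReal.inv_mul_cancel hL0 ENNReal.ofReal_ne_top
  rw [hinv]
  calc (ENNReal.ofReal L)⁻¹ ^ 2 * ‖∫ t in cell L i, g t‖ₑ ^ 2 * ENNReal.ofReal L
      ≤ (ENNReal.ofReal L)⁻¹ ^ 2 * ((∫⁻ t in cell L i, ‖g t‖ₑ ^ 2) * ENNReal.ofReal L)
          * ENNReal.ofReal L := by gcongr
    _ = ((ENNReal.ofReal L)⁻¹ * ENNReal.ofReal L) * ((ENNReal.ofReal L)⁻¹ * ENNReal.ofReal L)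
          * ∫⁻ t in cell L i, ‖g t‖ₑ ^ 2 := by ring
    _ = _ := by rw [hc, one_mul, one_mul]

theorem memLp_two_iff_lintegral {g : ℝ → ℂ} (hg : AEStronglyMeasurable g) :
    MemLp g 2 ↔ ∫⁻ x, ‖g x‖ₑ ^ 2 < ∞ := by
  have : eLpNorm g 2 volume ^ 2 = ∫⁻ x, ‖g x‖ₑ ^ 2 := by
    rw [← eLpNorm_two_sq, eLpNorm_enorm]
  rw [← this]
  constructor
  · intro h; exact ENNReal.pow_lt_top h.2
  · intro h; exact ⟨hg, by simpa using h⟩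

theorem memLp_gridAvg {L : ℝ} (hL : 0 < L) {g : ℝ → ℂ} (hg : MemLp g 2) :
    MemLp (gridAvg L g) 2 := by
  rw [memLp_two_iff_lintegral (gridConst_gridAvg L g).measurable.aestronglyMeasurable]
  exact (lintegral_gridAvg_sq_le hL hg.1).trans_lt ((memLp_two_iff_lintegral hg.1).1 hg)

theorem integral_mul_gridAvg {L : ℝ} (hL : 0 < L) {g H : ℝ → ℂ} (hg : MemLp g 2) (hH : MemLp H 2)
    (hc : GridConst L H) : ∫ x, H x * gridAvg L g x = ∫ x, H x * g x := by
  have e1 := integral_eq_tsum_cell hL (hH.integrable_mul (memLp_gridAvg hL hg))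
  have e2 := integral_eq_tsum_cell hL (hH.integrable_mul hg)
  simp only [Pi.mul_apply] at e1 e2
  rw [e1, e2]
  obtain ⟨η, hη⟩ := hc
  congr 1
  ext i
  have h1 : ∀ x ∈ cell L i, H x * gridAvg L g x = η i * ((L : ℂ)⁻¹ * ∫ t in cell L i, g t) :=
    fun x hx => by rw [gridAvg, hη, (mem_cell hL).1 hx]
  have h2 : ∀ x ∈ cell L i, H x * g x = η i * g x :=
    fun x hx => by rw [hη, (mem_cell hL).1 hx]
  rw [setIntegral_congr_fun (measurableSet_cell L i) h1,
    setIntegral_congr_fun (measurableSet_cell L i) h2, setIntegral_const, integral_const_mul,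
    measureReal_def, volume_cell, ENNReal.toReal_ofReal hL.le, Complex.real_smul]
  have : (L : ℂ) ≠ 0 := by exact_mod_cast hL.ne'
  field_simp

end Grid

section Martingale

variable {R : ℝ} {g : ℝ → ℂ}

/-- The dyadic martingale of `g`: the averages over the grids of mesh `R, R/2, R/4, …`. -/
noncomputable def dyadicAvg (R : ℝ) (g : ℝ → ℂ) (x : ℝ) (n : ℕ) : ℂ := gridAvg (R / 2 ^ n) g x

theorem gridConst_of_le {β : Type*} {H : ℝ → β} {m n : ℕ} (hmn : m ≤ n)
    (h : GridConst (R / 2 ^ m) H) : GridConst (R / 2 ^ n) H := by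
  refine h.refine (d := 2 ^ (n - m)) ?_
  have : (2 : ℝ) ^ n = 2 ^ m * 2 ^ (n - m) := by rw [← pow_add, Nat.add_sub_cancel' hmn]
  rw [this]
  push_cast
  field_simp

theorem gridConst_dyadicAvg {m n : ℕ} (hmn : m ≤ n) :
    GridConst (R / 2 ^ n) fun x => dyadicAvg R g x m :=
  gridConst_of_le hmn (gridConst_gridAvg _ g)

theorem memLp_dyadicAvg (hR : 0 < R) (hg : MemLp g 2) (n : ℕ) :
    MemLp (fun x => dyadicAvg R g x n) 2 :=
  memLp_gridAvg (by positivity) hg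

theorem integral_mul_dyadicAvg_sub (hR : 0 < R) (hg : MemLp g 2) {n : ℕ} {H : ℝ → ℂ}
    (hH : MemLp H 2) (hc : GridConst (R / 2 ^ n) H) :
    ∫ x, H x * (dyadicAvg R g x (n + 1) - dyadicAvg R g x n) = 0 := by
  simp only [mul_sub]
  have e := integral_sub (hH.integrable_mul (memLp_dyadicAvg hR hg (n + 1)))
    (hH.integrable_mul (memLp_dyadicAvg hR hg n))
  simp only [Pi.mul_apply] at e
  rw [e]
  simp only [dyadicAvg]
  rw [integral_mul_gridAvg (by positivity) hg hH hc, integral_mul_gridAvg (by positivity) hg hH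
    (gridConst_of_le n.le_succ hc), sub_self]

theorem gridConst_runMax {m n : ℕ} (hmn : m ≤ n) :
    GridConst (R / 2 ^ n) fun x => runMax (dyadicAvg R g x) m := by
  induction m with
  | zero =>
    have : ∀ x, runMax (dyadicAvg R g x) 0 = ‖dyadicAvg R g x 0‖ := fun x => partialSups_zero _
    simp only [this]
    exact (gridConst_dyadicAvg hmn).comp _
  | succ m ih =>
    simp only [runMax_succ]
    exact ((ih (m.le_succ.trans hmn)).prodMk (gridConst_dyadicAvg (g := g) hmn)).comp
      fun p => max p.1 ‖p.2‖

theorem gridConst_greedy (c : ℝ) {m n : ℕ} (hmn : m ≤ n) :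
    GridConst (R / 2 ^ n) fun x =>
      greedy (dyadicAvg R g x) (fun n => c * runMax (dyadicAvg R g x) n) m := by
  classical
  induction m with
  | zero => exact gridConst_dyadicAvg hmn
  | succ m ih =>
    simp only [greedy]
    exact (((gridConst_runMax (g := g) hmn).prodMk (gridConst_dyadicAvg (g := g) hmn)).prodMk
      (ih (m.le_succ.trans hmn))).comp
        fun p => if c * p.1.1 < ‖p.1.2 - p.2‖ then p.1.2 else p.2

theorem memLp_runMax (hR : 0 < R) (hg : MemLp g 2) (n : ℕ) :
    MemLp (fun x => runMax (dyadicAvg R g x) n) 2 := by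
  have h : MemLp (fun x => ∑ i ∈ Finset.range (n + 1), ‖dyadicAvg R g x i‖) 2 :=
    memLp_finsetSum _ fun i _ => (memLp_dyadicAvg hR hg i).norm
  refine h.of_le (gridConst_runMax le_rfl).measurable.aestronglyMeasurable
    (Filter.Eventually.of_forall fun x => ?_)
  rw [Real.norm_of_nonneg (runMax_nonneg _ _), Real.norm_of_nonneg (by positivity)]
  exact runMax_le_sum _ _

theorem memLp_greedy (hR : 0 < R) (hg : MemLp g 2) {c : ℝ} (hc : 0 ≤ c) (n : ℕ) :
    MemLp (fun x => greedy (dyadicAvg R g x) (fun n => c * runMax (dyadicAvg R g x) n) n) 2 := by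
  refine ((memLp_runMax hR hg n).const_mul (1 + c)).of_le
    (gridConst_greedy c le_rfl).measurable.aestronglyMeasurable
    (Filter.Eventually.of_forall fun x => ?_)
  have h0 := runMax_nonneg (dyadicAvg R g x)
  rw [Real.norm_of_nonneg (mul_nonneg (by positivity) (h0 n))]
  have h1 := norm_sub_greedy_le (dyadicAvg R g x) (T := fun n => c * runMax (dyadicAvg R g x) n)
    (fun n => mul_nonneg hc (h0 n)) n
  have h2 := norm_le_runMax (dyadicAvg R g x) (le_refl n)
  have h3 := norm_sub_norm_le (greedy (dyadicAvg R g x)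
    (fun n => c * runMax (dyadicAvg R g x) n) n) (dyadicAvg R g x n)
  rw [norm_sub_rev] at h3
  linarith

/-- A pathwise inequality up to a martingale transform gives an inequality in the mean. -/
theorem lintegral_le_of_martingale_transform (hR : 0 < R) (hg : MemLp g 2) {n : ℕ}
    {H : ℕ → ℝ → ℂ} (hH : ∀ i < n, MemLp (H i) 2) (hc : ∀ i < n, GridConst (R / 2 ^ i) (H i))
    {X : ℝ → ℝ} {c : ℝ} (hc0 : 0 ≤ c) (hX0 : ∀ x, 0 ≤ X x) (hXm : Measurable X)
    (hX : ∀ x, X x ≤ c * ‖dyadicAvg R g x n‖ ^ 2 - (∑ i ∈ Finset.range n,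
      H i x * (dyadicAvg R g x (i + 1) - dyadicAvg R g x i)).re) :
    ∫⁻ x, ENNReal.ofReal (X x) ≤ ENNReal.ofReal c * ∫⁻ x, ‖g x‖ₑ ^ 2 := by
  have hint1 : Integrable fun x => c * ‖dyadicAvg R g x n‖ ^ 2 :=
    ((memLp_dyadicAvg hR hg n).norm.integrable_sq).const_mul c
  have hterm : ∀ i < n, Integrable fun x =>
      H i x * (dyadicAvg R g x (i + 1) - dyadicAvg R g x i) := fun i hi =>
    (hH i hi).integrable_mul ((memLp_dyadicAvg hR hg _).sub (memLp_dyadicAvg hR hg _))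
  have hint2 : Integrable fun x => ∑ i ∈ Finset.range n,
      H i x * (dyadicAvg R g x (i + 1) - dyadicAvg R g x i) :=
    integrable_finsetSum _ fun i hi => hterm i (Finset.mem_range.1 hi)
  have hzero : ∫ x, (∑ i ∈ Finset.range n,
      H i x * (dyadicAvg R g x (i + 1) - dyadicAvg R g x i)).re = 0 := by
    have := integral_re hint2
    simp only [RCLike.re_to_complex] at this
    rw [this, integral_finsetSum _ fun i hi => hterm i (Finset.mem_range.1 hi)]
    rw [Finset.sum_eq_zero fun i hi => integral_mul_dyadicAvg_sub hR hg
      (hH i (Finset.mem_range.1 hi)) (hc i (Finset.mem_range.1 hi))]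
    simp
  have hintX : Integrable X := (hint1.sub hint2.re).mono' hXm.aestronglyMeasurable
    (Filter.Eventually.of_forall fun x => by
      rw [Real.norm_of_nonneg (hX0 x)]; exact hX x)
  have hle : ∫ x, X x ≤ ∫ x, c * ‖dyadicAvg R g x n‖ ^ 2 := by
    refine (integral_mono hintX (hint1.sub hint2.re) hX).trans ?_
    have := integral_sub hint1 hint2.re
    simp only [RCLike.re_to_complex] at this
    simp only [Pi.sub_apply, RCLike.re_to_complex]
    rw [this, hzero, sub_zero]
  rw [← ofReal_integral_eq_lintegral_ofReal hintX (Filter.Eventually.of_forall hX0)]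
  refine (ENNReal.ofReal_le_ofReal hle).trans ?_
  rw [ofReal_integral_eq_lintegral_ofReal hint1 (Filter.Eventually.of_forall fun x => by positivity)]
  calc ∫⁻ x, ENNReal.ofReal (c * ‖dyadicAvg R g x n‖ ^ 2)
      = ENNReal.ofReal c * ∫⁻ x, ‖dyadicAvg R g x n‖ₑ ^ 2 := by
        rw [← lintegral_const_mul' _ _ ENNReal.ofReal_ne_top]
        refine lintegral_congr fun x => ?_
        rw [ENNReal.ofReal_mul hc0, ENNReal.ofReal_pow (norm_nonneg _), ofReal_norm]
    _ ≤ _ := by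
        exact mul_le_mul_right (lintegral_gridAvg_sq_le (by positivity) hg.1) _

/-- Doob's maximal inequality for the dyadic martingale. -/
theorem lintegral_runMax_sq_le (hR : 0 < R) (hg : MemLp g 2) (n : ℕ) :
    ∫⁻ x, ENNReal.ofReal (runMax (dyadicAvg R g x) n) ^ 2 ≤ 4 * ∫⁻ x, ‖g x‖ₑ ^ 2 := by
  have h := lintegral_le_of_martingale_transform hR hg (n := n) (c := 4)
    (X := fun x => runMax (dyadicAvg R g x) n ^ 2)
    (H := fun i x => 4 * ((runMax (dyadicAvg R g x) i : ℂ)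
      * starRingEnd ℂ (dyadicAvg R g x i / ‖dyadicAvg R g x i‖)))
    (fun i _ => ?_) (fun i _ => ?_) (by norm_num) (fun x => by positivity)
    ((gridConst_runMax le_rfl).measurable.pow_const 2) (fun x => ?_)
  · simpa [ENNReal.ofReal_pow, runMax_nonneg] using h
  · refine ((memLp_runMax hR hg i).const_mul 4).of_le ?_ (Filter.Eventually.of_forall fun x => ?_)
    · exact (((gridConst_runMax (g := g) le_rfl).prodMk (gridConst_dyadicAvg (g := g) le_rfl)).comp
        fun p : ℝ × ℂ => 4 * ((p.1 : ℂ) * starRingEnd ℂ (p.2 / ‖p.2‖))).measurable.aestronglyMeasurable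
    · rw [norm_mul, norm_mul, norm_mul, RCLike.norm_conj, norm_div, Complex.norm_real,
        Complex.norm_real, norm_norm]
      simp only [Complex.norm_ofNat, Real.norm_ofNat]
      gcongr
      exact mul_le_of_le_one_right (norm_nonneg _) (div_self_le_one _)
  · exact ((gridConst_runMax (g := g) le_rfl).prodMk (gridConst_dyadicAvg (g := g) le_rfl)).comp
        fun p : ℝ × ℂ => 4 * ((p.1 : ℂ) * starRingEnd ℂ (p.2 / ‖p.2‖))
  · refine (runMax_sq_le (dyadicAvg R g x) n).trans (le_of_eq ?_)
    rw [Complex.re_sum, Finset.mul_sum]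
    congr 1
    refine Finset.sum_congr rfl fun i _ => ?_
    rw [mul_assoc 4, show (4 : ℂ) = ((4 : ℝ) : ℂ) by norm_num, Complex.re_ofReal_mul]

/-- The square function of the greedy approximations is bounded on `L²`, uniformly in the thresholds:
by `sum_greedy_sq_add` it is at most the square of the last average up to a martingale transform. -/
theorem lintegral_sum_greedy_sq_le (hR : 0 < R) (hg : MemLp g 2) {c : ℝ} (hc : 0 ≤ c) (n : ℕ) :
    ∫⁻ x, ∑ i ∈ Finset.range n,
      ‖greedy (dyadicAvg R g x) (fun n => c * runMax (dyadicAvg R g x) n) (i + 1)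
        - greedy (dyadicAvg R g x) (fun n => c * runMax (dyadicAvg R g x) n) i‖ₑ ^ 2
      ≤ ∫⁻ x, ‖g x‖ₑ ^ 2 := by
  have hm : ∀ i, Measurable fun x =>
      greedy (dyadicAvg R g x) (fun n => c * runMax (dyadicAvg R g x) n) i := fun i =>
    (gridConst_greedy c le_rfl).measurable
  have h := lintegral_le_of_martingale_transform hR hg (n := n) (c := 1)
    (X := fun x => ∑ i ∈ Finset.range n,
      ‖greedy (dyadicAvg R g x) (fun n => c * runMax (dyadicAvg R g x) n) (i + 1)
        - greedy (dyadicAvg R g x) (fun n => c * runMax (dyadicAvg R g x) n) i‖ ^ 2)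
    (H := fun i x => 2 * starRingEnd ℂ
      (greedy (dyadicAvg R g x) (fun n => c * runMax (dyadicAvg R g x) n) i))
    (fun i _ => ?_) (fun i _ => ?_) (by norm_num) (fun x => by positivity)
    (Finset.measurable_sum _ fun i _ => ((hm _).sub (hm _)).norm.pow_const 2) (fun x => ?_)
  · rw [ENNReal.ofReal_one, one_mul] at h
    refine le_trans (le_of_eq (lintegral_congr fun x => ?_)) h
    rw [ENNReal.ofReal_sum_of_nonneg fun _ _ => by positivity]
    refine Finset.sum_congr rfl fun i _ => ?_
    rw [ENNReal.ofReal_pow (norm_nonneg _), ofReal_norm]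
  · exact ((memLp_greedy hR hg hc i).star).const_mul 2
  · exact (gridConst_greedy c le_rfl).comp fun z : ℂ => 2 * starRingEnd ℂ z
  · have := sum_greedy_sq_add (dyadicAvg R g x) (fun n => c * runMax (dyadicAvg R g x) n) n
    have e : (∑ i ∈ Finset.range n, 2 * starRingEnd ℂ
        (greedy (dyadicAvg R g x) (fun n => c * runMax (dyadicAvg R g x) n) i)
          * (dyadicAvg R g x (i + 1) - dyadicAvg R g x i)).re
        = 2 * ∑ i ∈ Finset.range n, (starRingEnd ℂ
        (greedy (dyadicAvg R g x) (fun n => c * runMax (dyadicAvg R g x) n) i)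
          * (dyadicAvg R g x (i + 1) - dyadicAvg R g x i)).re := by
      rw [Complex.re_sum, Finset.mul_sum]
      refine Finset.sum_congr rfl fun i _ => ?_
      rw [mul_assoc 2, show (2 : ℂ) = ((2 : ℝ) : ℂ) by norm_num, Complex.re_ofReal_mul]
    rw [e]
    nlinarith [sq_nonneg ‖dyadicAvg R g x n
      - greedy (dyadicAvg R g x) (fun n => c * runMax (dyadicAvg R g x) n) n‖,
      sq_nonneg ‖dyadicAvg R g x 0‖]

theorem enorm_le_runMax (F : ℕ → ℂ) {m n : ℕ} (h : m ≤ n) :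
    ‖F m‖ₑ ≤ ENNReal.ofReal (runMax F n) := by
  rw [← ofReal_norm]
  exact ENNReal.ofReal_le_ofReal (norm_le_runMax F h)

theorem approx_runMax_eq (F : ℕ → ℂ) (m n : ℕ) :
    approx F (runMax F) m n = F 0 + ∑ i ∈ Finset.range m, layer F (runMax F) i n := by
  refine approx_eq_add_sum_layer (fun n => ?_) m n
  have := norm_sub_le (F n) (F 0)
  have h1 := norm_le_runMax F (le_refl n)
  have h2 := norm_le_runMax F (Nat.zero_le n)
  linarith

/-- Pathwise bound for the variation of one layer, by the running maximum and the squares of the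
jumps of the greedy approximations. The thresholds follow the running maximum. -/
theorem variationSeminorm_layer_le {r : ℝ≥0∞} (hr : r ≠ ∞) (hr2 : 2 ≤ r) (F : ℕ → ℂ) (m K : ℕ) :
    variationSeminorm r (Set.Iic K) (layer F (runMax F) m) ^ r.toReal
      ≤ 2 ^ r.toReal * ((3 ^ r.toReal * (ENNReal.ofReal ((1 / 2) ^ m * runMax F K)) ^ (r.toReal - 2))
        * (∑ i ∈ Finset.range K, ‖approx F (runMax F) (m + 1) (i + 1)
              - approx F (runMax F) (m + 1) i‖ₑ ^ 2
          + ∑ i ∈ Finset.range K, ‖approx F (runMax F) m (i + 1)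
              - approx F (runMax F) m i‖ₑ ^ 2)) := by
  classical
  have hr1 : 1 ≤ r := one_le_two.trans hr2
  have h0 := toReal_pos_of_one_le hr hr1
  have h2 : 2 ≤ r.toReal := by
    simpa using (ENNReal.toReal_le_toReal ENNReal.ofNat_ne_top hr).2 hr2
  refine (variationSeminorm_rpow_le_sum_changes hr hr1 K _).trans ?_
  refine mul_le_mul_right ?_ _
  rw [layer_zero_index, enorm_zero, ENNReal.zero_rpow_of_pos h0, zero_add, ← Finset.sum_add_distrib,
    Finset.mul_sum]
  refine Finset.sum_le_sum fun s hs => ?_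
  split_ifs with hch
  swap
  · exact zero_le
  have h3 := rpow_le_of_layer_ne (runMax_nonneg F) hch (p := 2) zero_le_two
  have hsq : ∀ x : ℝ≥0∞, x ^ (2 : ℝ) = x ^ (2 : ℕ) := fun x => by norm_cast
  simp only [hsq] at h3
  have hb : ‖layer F (runMax F) m (s + 1)‖ₑ
      ≤ 3 * ENNReal.ofReal ((1 / 2) ^ m * runMax F (s + 1)) := by
    rw [← ofReal_norm, show (3 : ℝ≥0∞) = ENNReal.ofReal 3 by simp, ← ENNReal.ofReal_mul (by norm_num),
      ← mul_assoc]
    exact ENNReal.ofReal_le_ofReal (norm_layer_le F (runMax_nonneg F) m (s + 1))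
  set y := ENNReal.ofReal ((1 / 2) ^ m * runMax F (s + 1))
  calc ‖layer F (runMax F) m (s + 1)‖ₑ ^ r.toReal ≤ (3 * y) ^ r.toReal := by gcongr
    _ = 3 ^ r.toReal * (y ^ (r.toReal - 2) * y ^ (2 : ℝ)) := by
        rw [ENNReal.mul_rpow_of_nonneg _ _ h0.le, ← ENNReal.rpow_add_of_nonneg _ _ (by linarith)
          (by norm_num), sub_add_cancel]
    _ = 3 ^ r.toReal * y ^ (r.toReal - 2) * y ^ 2 := by rw [hsq, mul_assoc]
    _ ≤ _ := by
        gcongr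
        exact ENNReal.ofReal_le_ofReal (mul_le_mul_of_nonneg_left
          (runMax_mono F (Finset.mem_range.1 hs)) (by positivity))

theorem measurable_dyadicAvg (n : ℕ) : Measurable fun x => dyadicAvg R g x n :=
  (gridConst_gridAvg _ g).measurable

theorem measurable_approx (m n : ℕ) : Measurable fun x =>
    approx (dyadicAvg R g x) (runMax (dyadicAvg R g x)) m n :=
  (gridConst_greedy _ le_rfl).measurable

theorem measurable_layer (m n : ℕ) : Measurable fun x =>
    layer (dyadicAvg R g x) (runMax (dyadicAvg R g x)) m n :=
  (measurable_approx _ _).sub (measurable_approx _ _)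

/-- The variation of the layers decays geometrically if `r > 2`, as this leaves a positive power of the
threshold in the pathwise bound; Hölder's inequality separates the maximal function from the square
functions. -/
theorem eLpNorm_variationSeminorm_layer_le {r : ℝ≥0∞} (hr : r ≠ ∞) (hr2 : 2 ≤ r) (hR : 0 < R)
    (hg : MemLp g 2) (m K : ℕ) :
    eLpNorm (fun x => variationSeminorm r (Set.Iic K)
        (layer (dyadicAvg R g x) (runMax (dyadicAvg R g x)) m)) 2 volume
      ≤ 12 * (ENNReal.ofReal ((1 / 2) ^ (1 - 2 / r.toReal))) ^ m * eLpNorm g 2 volume := by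
  have hr1 : 1 ≤ r := one_le_two.trans hr2
  have h0 := toReal_pos_of_one_le hr hr1
  have h2 : 2 ≤ r.toReal := by
    simpa using (ENNReal.toReal_le_toReal ENNReal.ofNat_ne_top hr).2 hr2
  set p := r.toReal
  have ha : 0 ≤ 1 - 2 / p := by
    rw [sub_nonneg, div_le_one h0]; exact h2
  rw [eLpNorm_two_le_iff]
  set G := ∫⁻ x, ‖g x‖ₑ ^ 2 with hG
  have hGe : eLpNorm g 2 volume ^ 2 = G := by rw [hG, ← eLpNorm_two_sq, eLpNorm_enorm]
  set S : ℕ → ℝ → ℝ≥0∞ := fun m x => ∑ i ∈ Finset.range K,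
    ‖approx (dyadicAvg R g x) (runMax (dyadicAvg R g x)) m (i + 1)
      - approx (dyadicAvg R g x) (runMax (dyadicAvg R g x)) m i‖ₑ ^ 2 with hS
  have hSm : ∀ m, Measurable (S m) := fun m => Finset.measurable_sum _ fun i _ =>
    ((measurable_approx _ _).sub (measurable_approx _ _)).enorm.pow_const 2
  have hSi : ∀ m, ∫⁻ x, S m x ≤ G := fun m =>
    lintegral_sum_greedy_sq_le hR hg (c := 2 * (1 / 2) ^ m) (by positivity) K
  set Y : ℝ → ℝ≥0∞ := fun x => ENNReal.ofReal (runMax (dyadicAvg R g x) K) with hY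
  have hYm : Measurable Y := (gridConst_runMax le_rfl).measurable.ennreal_ofReal
  have hsq : ∀ x : ℝ≥0∞, x ^ (2 : ℕ) = x ^ (2 : ℝ) := fun x => by norm_cast
  set ρ := ENNReal.ofReal ((1 / 2) ^ (1 - 2 / p)) with hρ
  -- The pathwise bound, raised to the power `2 / p`.
  have hpt : ∀ x, variationSeminorm r (Set.Iic K)
        (layer (dyadicAvg R g x) (runMax (dyadicAvg R g x)) m) ^ 2
      ≤ (36 * ρ ^ (2 * m)) * ((Y x ^ 2) ^ (1 - 2 / p) * (S (m + 1) x + S m x) ^ (2 / p)) := by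
    intro x
    have h := ENNReal.rpow_le_rpow (variationSeminorm_layer_le hr hr2 (dyadicAvg R g x) m K)
      (show 0 ≤ 2 / p by positivity)
    rw [← ENNReal.rpow_mul, mul_div_cancel₀ _ h0.ne', ← hsq] at h
    refine h.trans (le_of_eq ?_)
    have hexp : p * (2 / p) = 2 := by field_simp
    have hexp2 : (p - 2) * (2 / p) = 2 * (1 - 2 / p) := by field_simp
    rw [ENNReal.mul_rpow_of_nonneg _ _ (by positivity), ENNReal.mul_rpow_of_nonneg _ _ (by positivity),
      ENNReal.mul_rpow_of_nonneg _ _ (by positivity), ← ENNReal.rpow_mul, ← ENNReal.rpow_mul,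
      ← ENNReal.rpow_mul, hexp, hexp2, ENNReal.ofReal_mul (by positivity),
      ENNReal.mul_rpow_of_nonneg _ _ (by positivity)]
    have e1 : ENNReal.ofReal ((1 / 2) ^ m) ^ (2 * (1 - 2 / p)) = ρ ^ (2 * m) := by
      rw [hρ, ENNReal.ofReal_rpow_of_nonneg (by positivity) (by positivity),
        ← ENNReal.ofReal_pow (by positivity)]
      congr 1
      rw [← Real.rpow_natCast, ← Real.rpow_mul (by norm_num), ← Real.rpow_natCast,
        ← Real.rpow_mul (by norm_num)]
      congr 1
      push_cast
      ring
    have e2 : (Y x ^ 2) ^ (1 - 2 / p) = Y x ^ (2 * (1 - 2 / p)) := by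
      rw [hsq, ← ENNReal.rpow_mul]
    rw [e1, e2, ← hsq, ← hsq]
    simp only [hY, hS]
    rw [show (36 : ℝ≥0∞) = 2 ^ 2 * 3 ^ 2 by norm_num]
    ring
  refine (lintegral_mono hpt).trans ?_
  rw [lintegral_const_mul _ (by fun_prop)]
  have hhol := ENNReal.lintegral_mul_norm_pow_le (μ := volume) (f := fun x => Y x ^ 2)
    (g := fun x => S (m + 1) x + S m x) (hYm.pow_const 2).aemeasurable
    ((hSm _).add (hSm _)).aemeasurable ha (show 0 ≤ 2 / p by positivity) (by ring)
  have hS2 : ∫⁻ x, S (m + 1) x + S m x ≤ 4 * G := by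
    rw [lintegral_add_left (hSm _)]
    calc _ ≤ G + G := add_le_add (hSi _) (hSi _)
      _ = 2 * G := (two_mul G).symm
      _ ≤ 4 * G := by gcongr; norm_num
  calc 36 * ρ ^ (2 * m) * ∫⁻ x, (Y x ^ 2) ^ (1 - 2 / p) * (S (m + 1) x + S m x) ^ (2 / p)
      ≤ 36 * ρ ^ (2 * m) * ((4 * G) ^ (1 - 2 / p) * (4 * G) ^ (2 / p)) := by
        gcongr
        refine hhol.trans ?_
        gcongr
        exact lintegral_runMax_sq_le hR hg K
    _ = 36 * ρ ^ (2 * m) * (4 * G) := by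
        rw [← ENNReal.rpow_add_of_nonneg _ _ ha (by positivity), sub_add_cancel, ENNReal.rpow_one]
    _ = _ := by
        rw [mul_pow, mul_pow, hGe, ← pow_mul, mul_comm m 2]
        norm_num
        ring

/-- A telescoping series of sequences `G 0 + ∑ b i`, with `G 0` constant: the `L²` norm of the
variation of the limit is at most the sum of those of the terms. -/
theorem eLpNorm_variationSeminorm_le_tsum {α E : Type*} [MeasurableSpace α] {μ : Measure α}
    [NormedAddCommGroup E] [MeasurableSpace E] [BorelSpace E] [SecondCountableTopology E]
    {r : ℝ≥0∞} (hr : r ≠ ∞) (hr1 : 1 ≤ r) (K : Set ℕ) {F : α → ℕ → E} {G b : ℕ → α → ℕ → E}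
    {c : α → E} (hb : ∀ m n, Measurable fun x => b m x n) (hG : ∀ m n, Measurable fun x => G m x n)
    (hsum : ∀ m x n, G m x n = c x + ∑ i ∈ Finset.range m, b i x n)
    (hlim : ∀ x n, Filter.Tendsto (fun m => G m x n) Filter.atTop (nhds (F x n)))
    {B : ℕ → ℝ≥0∞} (hB : ∀ m, eLpNorm (fun x => variationSeminorm r K (b m x)) 2 μ ≤ B m) :
    eLpNorm (fun x => variationSeminorm r K (F x)) 2 μ ≤ ∑' m, B m := by
  refine (eLpNorm_two_le_liminf (G := fun m x => variationSeminorm r K (G m x))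
    (fun m => measurable_variationSeminorm hr K (hG m))
    (fun x => variationSeminorm_le_liminf hr (fun n hn => Filter.Eventually.of_forall fun _ => hn)
      fun n _ => hlim x n)).trans ?_
  refine (Filter.liminf_le_liminf (Filter.Eventually.of_forall fun m => ?_)).trans
    (Filter.liminf_const (∑' m, B m)).le
  calc eLpNorm (fun x => variationSeminorm r K (G m x)) 2 μ
      ≤ eLpNorm (∑ i ∈ Finset.range m, fun x => variationSeminorm r K (b i x)) 2 μ := by
        refine eLpNorm_mono_enorm fun x => ?_
        rw [enorm_eq_self, enorm_eq_self, Finset.sum_apply]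
        have : G m x = fun n => c x + ∑ i ∈ Finset.range m, b i x n := funext (hsum m x)
        rw [this]
        refine (variationSeminorm_add_le hr hr1 K (fun _ => c x) _).trans ?_
        rw [variationSeminorm_const hr hr1, zero_add]
        exact variationSeminorm_sum_le hr hr1 K _ _
    _ ≤ ∑ i ∈ Finset.range m, eLpNorm (fun x => variationSeminorm r K (b i x)) 2 μ :=
        eLpNorm_sum_le (fun i _ => (measurable_variationSeminorm hr K (hb i)).aestronglyMeasurable)
          one_le_two
    _ ≤ ∑ i ∈ Finset.range m, B i := Finset.sum_le_sum fun i _ => hB i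
    _ ≤ _ := ENNReal.sum_le_tsum _

/-- The constant in Lépingle's inequality. -/
noncomputable def lepingleConst (r : ℝ≥0∞) : ℝ≥0∞ :=
  12 * (1 - ENNReal.ofReal ((1 / 2) ^ (1 - 2 / r.toReal)))⁻¹

theorem lepingleConst_lt_top {r : ℝ≥0∞} (hr : r ≠ ∞) (hr2 : 2 < r) : lepingleConst r < ∞ := by
  have h2 : 2 < r.toReal := by
    simpa using (ENNReal.toReal_lt_toReal ENNReal.ofNat_ne_top hr).2 hr2
  have ha : 0 < 1 - 2 / r.toReal := by
    rw [sub_pos, div_lt_one (by linarith)]; exact h2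
  have : ENNReal.ofReal ((1 / 2) ^ (1 - 2 / r.toReal)) < 1 := by
    rw [ENNReal.ofReal_lt_one]
    exact Real.rpow_lt_one (by norm_num) (by norm_num) ha
  refine ENNReal.mul_lt_top (by norm_num) ?_
  rw [ENNReal.inv_lt_top]
  exact tsub_pos_of_lt this

/-- Lépingle's inequality in `L²` for the dyadic martingale. -/
theorem eLpNorm_variationSeminorm_dyadicAvg_le {r : ℝ≥0∞} (hr : r ≠ ∞) (hr2 : 2 ≤ r) (hR : 0 < R)
    (hg : MemLp g 2) (K : ℕ) :
    eLpNorm (fun x => variationSeminorm r (Set.Iic K) (dyadicAvg R g x)) 2 volume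
      ≤ lepingleConst r * eLpNorm g 2 volume := by
  refine (eLpNorm_variationSeminorm_le_tsum hr (one_le_two.trans hr2) (Set.Iic K)
    (G := fun m x => approx (dyadicAvg R g x) (runMax (dyadicAvg R g x)) m)
    (b := fun m x => layer (dyadicAvg R g x) (runMax (dyadicAvg R g x)) m)
    (c := fun x => dyadicAvg R g x 0)
    measurable_layer measurable_approx
    (fun m x n => approx_runMax_eq _ m n)
    (fun x n => tendsto_approx _ (runMax_nonneg _) n)
    fun m => eLpNorm_variationSeminorm_layer_le hr hr2 hR hg m K).trans (le_of_eq ?_)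
  rw [ENNReal.tsum_mul_right, ENNReal.tsum_mul_left, ENNReal.tsum_geometric, lepingleConst]

end Martingale

/-! ### The inverse Fourier transform and Plancherel's identity -/

section Fourier

/-- The character `t ↦ exp (2 π i t)`. -/
noncomputable def ex (t : ℝ) : ℂ := Real.fourierChar t

theorem ex_add (s t : ℝ) : ex (s + t) = ex s * ex t := by
  simp [ex, AddChar.map_add_eq_mul]

@[simp] theorem norm_ex (t : ℝ) : ‖ex t‖ = 1 := Circle.norm_coe _

@[simp] theorem enorm_ex (t : ℝ) : ‖ex t‖ₑ = 1 := by rw [← ofReal_norm]; simp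

theorem ex_eq (t : ℝ) : ex t = Complex.exp ((2 * Real.pi * t : ℝ) * Complex.I) :=
  Real.fourierChar_apply t

@[fun_prop]
theorem continuous_ex : Continuous ex :=
  continuous_subtype_val.comp Real.continuous_fourierChar

theorem norm_ex_sub_one_le (t : ℝ) : ‖ex t - 1‖ ≤ 2 * Real.pi * |t| := by
  rw [ex_eq, mul_comm _ Complex.I]
  refine (Real.norm_exp_I_mul_ofReal_sub_one_le (x := 2 * Real.pi * t)).trans (le_of_eq ?_)
  rw [Real.norm_eq_abs, abs_mul, abs_of_pos Real.two_pi_pos]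

/-- The inverse Fourier integral of a function on the frequency side. -/
noncomputable def invF (h : ℝ → ℂ) (x : ℝ) : ℂ := ∫ ξ, ex (ξ * x) * h ξ

theorem invF_eq (h : ℝ → ℂ) : invF h = 𝓕⁻ h := by
  ext x
  rw [Real.fourierInv_eq, invF]
  refine integral_congr_ae (Filter.Eventually.of_forall fun ξ => ?_)
  simp only [Circle.smul_def, smul_eq_mul, ex]
  congr 3
  simp [mul_comm]

theorem integrable_ex_mul {h : ℝ → ℂ} (hh : Integrable h) (x : ℝ) :
    Integrable fun ξ => ex (ξ * x) * h ξ :=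
  hh.bdd_mul (c := 1) (by fun_prop) (Filter.Eventually.of_forall fun ξ => by simp)

theorem continuous_invF {h : ℝ → ℂ} (hh : Integrable h) : Continuous (invF h) := by
  refine continuous_of_dominated (bound := fun ξ => ‖h ξ‖) (fun x => (integrable_ex_mul hh x).1)
    (fun x => Filter.Eventually.of_forall fun ξ => by simp) hh.norm
    (Filter.Eventually.of_forall fun ξ => by fun_prop)

theorem norm_invF_le (h : ℝ → ℂ) (x : ℝ) : ‖invF h x‖ ≤ ∫ ξ, ‖h ξ‖ := by
  refine (norm_integral_le_integral_norm _).trans (le_of_eq ?_)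
  simp

theorem invF_add {h h' : ℝ → ℂ} (hh : Integrable h) (hh' : Integrable h') (x : ℝ) :
    invF (fun ξ => h ξ + h' ξ) x = invF h x + invF h' x := by
  simp only [invF, mul_add]
  exact integral_add (integrable_ex_mul hh x) (integrable_ex_mul hh' x)

theorem invF_sum {ι : Type*} (s : Finset ι) {h : ι → ℝ → ℂ} (hh : ∀ i ∈ s, Integrable (h i))
    (x : ℝ) : invF (fun ξ => ∑ i ∈ s, h i ξ) x = ∑ i ∈ s, invF (h i) x := by
  simp only [invF, Finset.mul_sum]
  exact integral_finsetSum _ fun i hi => integrable_ex_mul (hh i hi) x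

theorem invF_const_mul (c : ℂ) (h : ℝ → ℂ) (x : ℝ) :
    invF (fun ξ => c * h ξ) x = c * invF h x := by
  simp only [invF]
  rw [← integral_const_mul]
  exact integral_congr_ae (Filter.Eventually.of_forall fun ξ => by ring)

/-- For functions in `L¹ ∩ L²`, the inverse Fourier integral represents the `L²` transform. -/
theorem invF_ae_eq {h : ℝ → ℂ} (h1 : Integrable h) (h2 : MemLp h 2) :
    (𝓕⁻ (h2.toLp h) : Lp ℂ 2 (volume : Measure ℝ)) =ᵐ[volume] invF h := by
  have hloc : LocallyIntegrable (𝓕⁻ (h2.toLp h) : Lp ℂ 2 (volume : Measure ℝ)) volume :=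
    (Lp.memLp _).locallyIntegrable one_le_two
  refine ae_eq_of_integral_contDiff_smul_eq hloc
    (continuous_invF h1).locallyIntegrable fun g hg hgs => ?_
  have hg' : HasCompactSupport fun x => (g x : ℂ) := hgs.comp_left (g := fun y : ℝ => (y : ℂ)) rfl
  set φ : 𝓢(ℝ, ℂ) := hg'.toSchwartzMap (Complex.ofRealCLM.contDiff.comp hg) with hφ
  have hφg : ∀ x, φ x = (g x : ℂ) := fun x => rfl
  have e1 := congrArg (fun T => T φ) (Lp.fourierInv_toTemperedDistribution_eq (h2.toLp h))
  simp only [TemperedDistribution.fourierInv_apply, Lp.toTemperedDistribution_apply] at e1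
  have e2 : ∫ x, g x • (𝓕⁻ (h2.toLp h) : Lp ℂ 2 (volume : Measure ℝ)) x
      = ∫ x, φ x • (𝓕⁻ (h2.toLp h) : Lp ℂ 2 (volume : Measure ℝ)) x := by
    simp [hφg]
  rw [e2, ← e1]
  have e3 : ∫ x, (𝓕⁻ φ) x • h2.toLp h x = ∫ x, (𝓕⁻ φ) x • h x := by
    refine integral_congr_ae ?_
    filter_upwards [h2.coeFn_toLp] with x hx
    rw [hx]
  rw [e3]
  have e4 : ∫ x, g x • invF h x = ∫ x, φ x • invF h x := by simp [hφg]
  rw [e4, invF_eq, SchwartzMap.fourierInv_coe]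
  refine (VectorFourier.integral_fourierIntegral_smul_eq_flip (L := -innerₗ ℝ)
    Real.continuous_fourierChar (by
      simp only [LinearMap.neg_apply, innerₗ_apply_apply]; fun_prop) φ.integrable h1).trans ?_
  refine integral_congr_ae (Filter.Eventually.of_forall fun x => ?_)
  simp only
  congr 1
  simp only [FourierTransformInv.fourierInv, VectorFourier.fourierIntegral, LinearMap.flip_apply,
    LinearMap.neg_apply, innerₗ_apply_apply, real_inner_comm]

/-- Plancherel's theorem on `L¹ ∩ L²`. -/
theorem lintegral_invF_sq {h : ℝ → ℂ} (h1 : Integrable h) (h2 : MemLp h 2) :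
    ∫⁻ x, ‖invF h x‖ₑ ^ 2 = ∫⁻ x, ‖h x‖ₑ ^ 2 := by
  have e : ∀ f : ℝ → ℂ, ∫⁻ x, ‖f x‖ₑ ^ 2 = eLpNorm f 2 volume ^ 2 := fun f => by
    rw [← eLpNorm_two_sq, eLpNorm_enorm]
  rw [e, e, ← eLpNorm_congr_ae (invF_ae_eq h1 h2), ← Lp.enorm_def, ← ofReal_norm]
  have : ‖(𝓕⁻ (h2.toLp h) : Lp ℂ 2 (volume : Measure ℝ))‖ = ‖h2.toLp h‖ := by
    rw [← Lp.norm_fourier_eq, FourierTransform.fourier_fourierInv_eq]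
  rw [this, ofReal_norm, Lp.enorm_toLp]

theorem memLp_invF {h : ℝ → ℂ} (h1 : Integrable h) (h2 : MemLp h 2) : MemLp (invF h) 2 := by
  rw [memLp_two_iff_lintegral (continuous_invF h1).aestronglyMeasurable, lintegral_invF_sq h1 h2]
  exact (memLp_two_iff_lintegral h2.1).1 h2

theorem invF_fourier (f : 𝓢(ℝ, ℂ)) (x : ℝ) : invF (𝓕 (f : ℝ → ℂ)) x = f x := by
  rw [invF_eq, ← SchwartzMap.fourier_coe, ← SchwartzMap.fourierInv_coe,
    FourierTransform.fourierInv_fourier_eq]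

theorem lintegral_fourier_sq (f : 𝓢(ℝ, ℂ)) :
    ∫⁻ x, ‖𝓕 (f : ℝ → ℂ) x‖ₑ ^ 2 = ∫⁻ x, ‖f x‖ₑ ^ 2 := by
  rw [← SchwartzMap.fourier_coe, ← lintegral_invF_sq (𝓕 f).integrable ((𝓕 f).memLp 2)]
  refine lintegral_congr fun x => ?_
  rw [SchwartzMap.fourier_coe, invF_fourier]

end Fourier

section AlmostOrthogonality

/-- Points are separated by more than `1`. -/
def Separated {N : ℕ} (ξ : Fin N → ℝ) : Prop := ∀ i j, i ≠ j → 1 < |ξ i - ξ j|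

/-- The transform of an interval of length `1 / 4` does not vanish on `[-1 / 2, 1 / 2]`. -/
theorem norm_integral_ex_ge {x : ℝ} (hx : |x| ≤ 1 / 2) :
    1 / 8 ≤ ‖∫ t in Set.Icc (-(1 / 8) : ℝ) (1 / 8), ex (t * x)‖ := by
  have hint : IntegrableOn (fun t => ex (t * x)) (Set.Icc (-(1 / 8) : ℝ) (1 / 8)) :=
    (by fun_prop : Continuous fun t => ex (t * x)).continuousOn.integrableOn_Icc
  refine le_trans ?_ (Complex.re_le_norm _)
  have := integral_re hint
  simp only [RCLike.re_to_complex] at this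
  rw [← this]
  have hre : ∀ t ∈ Set.Icc (-(1 / 8) : ℝ) (1 / 8), 1 / 2 ≤ (ex (t * x)).re := by
    intro t ht
    have h1 : ‖ex (t * x) - 1‖ ≤ 1 / 2 := by
      refine (norm_ex_sub_one_le _).trans ?_
      have : |t * x| ≤ 1 / 8 * (1 / 2) := by
        rw [abs_mul]
        exact mul_le_mul (abs_le.2 ht) hx (abs_nonneg _) (by norm_num)
      have hpi := Real.pi_lt_four
      nlinarith [Real.pi_pos, abs_nonneg (t * x)]
    have h2 := Complex.abs_re_le_norm (ex (t * x) - 1)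
    rw [Complex.sub_re, Complex.one_re] at h2
    linarith [(abs_le.1 (h2.trans h1)).1]
  have hmono := setIntegral_mono_on (μ := volume) (f := fun _ => (1 / 2 : ℝ))
    (g := fun t => (ex (t * x)).re) (by simp) hint.re measurableSet_Icc hre
  refine le_trans (le_of_eq ?_) hmono
  simp
  norm_num

/-- Exponentials with separated frequencies are almost orthogonal on intervals of length `1`. -/
theorem lintegral_exponential_sum_sq_le {N : ℕ} {ξ : Fin N → ℝ} (hξ : Separated ξ)
    (b : Fin N → ℂ) (c : ℝ) :
    ∫⁻ x in Set.Ico c (c + 1), ‖∑ j, b j * ex (ξ j * x)‖ₑ ^ 2 ≤ 16 * ∑ j, ‖b j‖ₑ ^ 2 := by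
  set J : Fin N → Set ℝ := fun j => Set.Icc (ξ j - 1 / 8) (ξ j + 1 / 8) with hJ
  -- The sum is compared with the inverse Fourier transform of a sum of bumps on disjoint intervals
  -- around the frequencies; the translation by `c'` is absorbed in the coefficients.
  set c' := c + 1 / 2 with hc'
  have hJd : ∀ i j, i ≠ j → ∀ x, x ∈ J i → x ∉ J j := by
    intro i j hij x hi hj
    have := hξ i j hij
    rw [lt_abs] at this
    rcases this with h | h <;> linarith [hi.1, hi.2, hj.1, hj.2]
  set h : Fin N → ℝ → ℂ := fun j => (J j).indicator fun _ => b j * ex (ξ j * c') with hh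
  have hJm : ∀ j, MeasurableSet (J j) := fun j => measurableSet_Icc
  have hJv : ∀ j, volume (J j) = ENNReal.ofReal (1 / 4) := fun j => by
    rw [hJ, Real.volume_Icc]; congr 1; ring
  have hint : ∀ j, Integrable (h j) := fun j => by
    refine (integrable_indicator_iff (hJm j)).2 (integrableOn_const ?_)
    rw [hJv]; exact ENNReal.ofReal_ne_top
  have hL2 : ∀ j, MemLp (h j) 2 := fun j =>
    memLp_indicator_const 2 (hJm j) _ (Or.inr (by rw [hJv]; exact ENNReal.ofReal_ne_top))
  have hval : ∀ x, invF (fun ξ => ∑ j, h j ξ) (x - c')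
      = (∫ t in Set.Icc (-(1 / 8) : ℝ) (1 / 8), ex (t * (x - c'))) * ∑ j, b j * ex (ξ j * x) := by
    intro x
    rw [invF_sum _ fun j _ => hint j, Finset.mul_sum]
    refine Finset.sum_congr rfl fun j _ => ?_
    have e1 : ∀ t, ex (t * (x - c')) * h j t
        = (J j).indicator (fun t => ex (t * (x - c')) * (b j * ex (ξ j * c'))) t := fun t => by
      simp only [hh, Set.indicator]
      split_ifs <;> simp
    rw [invF]
    simp only [e1]
    rw [integral_indicator (hJm j), ← integral_mul_const]
    have e2 : ∫ t in Set.Icc (-(1 / 8) : ℝ) (1 / 8), ex (t * (x - c')) * (b j * ex (ξ j * x))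
        = ∫ t in Set.Icc (-(1 / 8) : ℝ) (1 / 8),
            (fun t => ex (t * (x - c')) * (b j * ex (ξ j * c'))) (t + ξ j) := by
      refine integral_congr_ae (Filter.Eventually.of_forall fun t => ?_)
      simp only
      have : ex (ξ j * x) = ex (ξ j * (x - c')) * ex (ξ j * c') := by
        rw [← ex_add]; congr 1; ring
      rw [this, add_mul, ex_add]
      ring
    rw [e2, integral_Icc_eq_integral_Ioc, integral_Icc_eq_integral_Ioc,
      ← intervalIntegral.integral_of_le (by linarith), ← intervalIntegral.integral_of_le (by norm_num),
      intervalIntegral.integral_comp_add_right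
        (fun t => ex (t * (x - c')) * (b j * ex (ξ j * c')))]
    congr 1 <;> ring
  have hpl := lintegral_invF_sq (integrable_finsetSum _ fun j (_ : j ∈ Finset.univ) => hint j)
    (memLp_finsetSum _ fun j (_ : j ∈ Finset.univ) => hL2 j)
  have hR : ∫⁻ x, ‖∑ j, h j x‖ₑ ^ 2 = ENNReal.ofReal (1 / 4) * ∑ j, ‖b j‖ₑ ^ 2 := by
    have e1 : ∀ x, ‖∑ j, h j x‖ₑ ^ 2 = ∑ j, (J j).indicator (fun _ => ‖b j‖ₑ ^ 2) x := by
      intro x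
      by_cases hx : ∃ j, x ∈ J j
      · obtain ⟨j, hj⟩ := hx
        rw [Finset.sum_eq_single j, Finset.sum_eq_single j]
        · simp [hh, Set.indicator_of_mem hj]
        · intro i _ hij
          exact Set.indicator_of_notMem (fun hi => hJd i j hij x hi hj) _
        · simp
        · intro i _ hij
          exact Set.indicator_of_notMem (fun hi => hJd i j hij x hi hj) _
        · simp
      · push Not at hx
        simp [hh, Set.indicator_of_notMem (hx _)]
    simp only [e1]
    rw [lintegral_finsetSum _ fun j _ => measurable_const.indicator (hJm j), Finset.mul_sum]
    refine Finset.sum_congr rfl fun j _ => ?_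
    rw [lintegral_indicator_const (hJm j), hJv, mul_comm]
  have hge : ∀ x ∈ Set.Ico c (c + 1), ‖∑ j, b j * ex (ξ j * x)‖ₑ ^ 2
      ≤ 64 * ‖invF (fun ξ => ∑ j, h j ξ) (x - c')‖ₑ ^ 2 := by
    intro x hx
    have hx' : |x - c'| ≤ 1 / 2 := by
      rw [abs_le, hc']; constructor <;> linarith [hx.1, hx.2]
    have h8 : (1 : ℝ≥0∞) ≤ 8 * ‖∫ t in Set.Icc (-(1 / 8) : ℝ) (1 / 8), ex (t * (x - c'))‖ₑ := by
      rw [← ofReal_norm, show (8 : ℝ≥0∞) = ENNReal.ofReal 8 by simp, ← ENNReal.ofReal_mul (by norm_num),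
        ENNReal.one_le_ofReal]
      linarith [norm_integral_ex_ge hx']
    rw [hval, enorm_mul, mul_pow, ← mul_assoc]
    refine le_mul_of_one_le_left zero_le ?_
    calc (1 : ℝ≥0∞) = 1 ^ 2 := by norm_num
      _ ≤ (8 * ‖∫ t in Set.Icc (-(1 / 8) : ℝ) (1 / 8), ex (t * (x - c'))‖ₑ) ^ 2 := by gcongr
      _ = _ := by rw [mul_pow]; norm_num
  calc ∫⁻ x in Set.Ico c (c + 1), ‖∑ j, b j * ex (ξ j * x)‖ₑ ^ 2
      ≤ ∫⁻ x in Set.Ico c (c + 1), 64 * ‖invF (fun ξ => ∑ j, h j ξ) (x - c')‖ₑ ^ 2 :=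
        setLIntegral_mono' measurableSet_Ico hge
    _ ≤ ∫⁻ x, 64 * ‖invF (fun ξ => ∑ j, h j ξ) (x - c')‖ₑ ^ 2 := setLIntegral_le_lintegral _ _
    _ = 64 * ∫⁻ x, ‖invF (fun ξ => ∑ j, h j ξ) x‖ₑ ^ 2 := by
        rw [lintegral_const_mul' _ _ (by norm_num),
          lintegral_sub_right_eq_self fun x => ‖invF (fun ξ => ∑ j, h j ξ) x‖ₑ ^ 2]
    _ = 64 * (ENNReal.ofReal (1 / 4) * ∑ j, ‖b j‖ₑ ^ 2) := by rw [hpl, hR]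
    _ = _ := by
        rw [← mul_assoc]
        congr 1
        rw [show (64 : ℝ≥0∞) = ENNReal.ofReal 64 by simp, ← ENNReal.ofReal_mul (by norm_num)]
        norm_num

end AlmostOrthogonality

/-! ### Variation of exponential sums on an interval -/

section Jumps

variable {E : Type*} [NormedAddCommGroup E]

/-- The values of the greedy approximation are values of `F` along an increasing sequence of
indices, so that its jumps compete in the definition of the variation of `F`. -/
theorem exists_strictMono_sum_greedy (F : ℕ → E) (T : ℕ → ℝ) {p : ℝ} (hp : 0 < p) (n : ℕ) :
    ∃ (M : ℕ) (u : Fin (M + 1) → ℕ), StrictMono u ∧ u (Fin.last M) ≤ n ∧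
      F (u (Fin.last M)) = greedy F T n ∧
      ∑ j : Fin M, ‖F (u j.succ) - F (u j.castSucc)‖ₑ ^ p
        = ∑ i ∈ Finset.range n, ‖greedy F T (i + 1) - greedy F T i‖ₑ ^ p := by
  induction n with
  | zero =>
    exact ⟨0, fun _ => 0, Fin.strictMono_iff_lt_succ.2 fun i => i.elim0, le_rfl, rfl, by simp⟩
  | succ n ih =>
    obtain ⟨M, u, hu, hun, hF, hsum⟩ := ih
    by_cases h : greedy F T (n + 1) = greedy F T n
    · refine ⟨M, u, hu, hun.trans n.le_succ, by rw [hF, h], ?_⟩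
      rw [Finset.sum_range_succ, hsum, h]
      simp [hp]
    · have hjump : greedy F T (n + 1) = F (n + 1) := (greedy_succ_eq_or F T n).resolve_right h
      refine ⟨M + 1, Fin.snoc (α := fun _ => ℕ) u (n + 1), ?_, by simp, by simp [hjump], ?_⟩
      · rw [Fin.strictMono_iff_lt_succ]
        intro i
        refine Fin.lastCases ?_ (fun i => ?_) i
        · rw [Fin.succ_last, Fin.snoc_last, Fin.snoc_castSucc]
          omega
        · rw [Fin.succ_castSucc, Fin.snoc_castSucc, Fin.snoc_castSucc]
          exact hu Fin.castSucc_lt_succ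
      · rw [Fin.sum_univ_castSucc, Finset.sum_range_succ, ← hsum]
        simp only [Fin.succ_last, Fin.snoc_last, Fin.succ_castSucc, Fin.snoc_castSucc]
        rw [hjump, hF]

theorem sum_greedy_rpow_le {r : ℝ≥0∞} (hr : r ≠ ∞) (hr1 : 1 ≤ r) (F : ℕ → E) (T : ℕ → ℝ) (n : ℕ) :
    ∑ i ∈ Finset.range n, ‖greedy F T (i + 1) - greedy F T i‖ₑ ^ r.toReal
      ≤ variationSeminorm r (Set.Iic n) F ^ r.toReal := by
  obtain ⟨M, u, hu, hun, -, hsum⟩ :=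
    exists_strictMono_sum_greedy F T (toReal_pos_of_one_le hr hr1) n
  rw [← hsum]
  exact sum_rpow_le_variationSeminorm_rpow hr hr1 F hu
    fun i => (hu.monotone (Fin.le_last i)).trans hun

end Jumps

section GeometricSum

/-- Two competing geometric progressions, which balance where `2 ^ m = X`. -/
theorem tsum_min_le {α β X : ℝ} (hα : 0 < α) (hβ : 0 < β) (hX : 1 ≤ X) :
    ∑' m : ℕ, ENNReal.ofReal (min (((2 : ℝ) ^ m) ^ β) (X ^ (α + β) * ((2 : ℝ) ^ m) ^ (-α)))
      ≤ ENNReal.ofReal (X ^ β) * ((1 - ENNReal.ofReal (2 ^ (-β)))⁻¹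
          + (1 - ENNReal.ofReal (2 ^ (-α)))⁻¹) := by
  obtain ⟨k, hk1, hk2⟩ := exists_nat_pow_near hX (one_lt_two : (1 : ℝ) < 2)
  have hX0 : 0 < X := by linarith
  have hsplit : ∀ f : ℕ → ℝ≥0∞,
      ∑' m, f m = ∑ m ∈ Finset.range (k + 1), f m + ∑' i, f (i + (k + 1)) := fun f =>
    ENNReal.summable.sum_add_tsum_nat_add'.symm
  rw [hsplit, mul_add]
  refine add_le_add ?_ ?_
  · rw [← Finset.sum_range_reflect, ← ENNReal.tsum_geometric, ← ENNReal.tsum_mul_left]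
    refine le_trans (Finset.sum_le_sum fun m hm => ?_) (ENNReal.sum_le_tsum (Finset.range (k + 1)))
    have hm' : m ≤ k := Nat.lt_succ_iff.1 (Finset.mem_range.1 hm)
    rw [← ENNReal.ofReal_pow (by positivity), ← ENNReal.ofReal_mul (by positivity)]
    refine ENNReal.ofReal_le_ofReal ((min_le_left _ _).trans ?_)
    have e1 : (2 : ℝ) ^ (k + 1 - 1 - m) = 2 ^ k / 2 ^ m := by
      rw [Nat.add_sub_cancel, pow_sub₀ _ two_ne_zero hm', div_eq_mul_inv]
    have e2 : ((2 : ℝ) ^ (-β)) ^ m = (((2 : ℝ) ^ m) ^ β)⁻¹ := by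
      rw [← Real.rpow_natCast, ← Real.rpow_natCast, ← Real.rpow_mul (by norm_num),
        ← Real.rpow_mul (by norm_num), ← Real.rpow_neg (by norm_num)]
      congr 1
      ring
    rw [e1, e2, Real.div_rpow (by positivity) (by positivity), div_eq_mul_inv]
    gcongr
  · rw [← ENNReal.tsum_geometric, ← ENNReal.tsum_mul_left]
    refine ENNReal.tsum_le_tsum fun i => ?_
    rw [← ENNReal.ofReal_pow (by positivity), ← ENNReal.ofReal_mul (by positivity)]
    refine ENNReal.ofReal_le_ofReal ((min_le_right _ _).trans ?_)
    have e2 : ((2 : ℝ) ^ (-α)) ^ i = ((2 : ℝ) ^ i) ^ (-α) := by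
      rw [← Real.rpow_natCast, ← Real.rpow_natCast, ← Real.rpow_mul (by norm_num),
        ← Real.rpow_mul (by norm_num)]
      congr 1
      ring
    have e3 : (2 : ℝ) ^ (i + (k + 1)) = 2 ^ i * 2 ^ (k + 1) := by rw [pow_add]
    rw [e2, e3, Real.mul_rpow (by positivity) (by positivity), Real.rpow_add hX0]
    have e4 : X ^ α * ((2 : ℝ) ^ (k + 1)) ^ (-α) ≤ 1 := by
      rw [Real.rpow_neg (by positivity), ← div_eq_mul_inv, div_le_one (by positivity)]
      exact Real.rpow_le_rpow hX0.le hk2.le hα.le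
    calc X ^ α * X ^ β * (((2 : ℝ) ^ i) ^ (-α) * ((2 : ℝ) ^ (k + 1)) ^ (-α))
        = (X ^ α * ((2 : ℝ) ^ (k + 1)) ^ (-α)) * (X ^ β * ((2 : ℝ) ^ i) ^ (-α)) := by ring
      _ ≤ 1 * (X ^ β * ((2 : ℝ) ^ i) ^ (-α)) := by gcongr
      _ = _ := one_mul _

end GeometricSum

section ExponentialSums

variable {N : ℕ}

/-- The exponential sum with frequencies `ξ` and coefficients `v`. -/
noncomputable def expSum (ξ : Fin N → ℝ) (v : EuclideanSpace ℂ (Fin N)) (x : ℝ) : ℂ :=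
  ∑ j, v j * ex (ξ j * x)

theorem expSum_sub (ξ : Fin N → ℝ) (v w : EuclideanSpace ℂ (Fin N)) (x : ℝ) :
    expSum ξ (v - w) x = expSum ξ v x - expSum ξ w x := by
  simp [expSum, sub_mul]

theorem expSum_add (ξ : Fin N → ℝ) (v w : EuclideanSpace ℂ (Fin N)) (x : ℝ) :
    expSum ξ (v + w) x = expSum ξ v x + expSum ξ w x := by
  simp [expSum, add_mul, Finset.sum_add_distrib]

theorem expSum_sum (ξ : Fin N → ℝ) {ι : Type*} (s : Finset ι) (v : ι → EuclideanSpace ℂ (Fin N))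
    (x : ℝ) : expSum ξ (∑ i ∈ s, v i) x = ∑ i ∈ s, expSum ξ (v i) x := by
  classical
  induction s using Finset.induction_on with
  | empty => simp [expSum]
  | insert a s ha ih => rw [Finset.sum_insert ha, Finset.sum_insert ha, expSum_add, ih]

theorem continuous_expSum_left (ξ : Fin N → ℝ) (x : ℝ) : Continuous fun v => expSum ξ v x := by
  unfold expSum
  fun_prop

theorem measurable_expSum (ξ : Fin N → ℝ) (v : EuclideanSpace ℂ (Fin N)) :
    Measurable (expSum ξ v) := by
  unfold expSum
  exact (by fun_prop : Continuous fun x => ∑ j, v j * ex (ξ j * x)).measurable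

theorem norm_expSum_le (ξ : Fin N → ℝ) (v : EuclideanSpace ℂ (Fin N)) (x : ℝ) :
    ‖expSum ξ v x‖ ≤ √N * ‖v‖ := by
  have h1 : ‖expSum ξ v x‖ ≤ ∑ j, ‖v j‖ := by
    refine (norm_sum_le _ _).trans (le_of_eq ?_)
    simp
  have h2 : (∑ j, ‖v j‖) ^ 2 ≤ N * ∑ j, ‖v j‖ ^ 2 := by
    simpa using sq_sum_le_card_mul_sum_sq (s := Finset.univ) (f := fun j => ‖v j‖)
  refine h1.trans ?_
  rw [EuclideanSpace.norm_eq, ← Real.sqrt_mul (by positivity)]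
  exact Real.le_sqrt_of_sq_le h2

theorem enorm_sq_eq_sum (v : EuclideanSpace ℂ (Fin N)) : ‖v‖ₑ ^ 2 = ∑ j, ‖v j‖ₑ ^ 2 := by
  rw [← ofReal_norm, ← ENNReal.ofReal_pow (norm_nonneg _), EuclideanSpace.norm_sq_eq,
    ENNReal.ofReal_sum_of_nonneg (fun _ _ => by positivity)]
  refine Finset.sum_congr rfl fun j _ => ?_
  rw [ENNReal.ofReal_pow (norm_nonneg _), ofReal_norm]

theorem lintegral_expSum_sq_le {ξ : Fin N → ℝ} (hξ : Separated ξ) (v : EuclideanSpace ℂ (Fin N))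
    (c : ℝ) : ∫⁻ x in Set.Ico c (c + 1), ‖expSum ξ v x‖ₑ ^ 2 ≤ 16 * ‖v‖ₑ ^ 2 := by
  rw [enorm_sq_eq_sum]
  exact lintegral_exponential_sum_sq_le hξ _ c

open Classical in
/-- The indices `s < K` at which a sequence changes its value between `s` and `s + 1`. -/
noncomputable def changes {E : Type*} (b : ℕ → E) (K : ℕ) : Finset ℕ :=
  (Finset.range K).filter fun s => b (s + 1) ≠ b s

/-- The number of changes of value of a layer is bounded in terms of the variation. -/
theorem card_changes_layer_le {E : Type*} [NormedAddCommGroup E] {r : ℝ≥0∞} (hr : r ≠ ∞)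
    (hr1 : 1 ≤ r) (F : ℕ → E) (K : ℕ) {V : ℝ} (hV : 0 < V)
    (hVe : variationSeminorm r (Set.Iic K) F ≤ ENNReal.ofReal V) (m : ℕ) :
    ((changes (layer F (fun _ => V) m) K).card : ℝ) ≤ 2 * ((2 : ℝ) ^ m) ^ r.toReal := by
  have h0 := toReal_pos_of_one_le hr hr1
  set S := changes (layer F (fun _ => V) m) K
  have hJ : ∀ m, ∑ i ∈ Finset.range K, ‖approx F (fun _ => V) m (i + 1)
      - approx F (fun _ => V) m i‖ₑ ^ r.toReal ≤ ENNReal.ofReal V ^ r.toReal := fun m =>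
    (sum_greedy_rpow_le hr hr1 F _ K).trans (ENNReal.rpow_le_rpow hVe h0.le)
  have h1 : (S.card : ℝ≥0∞) * ENNReal.ofReal ((1 / 2) ^ m * V) ^ r.toReal
      ≤ 2 * ENNReal.ofReal V ^ r.toReal := by
    rw [← nsmul_eq_mul, ← Finset.sum_const]
    calc ∑ _s ∈ S, ENNReal.ofReal ((1 / 2) ^ m * V) ^ r.toReal
        ≤ ∑ s ∈ S, (‖approx F (fun _ => V) (m + 1) (s + 1) - approx F (fun _ => V) (m + 1) s‖ₑ
              ^ r.toReal
            + ‖approx F (fun _ => V) m (s + 1) - approx F (fun _ => V) m s‖ₑ ^ r.toReal) :=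
          Finset.sum_le_sum fun s hs =>
            rpow_le_of_layer_ne (fun _ => hV.le) (by classical exact (Finset.mem_filter.1 hs).2) h0.le
      _ ≤ ∑ s ∈ Finset.range K, (‖approx F (fun _ => V) (m + 1) (s + 1)
              - approx F (fun _ => V) (m + 1) s‖ₑ ^ r.toReal
            + ‖approx F (fun _ => V) m (s + 1) - approx F (fun _ => V) m s‖ₑ ^ r.toReal) :=
          Finset.sum_le_sum_of_subset (by classical exact Finset.filter_subset _ _)
      _ ≤ _ := by
          rw [Finset.sum_add_distrib, two_mul]
          exact add_le_add (hJ _) (hJ _)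
  have hpos : (0 : ℝ) < (1 / 2) ^ m * V := by positivity
  rw [ENNReal.ofReal_rpow_of_pos hpos, ENNReal.ofReal_rpow_of_pos hV,
    ← ENNReal.ofReal_natCast, ← ENNReal.ofReal_mul (by positivity),
    show (2 : ℝ≥0∞) = ENNReal.ofReal 2 by simp, ← ENNReal.ofReal_mul (by norm_num),
    ENNReal.ofReal_le_ofReal_iff (by positivity), Real.mul_rpow (by positivity) hV.le,
    ← mul_assoc] at h1
  have h2 := le_of_mul_le_mul_right h1 (by positivity)
  rw [one_div, inv_pow, Real.inv_rpow (by positivity), ← div_eq_mul_inv,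
    div_le_iff₀ (by positivity)] at h2
  exact h2

theorem variationSeminorm_expSum_le_sum_changes {p : ℝ≥0∞} (hp : p ≠ ∞) (hp1 : 1 ≤ p)
    (ξ : Fin N → ℝ) (b : ℕ → EuclideanSpace ℂ (Fin N)) (hb : b 0 = 0) (K : ℕ) (x : ℝ) :
    variationSeminorm p (Set.Iic K) (fun n => expSum ξ (b n) x) ^ p.toReal
      ≤ 2 ^ p.toReal * ∑ s ∈ changes b K,
          ‖expSum ξ (b (s + 1)) x‖ₑ ^ p.toReal := by
  classical
  refine (variationSeminorm_rpow_le_sum_changes hp hp1 K _).trans ?_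
  have h0 := toReal_pos_of_one_le hp hp1
  have hz : expSum ξ (b 0) x = 0 := by simp [hb, expSum]
  rw [hz, enorm_zero, ENNReal.zero_rpow_of_pos h0, zero_add, changes, Finset.sum_filter]
  refine mul_le_mul_right (Finset.sum_le_sum fun s _ => ?_) _
  by_cases h : b (s + 1) = b s
  · simp [h]
  · rw [if_pos h]
    split_ifs
    · exact le_rfl
    · exact zero_le

/-- Bound of a layer without loss in `N`, which grows with `m`: the `q`-variation is at most the
`2`-variation, and the at most `2 ^ (m r + 1)` values of the layer are summed by almost
orthogonality. -/
theorem eLpNorm_layer_le_of_orthogonality {q r : ℝ≥0∞} (hr : r ≠ ∞) (hr1 : 1 ≤ r) (hq2 : 2 ≤ q)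
    {ξ : Fin N → ℝ} (hξ : Separated ξ) (F : ℕ → EuclideanSpace ℂ (Fin N)) (K : ℕ) {V : ℝ}
    (hV : 0 < V) (hVe : variationSeminorm r (Set.Iic K) F ≤ ENNReal.ofReal V) (m : ℕ) (c : ℝ) :
    eLpNorm (fun x => variationSeminorm q (Set.Iic K)
        (fun n => expSum ξ (layer F (fun _ => V) m n) x)) 2 (volume.restrict (Set.Ico c (c + 1)))
      ≤ ENNReal.ofReal (200 * V * ((2 : ℝ) ^ m) ^ (r.toReal / 2 - 1)) := by
  rw [eLpNorm_two_le_iff]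
  set b := layer F (fun _ => V) m with hb
  set S := changes b K with hS
  have hcard : (S.card : ℝ) ≤ 2 * ((2 : ℝ) ^ m) ^ r.toReal := card_changes_layer_le hr hr1 F K hV hVe m
  have hpt : ∀ x, variationSeminorm q (Set.Iic K) (fun n => expSum ξ (b n) x) ^ 2
      ≤ 4 * ∑ s ∈ S, ‖expSum ξ (b (s + 1)) x‖ₑ ^ 2 := fun x => by
    refine (pow_le_pow_left' (variationSeminorm_anti one_le_two hq2 _ _) 2).trans ?_
    have := variationSeminorm_expSum_le_sum_changes ENNReal.ofNat_ne_top one_le_two ξ b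
      (by simp [hb]) K x
    have hsq : ∀ x : ℝ≥0∞, x ^ (2 : ℝ) = x ^ (2 : ℕ) := fun x => by norm_cast
    simp only [ENNReal.toReal_ofNat, hsq] at this
    refine this.trans (le_of_eq ?_)
    rw [hS]
    norm_num
  have hbs : ∀ s, ‖b s‖ₑ ^ 2 ≤ ENNReal.ofReal (9 * V ^ 2 * (((2 : ℝ) ^ m) ^ 2)⁻¹) := fun s => by
    rw [← ofReal_norm, ← ENNReal.ofReal_pow (norm_nonneg _)]
    refine ENNReal.ofReal_le_ofReal ?_
    refine (pow_le_pow_left₀ (norm_nonneg _) (norm_layer_le F (fun _ => hV.le) m s) 2).trans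
      (le_of_eq ?_)
    rw [one_div, inv_pow]
    ring
  have hD : (0 : ℝ) < 2 ^ m := by positivity
  calc ∫⁻ x in Set.Ico c (c + 1),
        variationSeminorm q (Set.Iic K) (fun n => expSum ξ (b n) x) ^ 2
      ≤ ∫⁻ x in Set.Ico c (c + 1), 4 * ∑ s ∈ S, ‖expSum ξ (b (s + 1)) x‖ₑ ^ 2 :=
        lintegral_mono hpt
    _ = 4 * ∑ s ∈ S, ∫⁻ x in Set.Ico c (c + 1), ‖expSum ξ (b (s + 1)) x‖ₑ ^ 2 := by
        rw [lintegral_const_mul' _ _ (by norm_num), lintegral_finsetSum _ fun s _ =>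
          (measurable_expSum ξ _).enorm.pow_const 2]
    _ ≤ 4 * ∑ _s ∈ S, 16 * ENNReal.ofReal (9 * V ^ 2 * (((2 : ℝ) ^ m) ^ 2)⁻¹) := by
        gcongr with s _
        exact (lintegral_expSum_sq_le hξ _ c).trans (mul_le_mul_right (hbs _) _)
    _ = ENNReal.ofReal (4 * (S.card * (16 * (9 * V ^ 2 * (((2 : ℝ) ^ m) ^ 2)⁻¹)))) := by
        rw [Finset.sum_const, nsmul_eq_mul, ← ENNReal.ofReal_natCast,
          show (4 : ℝ≥0∞) = ENNReal.ofReal 4 by simp, show (16 : ℝ≥0∞) = ENNReal.ofReal 16 by simp,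
          ← ENNReal.ofReal_mul (by norm_num), ← ENNReal.ofReal_mul (by positivity),
          ← ENNReal.ofReal_mul (by norm_num)]
    _ ≤ _ := by
        rw [← ENNReal.ofReal_pow (by positivity)]
        refine ENNReal.ofReal_le_ofReal ?_
        have e1 : (((2 : ℝ) ^ m) ^ (r.toReal / 2 - 1)) ^ 2
            = ((2 : ℝ) ^ m) ^ r.toReal * (((2 : ℝ) ^ m) ^ 2)⁻¹ := by
          rw [← Real.rpow_natCast _ 2, ← Real.rpow_mul hD.le, ← Real.rpow_natCast _ 2,
            ← Real.rpow_neg hD.le, ← Real.rpow_add hD]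
          congr 1
          push_cast
          ring
        rw [mul_pow, e1]
        calc 4 * (S.card * (16 * (9 * V ^ 2 * (((2 : ℝ) ^ m) ^ 2)⁻¹)))
            ≤ 4 * ((2 * ((2 : ℝ) ^ m) ^ r.toReal) * (16 * (9 * V ^ 2 * (((2 : ℝ) ^ m) ^ 2)⁻¹))) := by
              gcongr
          _ = 1152 * (V ^ 2 * (((2 : ℝ) ^ m) ^ r.toReal * (((2 : ℝ) ^ m) ^ 2)⁻¹)) := by ring
          _ ≤ 40000 * (V ^ 2 * (((2 : ℝ) ^ m) ^ r.toReal * (((2 : ℝ) ^ m) ^ 2)⁻¹)) := by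
              gcongr; norm_num
          _ = _ := by ring

/-- Bound of a layer with a power of `N`, which decays with `m`: almost orthogonality is used for two
of the `q` factors, and the Cauchy–Schwarz inequality for the others. -/
theorem eLpNorm_layer_le_of_interpolation {q r : ℝ≥0∞} (hr : r ≠ ∞) (hr1 : 1 ≤ r) (hq : q ≠ ∞)
    (hq2 : 2 ≤ q) (hN : 0 < N) {ξ : Fin N → ℝ} (hξ : Separated ξ)
    (F : ℕ → EuclideanSpace ℂ (Fin N)) (K : ℕ) {V : ℝ}
    (hV : 0 < V) (hVe : variationSeminorm r (Set.Iic K) F ≤ ENNReal.ofReal V) (m : ℕ) (c : ℝ) :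
    eLpNorm (fun x => variationSeminorm q (Set.Iic K)
        (fun n => expSum ξ (layer F (fun _ => V) m n) x)) 2 (volume.restrict (Set.Ico c (c + 1)))
      ≤ ENNReal.ofReal (200 * V * ((N : ℝ) ^ (1 / 2 - 1 / q.toReal)
          * ((2 : ℝ) ^ m) ^ (r.toReal / q.toReal - 1))) := by
  rw [eLpNorm_two_le_iff]
  have hq1 : 1 ≤ q := one_le_two.trans hq2
  have hp0 := toReal_pos_of_one_le hq hq1
  have hp2 : 2 ≤ q.toReal := by
    simpa using (ENNReal.toReal_le_toReal ENNReal.ofNat_ne_top hq).2 hq2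
  set p := q.toReal
  set b := layer F (fun _ => V) m with hb
  set S := changes b K with hS
  have hcard : (S.card : ℝ) ≤ 2 * ((2 : ℝ) ^ m) ^ r.toReal := card_changes_layer_le hr hr1 F K hV hVe m
  have hD : (0 : ℝ) < 2 ^ m := by positivity
  have hNr : (0 : ℝ) < N := by exact_mod_cast hN
  set Y : ℝ := 3 * V * ((2 : ℝ) ^ m)⁻¹ with hY
  have hY0 : 0 < Y := by positivity
  have hbs : ∀ s, ‖b s‖ ≤ Y := fun s => by
    refine (norm_layer_le F (fun _ => hV.le) m s).trans (le_of_eq ?_)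
    rw [hY, one_div, inv_pow]
    ring
  have hsq : ∀ x : ℝ≥0∞, x ^ (2 : ℝ) = x ^ (2 : ℕ) := fun x => by norm_cast
  -- One factor `‖·‖²` is kept for the orthogonality, the others are bounded pointwise.
  have hpt : ∀ x, variationSeminorm q (Set.Iic K) (fun n => expSum ξ (b n) x) ^ p
      ≤ 2 ^ p * (ENNReal.ofReal (√N * Y) ^ (p - 2) * ∑ s ∈ S, ‖expSum ξ (b (s + 1)) x‖ₑ ^ 2) :=
    fun x => by
    refine (variationSeminorm_expSum_le_sum_changes hq hq1 ξ b (by simp [hb]) K x).trans ?_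
    refine mul_le_mul_right ?_ _
    rw [Finset.mul_sum]
    refine Finset.sum_le_sum fun s _ => ?_
    calc ‖expSum ξ (b (s + 1)) x‖ₑ ^ p
        = ‖expSum ξ (b (s + 1)) x‖ₑ ^ (p - 2) * ‖expSum ξ (b (s + 1)) x‖ₑ ^ 2 := by
          rw [← hsq, ← ENNReal.rpow_add_of_nonneg _ _ (by linarith) (by norm_num), sub_add_cancel]
      _ ≤ _ := by
          refine mul_le_mul_left (ENNReal.rpow_le_rpow ?_ (by linarith)) _
          rw [← ofReal_norm]
          exact ENNReal.ofReal_le_ofReal ((norm_expSum_le ξ _ x).trans (by gcongr; exact hbs _))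
  have hint : ∫⁻ x in Set.Ico c (c + 1),
      variationSeminorm q (Set.Iic K) (fun n => expSum ξ (b n) x) ^ p
      ≤ ENNReal.ofReal (2 ^ p * ((√N * Y) ^ (p - 2)
          * ((2 * ((2 : ℝ) ^ m) ^ r.toReal) * (16 * Y ^ 2)))) := by
    calc _ ≤ ∫⁻ x in Set.Ico c (c + 1), 2 ^ p * (ENNReal.ofReal (√N * Y) ^ (p - 2)
          * ∑ s ∈ S, ‖expSum ξ (b (s + 1)) x‖ₑ ^ 2) := lintegral_mono hpt
      _ = 2 ^ p * (ENNReal.ofReal (√N * Y) ^ (p - 2)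
          * ∑ s ∈ S, ∫⁻ x in Set.Ico c (c + 1), ‖expSum ξ (b (s + 1)) x‖ₑ ^ 2) := by
          rw [lintegral_const_mul' _ _ (by simp), lintegral_const_mul' _ _
            (ENNReal.rpow_ne_top_of_nonneg (by linarith) ENNReal.ofReal_ne_top),
            lintegral_finsetSum _ fun s _ => (measurable_expSum ξ _).enorm.pow_const 2]
      _ ≤ 2 ^ p * (ENNReal.ofReal (√N * Y) ^ (p - 2)
          * ∑ _s ∈ S, 16 * ENNReal.ofReal (Y ^ 2)) := by
          gcongr with s _
          refine (lintegral_expSum_sq_le hξ _ c).trans (mul_le_mul_right ?_ _)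
          rw [← ofReal_norm, ← ENNReal.ofReal_pow (norm_nonneg _)]
          exact ENNReal.ofReal_le_ofReal (pow_le_pow_left₀ (norm_nonneg _) (hbs _) 2)
      _ = ENNReal.ofReal (2 ^ p * ((√N * Y) ^ (p - 2) * (S.card * (16 * Y ^ 2)))) := by
          rw [Finset.sum_const, nsmul_eq_mul, ← ENNReal.ofReal_natCast,
            show (2 : ℝ≥0∞) = ENNReal.ofReal 2 by simp, show (16 : ℝ≥0∞) = ENNReal.ofReal 16 by simp,
            ENNReal.ofReal_rpow_of_pos two_pos, ENNReal.ofReal_rpow_of_pos (by positivity),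
            ← ENNReal.ofReal_mul (by norm_num), ← ENNReal.ofReal_mul (by positivity),
            ← ENNReal.ofReal_mul (by positivity), ← ENNReal.ofReal_mul (by positivity)]
      _ ≤ _ := by
          refine ENNReal.ofReal_le_ofReal ?_
          gcongr
  have hm : Measurable fun x => variationSeminorm q (Set.Iic K) (fun n => expSum ξ (b n) x) :=
    measurable_variationSeminorm hq _ fun n => measurable_expSum ξ (b n)
  have hhol := ENNReal.lintegral_mul_norm_pow_le (μ := volume.restrict (Set.Ico c (c + 1)))
    (f := fun x => variationSeminorm q (Set.Iic K) (fun n => expSum ξ (b n) x) ^ p)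
    (g := fun _ => 1) (hm.pow_const p).aemeasurable aemeasurable_const
    (p := 2 / p) (q := 1 - 2 / p) (by positivity)
    (by rw [sub_nonneg, div_le_one hp0]; exact hp2) (by ring)
  have hvol : volume (Set.Ico c (c + 1)) = 1 := by rw [Real.volume_Ico]; simp
  simp only [ENNReal.one_rpow, mul_one, lintegral_const, Measure.restrict_apply_univ,
    hvol, ← ENNReal.rpow_mul, mul_div_cancel₀ _ hp0.ne', hsq] at hhol
  refine hhol.trans ((ENNReal.rpow_le_rpow hint (by positivity)).trans ?_)
  rw [ENNReal.ofReal_rpow_of_nonneg (by positivity) (by positivity),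
    ← ENNReal.ofReal_pow (by positivity)]
  refine ENNReal.ofReal_le_ofReal ?_
  set Z := 200 * V * ((N : ℝ) ^ (1 / 2 - 1 / p) * ((2 : ℝ) ^ m) ^ (r.toReal / p - 1)) with hZ
  have e1 : Z ^ 2 = (Z ^ p) ^ (2 / p) := by
    rw [← Real.rpow_mul (by positivity), mul_div_cancel₀ _ hp0.ne']
    norm_num
  rw [e1, hZ]
  refine Real.rpow_le_rpow (by positivity) ?_ (by positivity)
  have e2 : Y ^ (p - 2) * Y ^ 2 = Y ^ p := by
    rw [← Real.rpow_natCast _ 2, ← Real.rpow_add hY0]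
    congr 1
    push_cast
    ring
  have e3 : (√N : ℝ) ^ (p - 2) = ((N : ℝ) ^ (1 / 2 - 1 / p)) ^ p := by
    rw [Real.sqrt_eq_rpow, ← Real.rpow_mul hNr.le, ← Real.rpow_mul hNr.le]
    congr 1
    field_simp
  have e4 : (((2 : ℝ) ^ m) ^ (r.toReal / p - 1)) ^ p
      = ((2 : ℝ) ^ m) ^ r.toReal * (((2 : ℝ) ^ m)⁻¹) ^ p := by
    rw [← Real.rpow_mul hD.le, Real.inv_rpow hD.le, ← Real.rpow_neg hD.le, ← Real.rpow_add hD]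
    congr 1
    field_simp
    ring
  have e5 : Y ^ p = 3 ^ p * V ^ p * (((2 : ℝ) ^ m)⁻¹) ^ p := by
    rw [hY, Real.mul_rpow (by positivity) (by positivity), Real.mul_rpow (by norm_num) hV.le]
  have e6 : (32 : ℝ) * 6 ^ p ≤ 200 ^ p := by
    calc (32 : ℝ) * 6 ^ p ≤ 32 ^ p * 6 ^ p := by
          gcongr
          exact Real.self_le_rpow_of_one_le (by norm_num) (by linarith)
      _ = 192 ^ p := by rw [← Real.mul_rpow (by norm_num) (by norm_num)]; norm_num
      _ ≤ 200 ^ p := Real.rpow_le_rpow (by norm_num) (by norm_num) hp0.le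
  have e7 : (2 : ℝ) ^ p * 3 ^ p = 6 ^ p := by
    rw [← Real.mul_rpow (by norm_num) (by norm_num)]; norm_num
  rw [Real.mul_rpow (x := √N) (by positivity) hY0.le,
    Real.mul_rpow (x := 200 * V) (by positivity) (by positivity),
    Real.mul_rpow (x := 200) (by norm_num) hV.le,
    Real.mul_rpow (x := (N : ℝ) ^ (1 / 2 - 1 / p)) (by positivity) (by positivity), e4, ← e3]
  calc (2 : ℝ) ^ p * ((√N) ^ (p - 2) * Y ^ (p - 2) * ((2 * ((2 : ℝ) ^ m) ^ r.toReal) * (16 * Y ^ 2)))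
      = 32 * 2 ^ p * ((√N) ^ (p - 2) * ((2 : ℝ) ^ m) ^ r.toReal * (Y ^ (p - 2) * Y ^ 2)) := by ring
    _ = (32 * (2 ^ p * 3 ^ p)) * (V ^ p * ((√N) ^ (p - 2)
          * (((2 : ℝ) ^ m) ^ r.toReal * (((2 : ℝ) ^ m)⁻¹) ^ p))) := by rw [e2, e5]; ring
    _ ≤ 200 ^ p * (V ^ p * ((√N) ^ (p - 2)
          * (((2 : ℝ) ^ m) ^ r.toReal * (((2 : ℝ) ^ m)⁻¹) ^ p))) := by
        rw [e7]
        gcongr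
    _ = _ := by ring

/-- The constant in the variational estimate for exponential sums. -/
noncomputable def expSumConst (q r : ℝ≥0∞) : ℝ≥0∞ :=
  200 * ((1 - ENNReal.ofReal (2 ^ (-(r.toReal / 2 - 1))))⁻¹
    + (1 - ENNReal.ofReal (2 ^ (-(1 - r.toReal / q.toReal))))⁻¹)

theorem expSumConst_lt_top {q r : ℝ≥0∞} (hr2 : 2 < r) (hrq : r < q) (hq : q ≠ ∞) :
    expSumConst q r < ∞ := by
  have hr := hrq.ne_top
  have h2 : 2 < r.toReal := by
    simpa using (ENNReal.toReal_lt_toReal ENNReal.ofNat_ne_top hr).2 hr2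
  have h3 : r.toReal < q.toReal := (ENNReal.toReal_lt_toReal hr hq).2 hrq
  have h : ∀ a : ℝ, 0 < a → (1 - ENNReal.ofReal (2 ^ (-a)))⁻¹ < ∞ := fun a ha => by
    rw [ENNReal.inv_lt_top]
    refine tsub_pos_of_lt ?_
    rw [ENNReal.ofReal_lt_one]
    exact Real.rpow_lt_one_of_one_lt_of_neg (by norm_num) (by linarith)
  refine ENNReal.mul_lt_top (by norm_num) (ENNReal.add_lt_top.2 ⟨h _ (by linarith), h _ ?_⟩)
  rw [sub_pos, div_lt_one (by linarith)]
  exact h3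

/-- Variational estimate for exponential sums on a unit interval, in terms of the variation of the
vectors of coefficients. -/
theorem eLpNorm_variationSeminorm_expSum_le {q r : ℝ≥0∞} (hr2 : 2 < r) (hrq : r < q) (hq : q ≠ ∞)
    {ξ : Fin N → ℝ} (hξ : Separated ξ) (v : ℕ → EuclideanSpace ℂ (Fin N)) (K : ℕ) (c : ℝ) :
    eLpNorm (fun x => variationSeminorm q (Set.Iic K) (fun n => expSum ξ (v n) x)) 2
        (volume.restrict (Set.Ico c (c + 1)))
      ≤ expSumConst q r * ENNReal.ofReal ((N : ℝ) ^ (1 / 2 - 1 / r.toReal))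
        * variationSeminorm r (Set.Iic K) v := by
  have hr := hrq.ne_top
  have hr1 : 1 ≤ r := one_le_two.trans hr2.le
  have hq1 : 1 ≤ q := hr1.trans hrq.le
  have hq2 : 2 ≤ q := hr2.le.trans hrq.le
  have h2 : 2 < r.toReal := by
    simpa using (ENNReal.toReal_lt_toReal ENNReal.ofNat_ne_top hr).2 hr2
  have h3 : r.toReal < q.toReal := (ENNReal.toReal_lt_toReal hr hq).2 hrq
  -- Values with index greater than `K` play no role.
  set F : ℕ → EuclideanSpace ℂ (Fin N) := fun n => v (min n K) with hF
  have hFv : ∀ n ∈ Set.Iic K, v n = F n := fun n hn => by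
    simp only [hF]; rw [min_eq_left hn]
  rw [variationSeminorm_congr hFv]
  have hL : ∀ x, variationSeminorm q (Set.Iic K) (fun n => expSum ξ (v n) x)
      = variationSeminorm q (Set.Iic K) (fun n => expSum ξ (F n) x) := fun x =>
    variationSeminorm_congr fun n hn => by rw [hFv n hn]
  simp only [hL]
  set Ve := variationSeminorm r (Set.Iic K) F with hVe
  have hVtop : Ve ≠ ∞ := by
    have h0 := toReal_pos_of_one_le hr hr1
    intro h
    have := variationSeminorm_rpow_le_sum hr hr1 K F
    rw [← hVe, h, ENNReal.top_rpow_of_pos h0, top_le_iff] at this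
    refine (ENNReal.mul_lt_top (ENNReal.rpow_lt_top_of_nonneg h0.le ENNReal.ofNat_ne_top)
      (ENNReal.sum_lt_top.2 fun n _ => ENNReal.rpow_lt_top_of_nonneg h0.le enorm_ne_top)).ne this
  have hlip : ∀ x, variationSeminorm q (Set.Iic K) (fun n => expSum ξ (F n) x)
      ≤ ENNReal.ofReal √N * Ve := fun x => by
    refine (variationSeminorm_anti hr1 hrq.le _ _).trans
      (variationSeminorm_le_mul hr hr1 fun m _ n _ => ?_)
    rw [← expSum_sub, ← ofReal_norm, ← ofReal_norm, ← ENNReal.ofReal_mul (by positivity)]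
    exact ENNReal.ofReal_le_ofReal (norm_expSum_le ξ _ x)
  by_cases hdeg : N = 0 ∨ Ve = 0
  · have hz : ∀ x, variationSeminorm q (Set.Iic K) (fun n => expSum ξ (F n) x) = 0 := fun x => by
      refine le_antisymm ((hlip x).trans (le_of_eq ?_)) zero_le
      rcases hdeg with h | h <;> simp [h]
    simp [hz]
  push Not at hdeg
  have hN : 0 < N := Nat.pos_of_ne_zero hdeg.1
  have hV : 0 < Ve.toReal := ENNReal.toReal_pos hdeg.2 hVtop
  set V := Ve.toReal with hVdef
  have hofV : ENNReal.ofReal V = Ve := ENNReal.ofReal_toReal hVtop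
  -- The thresholds of the greedy approximations are constant here, and equal to multiples of the
  -- `r`-variation.
  have hosc : ∀ n, ‖F n - F 0‖ ≤ 2 * V := fun n => by
    have h1 : ‖F (min n K) - F 0‖ₑ ≤ Ve := enorm_sub_le_variationSeminorm hr hr1 F
      (Set.mem_Iic.2 (min_le_right n K)) (Set.mem_Iic.2 K.zero_le)
    have h2 : F (min n K) = F n := by simp [hF]
    rw [h2, ← hofV, ← ofReal_norm, ENNReal.ofReal_le_ofReal_iff hV.le] at h1
    linarith
  set α := 1 - r.toReal / q.toReal with hα
  set β := r.toReal / 2 - 1 with hβ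
  have hα0 : 0 < α := by
    rw [hα, sub_pos, div_lt_one (by linarith)]; exact h3
  have hβ0 : 0 < β := by rw [hβ]; linarith
  -- The two bounds of the layers balance where `2 ^ (m r) = N`.
  set X : ℝ := (N : ℝ) ^ (1 / r.toReal) with hX
  have hN1 : (1 : ℝ) ≤ N := by exact_mod_cast hN
  have hX1 : 1 ≤ X := Real.one_le_rpow hN1 (by positivity)
  have hmin : ∀ m, eLpNorm (fun x => variationSeminorm q (Set.Iic K)
        (fun n => expSum ξ (layer F (fun _ => V) m n) x)) 2 (volume.restrict (Set.Ico c (c + 1)))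
      ≤ ENNReal.ofReal (200 * V) * ENNReal.ofReal
          (min (((2 : ℝ) ^ m) ^ β) (X ^ (α + β) * ((2 : ℝ) ^ m) ^ (-α))) := fun m => by
    rw [← ENNReal.ofReal_mul (by positivity)]
    rcases min_cases (((2 : ℝ) ^ m) ^ β) (X ^ (α + β) * ((2 : ℝ) ^ m) ^ (-α)) with h | h
    · rw [h.1]
      exact eLpNorm_layer_le_of_orthogonality hr hr1 hq2 hξ F K hV hofV.ge m c
    · rw [h.1]
      refine (eLpNorm_layer_le_of_interpolation hr hr1 hq hq2 hN hξ F K hV hofV.ge m c).trans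
        (le_of_eq ?_)
      have e1 : X ^ (α + β) = (N : ℝ) ^ (1 / 2 - 1 / q.toReal) := by
        rw [hX, ← Real.rpow_mul (by positivity)]
        congr 1
        rw [hα, hβ]
        have : r.toReal ≠ 0 := by positivity
        have : q.toReal ≠ 0 := by linarith
        field_simp
        ring
      have e2 : -α = r.toReal / q.toReal - 1 := by rw [hα]; ring
      rw [e1, e2]
  refine (eLpNorm_variationSeminorm_le_tsum hq hq1 (Set.Iic K)
    (F := fun x n => expSum ξ (F n) x)
    (G := fun m x n => expSum ξ (approx F (fun _ => V) m n) x)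
    (b := fun m x n => expSum ξ (layer F (fun _ => V) m n) x)
    (c := fun x => expSum ξ (F 0) x)
    (fun m n => measurable_expSum ξ _) (fun m n => measurable_expSum ξ _)
    (fun m x n => by rw [approx_eq_add_sum_layer hosc, expSum_add, expSum_sum])
    (fun x n => ((continuous_expSum_left ξ x).tendsto _).comp
      (tendsto_approx F (fun _ => hV.le) n)) hmin).trans ?_
  rw [ENNReal.tsum_mul_left]
  refine (mul_le_mul_right (tsum_min_le hα0 hβ0 hX1) _).trans (le_of_eq ?_)
  have e3 : X ^ β = (N : ℝ) ^ (1 / 2 - 1 / r.toReal) := by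
    rw [hX, ← Real.rpow_mul (by positivity)]
    congr 1
    rw [hβ]
    field_simp
  rw [e3, ENNReal.ofReal_mul (by norm_num), hofV, expSumConst]
  simp only [ENNReal.ofReal_ofNat]
  ring

end ExponentialSums

/-! ### Modulated averages on a fixed grid -/

section GridEstimate

variable {N : ℕ}

theorem dyadicAvg_eq_of_mem_cell {K n : ℕ} (hn : n ≤ K) (g : ℝ → ℂ) {i : ℤ} {x : ℝ}
    (hx : x ∈ cell 1 i) : dyadicAvg (2 ^ K) g x n = dyadicAvg (2 ^ K) g i n := by
  obtain ⟨η, hη⟩ := gridConst_dyadicAvg (R := 2 ^ K) (g := g) hn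
  have h1 : (2 : ℝ) ^ K / 2 ^ K = 1 := div_self (by positivity)
  have h2 := (mem_cell one_pos).1 hx
  rw [div_one] at h2
  have e1 := hη x
  have e2 := hη (i : ℝ)
  simp only [h1, div_one, h2, Int.floor_intCast] at e1 e2
  rw [e1, e2]

/-- The vector of coefficients of the main term at the point `x`. -/
noncomputable def coeffs (K : ℕ) (a : ℕ → Fin N → ℂ) (g : Fin N → ℝ → ℂ) (x : ℝ) (n : ℕ) :
    EuclideanSpace ℂ (Fin N) :=
  WithLp.toLp 2 fun j => a n j * dyadicAvg (2 ^ K) (g j) x n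

/-- Up to the scale `K` the coefficients are constant on unit intervals, on which the estimate for
exponential sums applies. -/
theorem lintegral_variationSeminorm_expSum_coeffs_le {q r : ℝ≥0∞} (hr2 : 2 < r) (hrq : r < q)
    (hq : q ≠ ∞) {ξ : Fin N → ℝ} (hξ : Separated ξ) (K : ℕ) (a : ℕ → Fin N → ℂ)
    (g : Fin N → ℝ → ℂ) :
    ∫⁻ x, variationSeminorm q (Set.Iic K) (fun n => expSum ξ (coeffs K a g x n) x) ^ 2
      ≤ (expSumConst q r * ENNReal.ofReal ((N : ℝ) ^ (1 / 2 - 1 / r.toReal))) ^ 2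
        * ∫⁻ x, variationSeminorm r (Set.Iic K) (coeffs K a g x) ^ 2 := by
  have hconst : ∀ (i : ℤ), ∀ x ∈ cell 1 i, ∀ n ∈ Set.Iic K, coeffs K a g x n = coeffs K a g i n := by
    intro i x hx n hn
    simp only [coeffs, dyadicAvg_eq_of_mem_cell hn _ hx]
  set C := expSumConst q r * ENNReal.ofReal ((N : ℝ) ^ (1 / 2 - 1 / r.toReal))
  rw [lintegral_eq_tsum_cell one_pos, lintegral_eq_tsum_cell one_pos
    (fun x => variationSeminorm r (Set.Iic K) (coeffs K a g x) ^ 2), ← ENNReal.tsum_mul_left]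
  refine ENNReal.tsum_le_tsum fun i => ?_
  have e1 : ∀ x ∈ cell 1 i, variationSeminorm q (Set.Iic K) (fun n => expSum ξ (coeffs K a g x n) x) ^ 2
      = variationSeminorm q (Set.Iic K) (fun n => expSum ξ (coeffs K a g i n) x) ^ 2 := fun x hx => by
    rw [variationSeminorm_congr (g := fun n => expSum ξ (coeffs K a g i n) x)
      fun n hn => by rw [hconst i x hx n hn]]
  have e2 : ∀ x ∈ cell 1 i, variationSeminorm r (Set.Iic K) (coeffs K a g x) ^ 2
      = variationSeminorm r (Set.Iic K) (coeffs K a g i) ^ 2 := fun x hx => by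
    rw [variationSeminorm_congr (hconst i x hx)]
  rw [setLIntegral_congr_fun (measurableSet_cell 1 i) e1,
    setLIntegral_congr_fun (measurableSet_cell 1 i) e2, setLIntegral_const, volume_cell,
    ENNReal.ofReal_one, mul_one, ← mul_pow, ← eLpNorm_two_le_iff]
  have hcell : cell 1 i = Set.Ico (i : ℝ) (i + 1) := by simp [cell]
  rw [hcell]
  exact eLpNorm_variationSeminorm_expSum_le hr2 hrq hq hξ _ K i

/-- The variation of the coefficients is controlled by the inequalities of Lépingle and of Doob. -/
theorem lintegral_variationSeminorm_coeffs_le {r : ℝ≥0∞} (hr : r ≠ ∞) (hr2 : 2 ≤ r) (K : ℕ)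
    {a : ℕ → Fin N → ℂ} {g : Fin N → ℝ → ℂ} (hg : ∀ j, MemLp (g j) 2) {A : ℝ≥0∞}
    (ha : ∀ j, ∀ n ≤ K, ‖a n j‖ₑ ≤ A)
    (hVa : ∀ j, variationSeminorm r (Set.Iic K) (fun n => a n j) ≤ A) :
    ∫⁻ x, variationSeminorm r (Set.Iic K) (coeffs K a g x) ^ 2
      ≤ (2 * (lepingleConst r ^ 2 + 4) * A ^ 2) * ∑ j, ∫⁻ x, ‖g j x‖ₑ ^ 2 := by
  have hr1 : 1 ≤ r := one_le_two.trans hr2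
  have hR : (0 : ℝ) < 2 ^ K := by positivity
  set V : Fin N → ℝ → ℝ≥0∞ := fun j x => variationSeminorm r (Set.Iic K) (dyadicAvg (2 ^ K) (g j) x)
  set Y : Fin N → ℝ → ℝ≥0∞ := fun j x => ENNReal.ofReal (runMax (dyadicAvg (2 ^ K) (g j) x) K)
  have hVm : ∀ j, Measurable (V j) := fun j =>
    measurable_variationSeminorm hr _ fun n => measurable_dyadicAvg n
  have hYm : ∀ j, Measurable (Y j) := fun j => (gridConst_runMax le_rfl).measurable.ennreal_ofReal
  have hpt : ∀ x, variationSeminorm r (Set.Iic K) (coeffs K a g x) ^ 2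
      ≤ ∑ j, 2 * A ^ 2 * (V j x ^ 2 + Y j x ^ 2) := fun x => by
    refine (variationSeminorm_euclidean_le hr hr2 _).trans (Finset.sum_le_sum fun j _ => ?_)
    have h1 : variationSeminorm r (Set.Iic K) (fun n => coeffs K a g x n j)
        ≤ A * V j x + Y j x * A := by
      exact (variationSeminorm_mul_le hr hr1 (K := Set.Iic K)
        (F := fun n => dyadicAvg (2 ^ K) (g j) x n) (fun n hn => ha j n hn)
        (fun n hn => enorm_le_runMax _ hn)).trans
          (add_le_add le_rfl (mul_le_mul_right (hVa j) _))
    calc variationSeminorm r (Set.Iic K) (fun n => coeffs K a g x n j) ^ 2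
        ≤ (A * V j x + Y j x * A) ^ 2 := pow_le_pow_left' h1 2
      _ = A ^ 2 * (V j x + Y j x) ^ 2 := by ring
      _ ≤ A ^ 2 * (2 * (V j x ^ 2 + Y j x ^ 2)) := by
          gcongr
          have := ENNReal.rpow_add_le_mul_rpow_add_rpow (V j x) (Y j x) (p := 2) one_le_two
          norm_num at this
          exact this
      _ = _ := by ring
  refine (lintegral_mono hpt).trans ?_
  rw [lintegral_finsetSum _ fun j _ => by fun_prop, Finset.mul_sum]
  refine Finset.sum_le_sum fun j _ => ?_
  rw [lintegral_const_mul _ (by fun_prop), lintegral_add_left (by fun_prop)]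
  set G := ∫⁻ x, ‖g j x‖ₑ ^ 2 with hG
  have h1 : ∫⁻ x, V j x ^ 2 ≤ lepingleConst r ^ 2 * G := by
    rw [hG, ← eLpNorm_two_sq (fun x => ‖g j x‖ₑ), eLpNorm_enorm, ← mul_pow, ← eLpNorm_two_le_iff]
    exact eLpNorm_variationSeminorm_dyadicAvg_le hr hr2 hR (hg j) K
  have h2 : ∫⁻ x, Y j x ^ 2 ≤ 4 * G := lintegral_runMax_sq_le hR (hg j) K
  calc 2 * A ^ 2 * ((∫⁻ x, V j x ^ 2) + ∫⁻ x, Y j x ^ 2)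
      ≤ 2 * A ^ 2 * (lepingleConst r ^ 2 * G + 4 * G) := by gcongr
    _ = _ := by ring

/-- The square of the constant in the estimate for the main term. -/
noncomputable def mainConst (N : ℕ) (q r A : ℝ≥0∞) : ℝ≥0∞ :=
  (expSumConst q r * ENNReal.ofReal ((N : ℝ) ^ (1 / 2 - 1 / r.toReal))) ^ 2
    * (2 * (lepingleConst r ^ 2 + 4) * A ^ 2)

theorem lintegral_variationSeminorm_dyadic_main_le {q r : ℝ≥0∞} (hr2 : 2 < r) (hrq : r < q)
    (hq : q ≠ ∞) {ξ : Fin N → ℝ} (hξ : Separated ξ) (K : ℕ) {a : ℕ → Fin N → ℂ}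
    {g : Fin N → ℝ → ℂ} (hg : ∀ j, MemLp (g j) 2) {A : ℝ≥0∞} (ha : ∀ j, ∀ n ≤ K, ‖a n j‖ₑ ≤ A)
    (hVa : ∀ j, variationSeminorm r (Set.Iic K) (fun n => a n j) ≤ A) :
    ∫⁻ x, variationSeminorm q (Set.Iic K)
        (fun n => ∑ j, a n j * dyadicAvg (2 ^ K) (g j) x n * ex (ξ j * x)) ^ 2
      ≤ mainConst N q r A * ∑ j, ∫⁻ x, ‖g j x‖ₑ ^ 2 := by
  refine (lintegral_variationSeminorm_expSum_coeffs_le hr2 hrq hq hξ K a g).trans ?_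
  rw [mainConst, mul_assoc]
  exact mul_le_mul_right (lintegral_variationSeminorm_coeffs_le hrq.ne_top hr2.le K hg ha hVa) _

end GridEstimate

/-! ### Averaging over the translates of the grid -/

section Averaging

/-- The Fourier symbol of the operator of averaging over `[x, x + L]`. -/
noncomputable def avgSymbol (L ξ : ℝ) : ℂ := (L : ℂ)⁻¹ * ∫ s in (0 : ℝ)..L, ex (ξ * s)

/-- The Fourier symbol of the averages over a grid of mesh `L`, once they are averaged over all the
translates of the grid. -/
noncomputable def gridSymbol (L ξ : ℝ) : ℂ := avgSymbol L (-ξ) * avgSymbol L ξ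

theorem continuous_avgSymbol (L : ℝ) : Continuous (avgSymbol L) := by
  refine continuous_const.mul ?_
  exact intervalIntegral.continuous_parametric_intervalIntegral_of_continuous' (by fun_prop) 0 L

theorem continuous_gridSymbol (L : ℝ) : Continuous (gridSymbol L) :=
  ((continuous_avgSymbol L).comp continuous_neg).mul (continuous_avgSymbol L)

theorem norm_avgSymbol_le_one {L : ℝ} (hL : 0 < L) (ξ : ℝ) : ‖avgSymbol L ξ‖ ≤ 1 := by
  rw [avgSymbol, norm_mul, norm_inv, Complex.norm_real, Real.norm_of_nonneg hL.le,
    inv_mul_le_iff₀ hL, mul_one]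
  have := intervalIntegral.norm_integral_le_of_norm_le_const (a := 0) (b := L) (C := 1)
    (f := fun s => ex (ξ * s)) fun s _ => by simp
  simpa [abs_of_pos hL] using this

theorem norm_gridSymbol_le_one {L : ℝ} (hL : 0 < L) (ξ : ℝ) : ‖gridSymbol L ξ‖ ≤ 1 := by
  rw [gridSymbol, norm_mul]
  exact mul_le_one₀ (norm_avgSymbol_le_one hL _) (norm_nonneg _) (norm_avgSymbol_le_one hL _)

theorem norm_avgSymbol_sub_one_le {L : ℝ} (hL : 0 < L) (ξ : ℝ) :
    ‖avgSymbol L ξ - 1‖ ≤ 2 * Real.pi * (L * |ξ|) := by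
  have hL' : (L : ℂ) ≠ 0 := by exact_mod_cast hL.ne'
  have h1 : avgSymbol L ξ - 1 = (L : ℂ)⁻¹ * ∫ s in (0 : ℝ)..L, (ex (ξ * s) - 1) := by
    rw [intervalIntegral.integral_sub ((by fun_prop : Continuous fun s => ex (ξ * s)).intervalIntegrable
      _ _) (by simp), mul_sub, avgSymbol]
    simp [hL']
  rw [h1, norm_mul, norm_inv, Complex.norm_real, Real.norm_of_nonneg hL.le, inv_mul_le_iff₀ hL]
  have := intervalIntegral.norm_integral_le_of_norm_le_const (a := 0) (b := L)
    (C := 2 * Real.pi * (L * |ξ|)) (f := fun s => ex (ξ * s) - 1) fun s hs => by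
      rw [Set.uIoc_of_le hL.le] at hs
      refine (norm_ex_sub_one_le _).trans ?_
      rw [abs_mul, abs_of_pos hs.1, mul_comm L]
      gcongr
      exact hs.2
  rw [sub_zero, abs_of_pos hL] at this
  linarith

theorem norm_gridSymbol_sub_one_le {L : ℝ} (hL : 0 < L) (ξ : ℝ) :
    ‖gridSymbol L ξ - 1‖ ≤ 4 * Real.pi * (L * |ξ|) := by
  have h1 := norm_avgSymbol_sub_one_le hL (-ξ)
  have h2 := norm_avgSymbol_sub_one_le hL ξ
  rw [abs_neg] at h1
  calc ‖gridSymbol L ξ - 1‖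
      = ‖(avgSymbol L (-ξ) - 1) * avgSymbol L ξ + (avgSymbol L ξ - 1)‖ := by
        rw [gridSymbol]; congr 1; ring
    _ ≤ ‖avgSymbol L (-ξ) - 1‖ * ‖avgSymbol L ξ‖ + ‖avgSymbol L ξ - 1‖ := by
        refine (norm_add_le _ _).trans ?_
        rw [norm_mul]
    _ ≤ ‖avgSymbol L (-ξ) - 1‖ * 1 + ‖avgSymbol L ξ - 1‖ := by
        gcongr
        exact norm_avgSymbol_le_one hL ξ
    _ ≤ _ := by linarith

theorem norm_gridSymbol_mul_le {L : ℝ} (hL : 0 < L) (ξ : ℝ) :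
    ‖gridSymbol L ξ‖ * (L * |ξ|) ≤ 1 := by
  by_cases hξ : ξ = 0
  · simp [hξ]
  have hc : ((2 * Real.pi * ξ : ℝ) : ℂ) * Complex.I ≠ 0 := by
    refine mul_ne_zero ?_ Complex.I_ne_zero
    exact_mod_cast mul_ne_zero Real.two_pi_pos.ne' hξ
  have h1 : ∫ s in (0 : ℝ)..L, ex (ξ * s)
      = (ex (ξ * L) - 1) / (((2 * Real.pi * ξ : ℝ) : ℂ) * Complex.I) := by
    have e : ∀ s : ℝ, ex (ξ * s)
        = Complex.exp ((((2 * Real.pi * ξ : ℝ) : ℂ) * Complex.I) * s) := fun s => by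
      rw [ex_eq]; congr 1; push_cast; ring
    simp only [e]
    rw [integral_exp_mul_complex hc]
    simp
  have h2 : ‖avgSymbol L ξ‖ * (L * |ξ|) ≤ 1 := by
    rw [avgSymbol, h1, norm_mul, norm_inv, Complex.norm_real, Real.norm_of_nonneg hL.le, norm_div,
      norm_mul, Complex.norm_I, mul_one, Complex.norm_real, Real.norm_eq_abs, abs_mul,
      abs_of_pos Real.two_pi_pos]
    have h3 : ‖ex (ξ * L) - 1‖ ≤ 2 := by
      refine (norm_sub_le _ _).trans ?_
      rw [norm_ex, norm_one]
      norm_num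
    have hξ' : 0 < |ξ| := abs_pos.2 hξ
    have e : L⁻¹ * (‖ex (ξ * L) - 1‖ / (2 * Real.pi * |ξ|)) * (L * |ξ|)
        = ‖ex (ξ * L) - 1‖ / (2 * Real.pi) := by
      field_simp
    rw [e, div_le_one Real.two_pi_pos]
    have := Real.pi_gt_three
    linarith
  calc ‖gridSymbol L ξ‖ * (L * |ξ|)
      = ‖avgSymbol L (-ξ)‖ * (‖avgSymbol L ξ‖ * (L * |ξ|)) := by
        rw [gridSymbol, norm_mul, mul_assoc]
    _ ≤ 1 * 1 := by
        gcongr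
        exact norm_avgSymbol_le_one hL _
    _ = 1 := one_mul 1

theorem integrable_avgSymbol_mul {L : ℝ} (hL : 0 < L) {h : ℝ → ℂ} (hh : Integrable h) :
    Integrable fun ξ => avgSymbol L ξ * h ξ :=
  hh.bdd_mul (c := 1) (continuous_avgSymbol L).aestronglyMeasurable
    (Filter.Eventually.of_forall fun ξ => norm_avgSymbol_le_one hL ξ)

theorem average_invF {L : ℝ} (hL : 0 < L) {h : ℝ → ℂ} (hh : Integrable h) (σ y : ℝ) :
    (L : ℂ)⁻¹ * ∫ s in (0 : ℝ)..L, invF h (y + σ * s)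
      = invF (fun ξ => avgSymbol L (σ * ξ) * h ξ) y := by
  have hswap : ∫ s in (0 : ℝ)..L, invF h (y + σ * s)
      = ∫ ξ, ∫ s in (0 : ℝ)..L, ex (ξ * (y + σ * s)) * h ξ := by
    simp only [invF, intervalIntegral.integral_of_le hL.le]
    refine integral_integral_swap ((hh.comp_snd (volume.restrict (Set.Ioc 0 L))).bdd_mul (c := 1)
      (Continuous.aestronglyMeasurable (by fun_prop))
      (Filter.Eventually.of_forall fun p => by simp))
  rw [hswap, ← integral_const_mul, invF]
  refine integral_congr_ae (Filter.Eventually.of_forall fun ξ => ?_)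
  simp only [avgSymbol]
  have e : ∀ s : ℝ, ex (ξ * (y + σ * s)) * h ξ = ex (ξ * y) * h ξ * ex (σ * ξ * s) := fun s => by
    rw [show ξ * (y + σ * s) = ξ * y + σ * ξ * s by ring, ex_add]; ring
  simp only [e]
  rw [intervalIntegral.integral_const_mul]
  ring

/-- The part of `y` beyond the left end point of its interval in the grid of mesh `L`. -/
noncomputable def gridFract (L y : ℝ) : ℝ := L * Int.fract (y / L)

theorem measurable_gridFract (L : ℝ) : Measurable (gridFract L) :=
  (measurable_fract.comp (measurable_id.div_const L)).const_mul L

/-- The average over the translate by `θ` of the grid, as an average over the interval of length `L`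
that starts at the left end point of the interval containing `x`. -/
theorem gridAvg_translate {L : ℝ} (hL : 0 < L) {h : ℝ → ℂ} (hh : Integrable h) (θ x : ℝ) :
    gridAvg L (fun t => invF h (t + θ)) (x - θ)
      = invF (fun ξ => avgSymbol L ξ * h ξ) (x - gridFract L (x - θ)) := by
  have hi : L * (⌊(x - θ) / L⌋ : ℝ) = x - θ - gridFract L (x - θ) := by
    rw [gridFract, Int.fract, mul_sub, mul_div_cancel₀ _ hL.ne']
    ring
  have h1 := average_invF hL hh 1 (x - gridFract L (x - θ))
  simp only [one_mul] at h1
  rw [← h1, gridAvg, cell, integral_Ico_eq_integral_Ioc, ← intervalIntegral.integral_of_le (by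
    gcongr; linarith)]
  congr 1
  have e := intervalIntegral.integral_comp_add_left (a := 0) (b := L)
    (fun t => invF h (t + θ)) (L * (⌊(x - θ) / L⌋ : ℝ))
  rw [add_zero] at e
  rw [show L * ((⌊(x - θ) / L⌋ : ℝ) + 1) = L * (⌊(x - θ) / L⌋ : ℝ) + L by ring, ← e]
  refine intervalIntegral.integral_congr fun s _ => ?_
  simp only [hi]
  congr 1
  ring

/-- The position of `x` in the translated grid is uniformly distributed. -/
theorem integral_gridFract_translates {L : ℝ} (hL : 0 < L) (m : ℕ) {G : ℝ → ℂ} (hG : Continuous G)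
    {C : ℝ} (hC : ∀ x, ‖G x‖ ≤ C) (x : ℝ) :
    ∫ θ in (0 : ℝ)..m * L, G (x - gridFract L (x - θ)) = m * ∫ s in (0 : ℝ)..L, G (x - s) := by
  set f : ℝ → ℂ := fun y => G (x - gridFract L y) with hf
  have hper : Function.Periodic f L := fun y => by
    simp only [hf, gridFract, add_div, div_self hL.ne', Int.fract_add_one]
  have hint : ∀ t₁ t₂, IntervalIntegrable f MeasureSpace.volume t₁ t₂ := fun t₁ t₂ =>
    intervalIntegrable_const.mono_fun' (g := fun _ => C)
      (hG.measurable.comp (measurable_const.sub (measurable_gridFract L))).aestronglyMeasurable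
      (Filter.Eventually.of_forall fun y => hC _)
  have e1 := intervalIntegral.integral_comp_sub_left (a := 0) (b := m * L) f x
  have e2 := hper.intervalIntegral_add_zsmul_eq m (x - m * L) hint
  rw [hper.intervalIntegral_add_eq _ 0, zero_add] at e2
  have e3 : x - m * L + (m : ℤ) • L = x := by simp
  rw [e3] at e2
  rw [sub_zero] at e1
  rw [e1, e2]
  simp only [natCast_zsmul, nsmul_eq_mul]
  congr 1
  rw [intervalIntegral.integral_of_le hL.le, intervalIntegral.integral_of_le hL.le,
    ← integral_Ico_eq_integral_Ioc, ← integral_Ico_eq_integral_Ioc]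
  refine setIntegral_congr_fun measurableSet_Ico fun s hs => ?_
  have hfr : Int.fract (s / L) = s / L :=
    Int.fract_eq_self.2 ⟨div_nonneg hs.1 hL.le, (div_lt_one hL).2 hs.2⟩
  simp only [hf, gridFract, hfr, mul_div_cancel₀ _ hL.ne']

/-- The uniform probability measure on the translates of the grids of mesh `1, 2, …, 2 ^ K`. -/
noncomputable def shiftMeasure (K : ℕ) : Measure ℝ :=
  ENNReal.ofReal ((2 ^ K)⁻¹) • volume.restrict (Set.Ioc 0 (2 ^ K))

instance (K : ℕ) : IsProbabilityMeasure (shiftMeasure K) := by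
  refine ⟨?_⟩
  rw [shiftMeasure, Measure.smul_apply, Measure.restrict_apply_univ, Real.volume_Ioc, sub_zero,
    smul_eq_mul, ← ENNReal.ofReal_mul (by positivity), inv_mul_cancel₀ (by positivity),
    ENNReal.ofReal_one]

theorem dyadicAvg_translate {K n : ℕ} {h : ℝ → ℂ} (hh : Integrable h) (θ x : ℝ) :
    dyadicAvg (2 ^ K) (fun t => invF h (t + θ)) (x - θ) n
      = invF (fun ξ => avgSymbol (2 ^ K / 2 ^ n) ξ * h ξ)
          (x - gridFract (2 ^ K / 2 ^ n) (x - θ)) :=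
  gridAvg_translate (by positivity) hh θ x

/-- Averaging over the translates of the grid turns the grid averages into a convolution operator. -/
theorem integral_shiftMeasure_dyadicAvg {K : ℕ} (n : ℕ) {h : ℝ → ℂ} (hh : Integrable h) (x : ℝ) :
    ∫ θ, dyadicAvg (2 ^ K) (fun t => invF h (t + θ)) (x - θ) n ∂(shiftMeasure K)
      = invF (fun ξ => gridSymbol (2 ^ K / 2 ^ n) ξ * h ξ) x := by
  set L : ℝ := 2 ^ K / 2 ^ n with hLdef
  have hL : 0 < L := by positivity
  have hK : (2 : ℝ) ^ K = (2 ^ n : ℕ) * L := by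
    rw [hLdef]; push_cast; field_simp
  have hi := integrable_avgSymbol_mul hL hh
  simp only [dyadicAvg_translate hh]
  rw [shiftMeasure, integral_smul_measure, ENNReal.toReal_ofReal (by positivity),
    ← intervalIntegral.integral_of_le (by positivity)]
  have e1 := integral_gridFract_translates hL (2 ^ n) (continuous_invF hi) (norm_invF_le _) x
  rw [← hK] at e1
  have e2 := average_invF hL hi (-1) x
  simp only [neg_one_mul, ← sub_eq_add_neg] at e2
  rw [e1]
  have e3 : (fun ξ => gridSymbol L ξ * h ξ)
      = fun ξ => avgSymbol L (-ξ) * (avgSymbol L ξ * h ξ) := by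
    ext ξ; rw [gridSymbol, mul_assoc]
  rw [e3, ← e2, Complex.real_smul, ← mul_assoc]
  congr 1
  have hL' : (L : ℂ) ≠ 0 := by exact_mod_cast hL.ne'
  rw [hK]
  push_cast
  field_simp

theorem lintegral_sq_le_lintegral_sq {α : Type*} [MeasurableSpace α] {μ : Measure α}
    [IsProbabilityMeasure μ] {F : α → ℝ≥0∞} (hF : AEMeasurable F μ) :
    (∫⁻ a, F a ∂μ) ^ 2 ≤ ∫⁻ a, F a ^ 2 ∂μ := by
  rw [← eLpNorm_two_sq]
  gcongr
  have := eLpNorm_le_eLpNorm_of_exponent_le (p := 1) (q := 2) one_le_two hF.aestronglyMeasurable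
  rwa [eLpNorm_one_eq_lintegral_enorm] at this

/-- The main term: the estimate for dyadic averages is averaged over the translates of the grid. -/
theorem lintegral_variationSeminorm_main_le {N : ℕ} {q r : ℝ≥0∞} (hr2 : 2 < r) (hrq : r < q)
    (hq : q ≠ ∞) {ξ : Fin N → ℝ} (hξ : Separated ξ) (K : ℕ) {a : ℕ → Fin N → ℂ}
    {h : Fin N → ℝ → ℂ} (h1 : ∀ j, Integrable (h j)) (h2 : ∀ j, MemLp (h j) 2) {A : ℝ≥0∞}
    (ha : ∀ j, ∀ n ≤ K, ‖a n j‖ₑ ≤ A)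
    (hVa : ∀ j, variationSeminorm r (Set.Iic K) (fun n => a n j) ≤ A) :
    ∫⁻ x, variationSeminorm q (Set.Iic K) (fun n => ∑ j, a n j * ex (ξ j * x)
        * invF (fun η => gridSymbol (2 ^ K / 2 ^ n) η * h j η) x) ^ 2
      ≤ mainConst N q r A * ∑ j, ∫⁻ x, ‖h j x‖ₑ ^ 2 := by
  have hq1 : 1 ≤ q := (one_le_two.trans hr2.le).trans hrq.le
  set Φ : ℕ → ℝ → ℝ → ℂ := fun n x θ => ∑ j, a n j * ex (ξ j * x)
    * invF (fun η => avgSymbol (2 ^ K / 2 ^ n) η * h j η) (x - gridFract (2 ^ K / 2 ^ n) (x - θ))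
    with hΦ
  have hL : ∀ n, (0 : ℝ) < 2 ^ K / 2 ^ n := fun n => by positivity
  have hΦm : ∀ n, Measurable fun p : ℝ × ℝ => Φ n p.1 p.2 := fun n => by
    refine Finset.measurable_sum _ fun j _ => Measurable.mul ?_ ?_
    · exact (continuous_const.mul (continuous_ex.comp
        (continuous_const.mul continuous_fst))).measurable
    · refine (continuous_invF (integrable_avgSymbol_mul (hL n) (h1 j))).measurable.comp ?_
      exact measurable_fst.sub ((measurable_gridFract _).comp (measurable_fst.sub measurable_snd))
  have hterm : ∀ n x j, Integrable (fun θ => a n j * ex (ξ j * x)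
    * invF (fun η => avgSymbol (2 ^ K / 2 ^ n) η * h j η) (x - gridFract (2 ^ K / 2 ^ n) (x - θ)))
      (shiftMeasure K) := fun n x j => by
    refine Integrable.const_mul ?_ _
    refine Integrable.of_bound (C := ∫ η, ‖avgSymbol (2 ^ K / 2 ^ n) η * h j η‖) ?_
      (Filter.Eventually.of_forall fun θ => norm_invF_le _ _)
    refine ((continuous_invF (integrable_avgSymbol_mul (hL n) (h1 j))).measurable.comp
      ?_).aestronglyMeasurable
    exact measurable_const.sub ((measurable_gridFract _).comp (measurable_const.sub measurable_id))
  have hΦi : ∀ n x, Integrable (Φ n x) (shiftMeasure K) := fun n x =>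
    integrable_finsetSum _ fun j _ => hterm n x j
  have havg : ∀ n x, ∫ θ, Φ n x θ ∂(shiftMeasure K) = ∑ j, a n j * ex (ξ j * x)
        * invF (fun η => gridSymbol (2 ^ K / 2 ^ n) η * h j η) x := fun n x => by
    simp only [hΦ]
    rw [integral_finsetSum _ fun j _ => hterm n x j]
    refine Finset.sum_congr rfl fun j _ => ?_
    rw [integral_const_mul, ← integral_shiftMeasure_dyadicAvg n (h1 j)]
    simp only [dyadicAvg_translate (h1 j)]
  have hVm : Measurable fun p : ℝ × ℝ => variationSeminorm q (Set.Iic K) (fun n => Φ n p.1 p.2) :=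
    measurable_variationSeminorm hq _ hΦm
  -- For a fixed translate, `x` is moved by `θ` to have the grid with the origin as an end point.
  have hfix : ∀ θ, ∫⁻ x, variationSeminorm q (Set.Iic K) (fun n => Φ n x θ) ^ 2
      ≤ mainConst N q r A * ∑ j, ∫⁻ x, ‖h j x‖ₑ ^ 2 := fun θ => by
    rw [← lintegral_add_right_eq_self
      (fun x => variationSeminorm q (Set.Iic K) (fun n => Φ n x θ) ^ 2) θ]
    set g : Fin N → ℝ → ℂ := fun j t => invF (h j) (t + θ)
    have hg : ∀ j, MemLp (g j) 2 := fun j =>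
      (memLp_invF (h1 j) (h2 j)).comp_measurePreserving (measurePreserving_add_right volume θ)
    have hgn : ∀ j, ∫⁻ x, ‖g j x‖ₑ ^ 2 = ∫⁻ x, ‖h j x‖ₑ ^ 2 := fun j => by
      rw [← lintegral_invF_sq (h1 j) (h2 j)]
      exact lintegral_add_right_eq_self (fun x => ‖invF (h j) x‖ₑ ^ 2) θ
    have hval : ∀ x n, Φ n (x + θ) θ
        = ∑ j, (a n j * ex (ξ j * θ)) * dyadicAvg (2 ^ K) (g j) x n * ex (ξ j * x) := fun x n => by
      refine Finset.sum_congr rfl fun j _ => ?_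
      have e := dyadicAvg_translate (K := K) (n := n) (h1 j) θ (x + θ)
      rw [add_sub_cancel_right] at e
      rw [add_sub_cancel_right, e, mul_add, ex_add]
      ring
    simp only [hval]
    refine (lintegral_variationSeminorm_dyadic_main_le hr2 hrq hq hξ K hg (A := A)
      (a := fun n j => a n j * ex (ξ j * θ)) (fun j n hn => ?_) (fun j => ?_)).trans (le_of_eq ?_)
    · rw [enorm_mul, enorm_ex, mul_one]
      exact ha j n hn
    · refine le_trans ?_ (hVa j)
      have := variationSeminorm_le_mul hrq.ne_top (one_le_two.trans hr2.le) (K := Set.Iic K)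
        (f := fun n => a n j * ex (ξ j * θ)) (g := fun n => a n j) (C := 1) fun m _ n _ => by
          rw [← sub_mul, enorm_mul, enorm_ex, one_mul, mul_one]
      rwa [one_mul] at this
    · simp only [hgn]
  calc ∫⁻ x, variationSeminorm q (Set.Iic K) (fun n => ∑ j, a n j * ex (ξ j * x)
        * invF (fun η => gridSymbol (2 ^ K / 2 ^ n) η * h j η) x) ^ 2
      ≤ ∫⁻ x, (∫⁻ θ, variationSeminorm q (Set.Iic K) (fun n => Φ n x θ) ∂(shiftMeasure K)) ^ 2 := by
        refine lintegral_mono fun x => ?_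
        simp only [← havg]
        gcongr
        exact variationSeminorm_integral_le hq hq1 fun n => hΦi n x
    _ ≤ ∫⁻ x, ∫⁻ θ, variationSeminorm q (Set.Iic K) (fun n => Φ n x θ) ^ 2 ∂(shiftMeasure K) :=
        lintegral_mono fun x => lintegral_sq_le_lintegral_sq
          (hVm.comp measurable_prodMk_left).aemeasurable
    _ = ∫⁻ θ, ∫⁻ x, variationSeminorm q (Set.Iic K) (fun n => Φ n x θ) ^ 2 ∂volume
          ∂(shiftMeasure K) :=
        lintegral_lintegral_swap (hVm.pow_const 2).aemeasurable
    _ ≤ ∫⁻ _θ, (mainConst N q r A * ∑ j, ∫⁻ x, ‖h j x‖ₑ ^ 2 ∂volume) ∂(shiftMeasure K) :=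
        lintegral_mono fun θ => hfix θ
    _ = _ := by simp

end Averaging

/-! ### Multipliers adapted to separated frequencies -/

section ErrorSymbol

/-- An error symbol is small both near the frequency, where `p` is close to `a` and the averaging
symbol is close to `1`, and far from it, where `p` vanishes and the averaging symbol decays. -/
theorem norm_sub_mul_gridSymbol_sq_le {L D u : ℝ} (hL : 0 < L) {p a : ℂ}
    (h1 : ‖p - a‖ ≤ D * (L * |u|)) (h2 : ‖a‖ ≤ D) (h3 : 1 ≤ L * |u| → p = 0) :
    ‖p - a * gridSymbol L u‖ ^ 2 ≤
      654 * D ^ 2 * (1 / (1 + (L * |u|) ^ 2) - 1 / (1 + 4 * (L * |u|) ^ 2)) := by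
  have hD : 0 ≤ D := (norm_nonneg _).trans h2
  have hg1 := norm_gridSymbol_sub_one_le hL u
  have hg2 := norm_gridSymbol_mul_le hL u
  set t := L * |u| with ht
  have ht0 : 0 ≤ t := by positivity
  have key : 1 / (1 + t ^ 2) - 1 / (1 + 4 * t ^ 2) = 3 * t ^ 2 / ((1 + t ^ 2) * (1 + 4 * t ^ 2)) := by
    field_simp
    ring
  rw [key, ← mul_div_assoc, le_div_iff₀ (by positivity)]
  rcases le_or_gt 1 t with h | h
  · rw [h3 h, zero_sub, norm_neg, norm_mul]
    have h4 : ‖a‖ * ‖gridSymbol L u‖ * t ≤ D := by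
      calc ‖a‖ * ‖gridSymbol L u‖ * t = ‖a‖ * (‖gridSymbol L u‖ * t) := by ring
        _ ≤ D * 1 := by gcongr
        _ = D := mul_one D
    have h5 : (‖a‖ * ‖gridSymbol L u‖ * t) ^ 2 ≤ D ^ 2 := by gcongr
    have h6 : (1 + t ^ 2) * (1 + 4 * t ^ 2) ≤ 10 * t ^ 2 * t ^ 2 := by
      have h7 : 1 ≤ t ^ 2 := one_le_pow₀ h
      nlinarith
    calc (‖a‖ * ‖gridSymbol L u‖) ^ 2 * ((1 + t ^ 2) * (1 + 4 * t ^ 2))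
        ≤ (‖a‖ * ‖gridSymbol L u‖) ^ 2 * (10 * t ^ 2 * t ^ 2) := by gcongr
      _ = 10 * t ^ 2 * (‖a‖ * ‖gridSymbol L u‖ * t) ^ 2 := by ring
      _ ≤ 10 * t ^ 2 * D ^ 2 := by gcongr
      _ ≤ 654 * D ^ 2 * (3 * t ^ 2) := by nlinarith [mul_nonneg (sq_nonneg D) (sq_nonneg t)]
  · have h4 : ‖p - a * gridSymbol L u‖ ≤ 14 * D * t := by
      calc ‖p - a * gridSymbol L u‖ = ‖(p - a) - a * (gridSymbol L u - 1)‖ := by congr 1; ring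
        _ ≤ ‖p - a‖ + ‖a‖ * ‖gridSymbol L u - 1‖ := by
            rw [← norm_mul]; exact norm_sub_le _ _
        _ ≤ D * t + D * (4 * Real.pi * t) := by gcongr
        _ ≤ D * t + D * (4 * 3.15 * t) := by gcongr; exact Real.pi_lt_d2.le
        _ ≤ 14 * D * t := by nlinarith [mul_nonneg hD ht0]
    have h6 : (1 + t ^ 2) * (1 + 4 * t ^ 2) ≤ 10 := by
      have h7 : t ^ 2 ≤ 1 := pow_le_one₀ ht0 h.le
      nlinarith [sq_nonneg t]
    calc ‖p - a * gridSymbol L u‖ ^ 2 * ((1 + t ^ 2) * (1 + 4 * t ^ 2))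
        ≤ (14 * D * t) ^ 2 * 10 := by gcongr
      _ ≤ 654 * D ^ 2 * (3 * t ^ 2) := by nlinarith [mul_nonneg (sq_nonneg D) (sq_nonneg t)]

/-- The bounds of `norm_sub_mul_gridSymbol_sq_le` telescope over the dyadic scales. -/
theorem sum_norm_sub_mul_gridSymbol_sq_le (K : ℕ) {D u : ℝ} {p a : ℕ → ℂ}
    (h1 : ∀ n ≤ K, ‖p n - a n‖ ≤ D * (2 ^ K / 2 ^ n * |u|)) (h2 : ∀ n ≤ K, ‖a n‖ ≤ D)
    (h3 : ∀ n ≤ K, 1 ≤ 2 ^ K / 2 ^ n * |u| → p n = 0) :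
    ∑ n ∈ Finset.range (K + 1), ‖p n - a n * gridSymbol (2 ^ K / 2 ^ n) u‖ ^ 2 ≤ 654 * D ^ 2 := by
  have hG : ∀ n : ℕ, 4 * (2 ^ K / 2 ^ (n + 1) * |u|) ^ 2 = (2 ^ K / 2 ^ n * |u|) ^ 2 := by
    intro n
    rw [pow_succ]
    field_simp
    ring
  have h4 : ∀ m : ℕ, ∑ n ∈ Finset.range (m + 1), (1 / (1 + (2 ^ K / 2 ^ n * |u|) ^ 2)
      - 1 / (1 + 4 * (2 ^ K / 2 ^ n * |u|) ^ 2)) ≤ 1 / (1 + (2 ^ K / 2 ^ m * |u|) ^ 2) := by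
    intro m
    induction m with
    | zero =>
      simp only [zero_add, Finset.sum_range_one]
      have : 0 ≤ 1 / (1 + 4 * (2 ^ K / 2 ^ 0 * |u|) ^ 2) := by positivity
      linarith
    | succ m ih =>
      rw [Finset.sum_range_succ, hG]
      linarith
  calc _ ≤ ∑ n ∈ Finset.range (K + 1), 654 * D ^ 2 * (1 / (1 + (2 ^ K / 2 ^ n * |u|) ^ 2)
      - 1 / (1 + 4 * (2 ^ K / 2 ^ n * |u|) ^ 2)) := by
        refine Finset.sum_le_sum fun n hn => ?_
        have hn : n ≤ K := Nat.lt_succ_iff.1 (Finset.mem_range.1 hn)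
        exact norm_sub_mul_gridSymbol_sq_le (by positivity) (h1 n hn) (h2 n hn) (h3 n hn)
    _ ≤ 654 * D ^ 2 * 1 := by
        rw [← Finset.mul_sum]
        gcongr
        refine (h4 K).trans (div_le_one_of_le₀ ?_ (by positivity))
        nlinarith [sq_nonneg (2 ^ K / 2 ^ K * |u|)]
    _ = _ := mul_one _

end ErrorSymbol

section Multiplier

theorem enorm_sum_indicator_sq {N : ℕ} {B : Fin N → Set ℝ} (hB : Pairwise (Function.onFun Disjoint B))
    (F : Fin N → ℝ → ℂ) (η : ℝ) :
    ‖∑ j, (B j).indicator (F j) η‖ₑ ^ 2 = ∑ j, ‖(B j).indicator (F j) η‖ₑ ^ 2 := by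
  by_cases h : ∃ j, η ∈ B j
  · obtain ⟨j, hj⟩ := h
    have h0 : ∀ i, i ≠ j → (B i).indicator (F i) η = 0 := fun i hi =>
      Set.indicator_of_notMem (fun hi' => Set.disjoint_left.1 (hB hi) hi' hj) _
    rw [Finset.sum_eq_single j (fun i _ hi => h0 i hi) (by simp),
      Finset.sum_eq_single j (fun i _ hi => by simp [h0 i hi]) (by simp)]
  · push Not at h
    simp [Set.indicator_of_notMem (h _)]

/-- The error made by replacing each symbol `ψ n j` near the frequency `ξ j` by the symbol of the
averaging operator times the value at `ξ j`. -/
noncomputable def errorSymbol {N : ℕ} (K : ℕ) (ξ : Fin N → ℝ) (ψ : ℕ → Fin N → ℝ → ℂ)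
    (n : ℕ) (j : Fin N) (η : ℝ) : ℂ :=
  ψ n j η - ψ n j (ξ j) * gridSymbol (2 ^ K / 2 ^ n) (η - ξ j)

theorem norm_errorSymbol_le {N K : ℕ} {ξ : Fin N → ℝ} {ψ : ℕ → Fin N → ℝ → ℂ} {D : ℝ}
    (hbd : ∀ n ≤ K, ∀ j η, ‖ψ n j η‖ ≤ D) {n : ℕ} (hn : n ≤ K) (j : Fin N) (η : ℝ) :
    ‖errorSymbol K ξ ψ n j η‖ ≤ 2 * D := by
  have h1 := norm_gridSymbol_le_one (L := 2 ^ K / 2 ^ n) (by positivity) (η - ξ j)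
  calc _ ≤ ‖ψ n j η‖ + ‖ψ n j (ξ j)‖ * ‖gridSymbol (2 ^ K / 2 ^ n) (η - ξ j)‖ := by
        rw [← norm_mul]; exact norm_sub_le _ _
    _ ≤ D + D * 1 := by
        have := hbd n hn j η
        have := hbd n hn j (ξ j)
        have := (norm_nonneg _).trans this
        gcongr
    _ = 2 * D := by ring

theorem continuous_errorSymbol {N K : ℕ} {ξ : Fin N → ℝ} {ψ : ℕ → Fin N → ℝ → ℂ}
    (hψ : ∀ n j, Continuous (ψ n j)) (n : ℕ) (j : Fin N) :
    Continuous (errorSymbol K ξ ψ n j) :=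
  (hψ n j).sub (continuous_const.mul
    ((continuous_gridSymbol _).comp (by fun_prop : Continuous fun η => η - ξ j)))

/-- The maximal variation of the error terms, by Plancherel and the `ℓ²` bound of the error
symbols over all scales. -/
theorem lintegral_variationSeminorm_error_le {q : ℝ≥0∞} (hq2 : 2 ≤ q) {N K : ℕ} {ξ : Fin N → ℝ}
    {ψ : ℕ → Fin N → ℝ → ℂ} (hψ : ∀ n j, Continuous (ψ n j)) {D : ℝ≥0}
    (hbd : ∀ n ≤ K, ∀ j η, ‖ψ n j η‖ ≤ D)
    (hlip : ∀ n ≤ K, ∀ j η, ‖ψ n j η - ψ n j (ξ j)‖ ≤ D * (2 ^ K / 2 ^ n * |η - ξ j|))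
    (hsupp : ∀ n ≤ K, ∀ j η, 1 ≤ 2 ^ K / 2 ^ n * |η - ξ j| → ψ n j η = 0)
    {B : Fin N → Set ℝ} (hBm : ∀ j, MeasurableSet (B j)) (hB : Pairwise (Function.onFun Disjoint B))
    {h : ℝ → ℂ} (h1 : Integrable h) (h2 : MemLp h 2) :
    ∫⁻ x, variationSeminorm q (Set.Iic K) (fun n => invF (fun η =>
      ∑ j, (B j).indicator (fun η => errorSymbol K ξ ψ n j η * h η) η) x) ^ 2 ≤
      (52 * (D : ℝ≥0∞)) ^ 2 * ∫⁻ η, ‖h η‖ₑ ^ 2 := by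
  set E : ℕ → ℝ → ℂ := fun n η =>
    ∑ j, (B j).indicator (fun η => errorSymbol K ξ ψ n j η * h η) η with hE
  have hm : ∀ n j, Continuous (errorSymbol K ξ ψ n j) := continuous_errorSymbol hψ
  have hE1 : ∀ n ≤ K, Integrable (E n) := fun n hn => integrable_finsetSum _ fun j _ =>
    (h1.bdd_mul (hm n j).aestronglyMeasurable
      (Filter.Eventually.of_forall (norm_errorSymbol_le hbd hn j))).indicator (hBm j)
  have hE2 : ∀ n ≤ K, MemLp (E n) 2 := fun n hn => memLp_finsetSum _ fun j _ =>
    (MemLp.of_le_mul (c := 2 * D) h2 ((hm n j).aestronglyMeasurable.mul h1.aestronglyMeasurable)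
      (Filter.Eventually.of_forall fun η => by
        rw [Pi.mul_apply, norm_mul]; gcongr; exact norm_errorSymbol_le hbd hn j η)).indicator (hBm j)
  have hptw : ∀ η, ∑ n ∈ Finset.range (K + 1), ‖E n η‖ₑ ^ 2 ≤ 654 * (D : ℝ≥0∞) ^ 2 * ‖h η‖ₑ ^ 2 := by
    intro η
    by_cases hη : ∃ j, η ∈ B j
    · obtain ⟨j, hj⟩ := hη
      have h0 : ∀ n, E n η = errorSymbol K ξ ψ n j η * h η := by
        intro n
        rw [hE]
        dsimp only
        rw [Finset.sum_eq_single j, Set.indicator_of_mem hj]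
        · exact fun i _ hi =>
            Set.indicator_of_notMem (fun hi' => Set.disjoint_left.1 (hB hi) hi' hj) _
        · simp
      simp only [h0, enorm_mul, mul_pow]
      rw [← Finset.sum_mul]
      gcongr
      have := sum_norm_sub_mul_gridSymbol_sq_le K (D := D) (u := η - ξ j) (p := fun n => ψ n j η)
        (a := fun n => ψ n j (ξ j)) (fun n hn => hlip n hn j η) (fun n hn => hbd n hn j _)
        (fun n hn => hsupp n hn j η)
      have h3 : ∑ n ∈ Finset.range (K + 1), ‖errorSymbol K ξ ψ n j η‖ₑ ^ 2 =
          ENNReal.ofReal (∑ n ∈ Finset.range (K + 1), ‖errorSymbol K ξ ψ n j η‖ ^ 2) := by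
        rw [ENNReal.ofReal_sum_of_nonneg fun _ _ => by positivity]
        refine Finset.sum_congr rfl fun n _ => ?_
        rw [ENNReal.ofReal_pow (norm_nonneg _), ofReal_norm]
      rw [h3]
      refine (ENNReal.ofReal_le_ofReal this).trans_eq ?_
      rw [ENNReal.ofReal_mul (by positivity), ENNReal.ofReal_pow D.coe_nonneg,
        ENNReal.ofReal_coe_nnreal]
      norm_num
    · push Not at hη
      have h0 : ∀ n, E n η = 0 := fun n => Finset.sum_eq_zero fun j _ =>
        Set.indicator_of_notMem (hη j) _
      simp [h0]
  calc _ ≤ ∫⁻ x, 4 * ∑ n ∈ Finset.range (K + 1), ‖invF (E n) x‖ₑ ^ 2 := by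
        refine lintegral_mono fun x => ?_
        have h3 := variationSeminorm_rpow_le_sum (r := 2) (by simp) (by norm_num) K
          (fun n => invF (E n) x)
        simp only [ENNReal.toReal_ofNat, ENNReal.rpow_ofNat] at h3
        calc _ ≤ variationSeminorm 2 (Set.Iic K) (fun n => invF (E n) x) ^ 2 := by
              gcongr; exact variationSeminorm_anti (by norm_num) hq2 _ _
          _ ≤ _ := h3
          _ = _ := by norm_num
    _ = 4 * ∑ n ∈ Finset.range (K + 1), ∫⁻ η, ‖E n η‖ₑ ^ 2 := by
        have hc : ∀ n ∈ Finset.range (K + 1), Measurable fun x => ‖invF (E n) x‖ₑ ^ 2 := by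
          intro n hn
          have hn : n ≤ K := Nat.lt_succ_iff.1 (Finset.mem_range.1 hn)
          exact (continuous_invF (hE1 n hn)).measurable.enorm.pow_const 2
        rw [lintegral_const_mul _ (Finset.measurable_fun_sum _ hc), lintegral_finsetSum _ hc]
        congr 1
        refine Finset.sum_congr rfl fun n hn => ?_
        have hn : n ≤ K := Nat.lt_succ_iff.1 (Finset.mem_range.1 hn)
        exact lintegral_invF_sq (hE1 n hn) (hE2 n hn)
    _ = 4 * ∫⁻ η, ∑ n ∈ Finset.range (K + 1), ‖E n η‖ₑ ^ 2 := by
        rw [lintegral_finsetSum']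
        intro n hn
        have hn : n ≤ K := Nat.lt_succ_iff.1 (Finset.mem_range.1 hn)
        exact (hE1 n hn).aestronglyMeasurable.enorm.pow_const 2
    _ ≤ 4 * ∫⁻ η, 654 * (D : ℝ≥0∞) ^ 2 * ‖h η‖ₑ ^ 2 := by
        gcongr with η
        exact hptw η
    _ = 2616 * (D : ℝ≥0∞) ^ 2 * ∫⁻ η, ‖h η‖ₑ ^ 2 := by
        rw [lintegral_const_mul'' _ (h1.aestronglyMeasurable.enorm.pow_const 2), ← mul_assoc,
          ← mul_assoc]
        norm_num
    _ ≤ _ := by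
        rw [mul_pow]
        gcongr
        norm_num

/-- Modulation by the frequency `ξ` is translation on the frequency side. -/
theorem ex_mul_invF_shift (κ h : ℝ → ℂ) (ξ x : ℝ) :
    ex (ξ * x) * invF (fun η => κ η * h (η + ξ)) x = invF (fun η => κ (η - ξ) * h η) x := by
  rw [invF, invF, ← integral_const_mul,
    ← integral_sub_right_eq_self (fun η => ex (ξ * x) * (ex (η * x) * (κ η * h (η + ξ)))) ξ]
  refine integral_congr_ae (Filter.Eventually.of_forall fun η => ?_)
  dsimp only
  rw [sub_add_cancel, ← mul_assoc, ← ex_add]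
  congr 2
  ring

/-- Bessel's inequality for the restrictions of `h` to disjoint sets. -/
theorem sum_lintegral_indicator_sq_le {N : ℕ} {B : Fin N → Set ℝ} (hBm : ∀ j, MeasurableSet (B j))
    (hB : Pairwise (Function.onFun Disjoint B)) {h : ℝ → ℂ} (h1 : AEStronglyMeasurable h) :
    ∑ j, ∫⁻ η, ‖(B j).indicator h η‖ₑ ^ 2 ≤ ∫⁻ η, ‖h η‖ₑ ^ 2 := by
  rw [← lintegral_finsetSum' _ fun j _ => ((h1.indicator (hBm j)).enorm.pow_const 2)]
  refine lintegral_mono fun η => ?_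
  rw [← enorm_sum_indicator_sq hB fun _ => h]
  by_cases h : ∃ j, η ∈ B j
  · obtain ⟨j, hj⟩ := h
    rw [Finset.sum_eq_single j, Set.indicator_of_mem hj]
    · exact fun i _ hi =>
        Set.indicator_of_notMem (fun hi' => Set.disjoint_left.1 (hB hi) hi' hj) _
    · simp
  · push Not at h
    simp [Set.indicator_of_notMem (h _)]

/-- The maximal `q`-variation of a family of multipliers adapted to the dyadic scales around
separated frequencies. -/
theorem eLpNorm_variationSeminorm_multiplier_le {q r : ℝ≥0∞} (hr2 : 2 < r) (hrq : r < q)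
    (hq : q ≠ ∞) {N K : ℕ} {ξ : Fin N → ℝ} (hξ : Separated ξ)
    {ψ : ℕ → Fin N → ℝ → ℂ} (hψ : ∀ n j, Continuous (ψ n j)) {D : ℝ≥0}
    (hbd : ∀ n ≤ K, ∀ j η, ‖ψ n j η‖ ≤ D)
    (hlip : ∀ n ≤ K, ∀ j η, ‖ψ n j η - ψ n j (ξ j)‖ ≤ D * (2 ^ K / 2 ^ n * |η - ξ j|))
    (hsupp : ∀ n ≤ K, ∀ j η, 1 ≤ 2 ^ K / 2 ^ n * |η - ξ j| → ψ n j η = 0)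
    {B : Fin N → Set ℝ} (hBm : ∀ j, MeasurableSet (B j)) (hB : Pairwise (Function.onFun Disjoint B))
    (hψB : ∀ n ≤ K, ∀ j η, η ∉ B j → ψ n j η = 0)
    {h : ℝ → ℂ} (h1 : Integrable h) (h2 : MemLp h 2) {A : ℝ≥0∞}
    (ha : ∀ j, ∀ n ≤ K, ‖ψ n j (ξ j)‖ₑ ≤ A)
    (hVa : ∀ j, variationSeminorm r (Set.Iic K) (fun n => ψ n j (ξ j)) ≤ A) :
    eLpNorm (fun x => variationSeminorm q (Set.Iic K)
        (fun n => invF (fun η => ∑ j, ψ n j η * h η) x)) 2 volume ≤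
      (2 * expSumConst q r * (lepingleConst r + 2) *
        ENNReal.ofReal ((N : ℝ) ^ (1 / 2 - 1 / r.toReal)) * A + 52 * D) * eLpNorm h 2 volume := by
  have hq1 : 1 ≤ q := (one_le_two.trans hr2.le).trans hrq.le
  set κ : ℕ → ℝ → ℂ := fun n => gridSymbol (2 ^ K / 2 ^ n) with hκ
  have hκc : ∀ n, Continuous (κ n) := fun n => continuous_gridSymbol _
  set H : Fin N → ℝ → ℂ := fun j => (B j).indicator h with hH
  have hH1 : ∀ j, Integrable (H j) := fun j => h1.indicator (hBm j)
  have hH2 : ∀ j, MemLp (H j) 2 := fun j => h2.indicator (hBm j)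
  set E : ℕ → ℝ → ℂ := fun n η =>
    ∑ j, (B j).indicator (fun η => errorSymbol K ξ ψ n j η * h η) η with hE
  have hE1 : ∀ n ≤ K, Integrable (E n) := fun n hn => integrable_finsetSum _ fun j _ =>
    (h1.bdd_mul (continuous_errorSymbol hψ n j).aestronglyMeasurable
      (Filter.Eventually.of_forall (norm_errorSymbol_le hbd hn j))).indicator (hBm j)
  set M : ℕ → ℝ → ℂ := fun n x =>
    ∑ j, ψ n j (ξ j) * ex (ξ j * x) * invF (fun η => κ n η * H j (η + ξ j)) x with hM
  have hκ1 : ∀ n j, Integrable fun η => κ n (η - ξ j) * H j η := fun n j =>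
    (hH1 j).bdd_mul (c := 1) ((hκc n).comp (by fun_prop : Continuous fun η => η - ξ j)).aestronglyMeasurable
      (Filter.Eventually.of_forall fun η => norm_gridSymbol_le_one (by positivity) _)
  -- The decomposition into modulated averages and errors.
  have hdec : ∀ x, ∀ n ≤ K, invF (fun η => ∑ j, ψ n j η * h η) x = M n x + invF (E n) x := by
    intro x n hn
    have e1 : (fun η => ∑ j, ψ n j η * h η) =
        fun η => (∑ j, ψ n j (ξ j) * (κ n (η - ξ j) * H j η)) + E n η := by
      funext η
      rw [← Finset.sum_add_distrib]
      refine Finset.sum_congr rfl fun j _ => ?_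
      by_cases hη : η ∈ B j
      · simp only [hH, Set.indicator_of_mem hη, errorSymbol, hκ]
        ring
      · simp only [hH, Set.indicator_of_notMem hη, hψB n hn j η hη]
        ring
    rw [e1, invF_add (integrable_finsetSum _ fun j _ => (hκ1 n j).const_mul _) (hE1 n hn),
      invF_sum _ fun j _ => (hκ1 n j).const_mul _]
    congr 1
    refine Finset.sum_congr rfl fun j _ => ?_
    rw [invF_const_mul, mul_assoc, ex_mul_invF_shift]
  have hMm : ∀ n, Measurable (M n) := by
    intro n
    refine Continuous.measurable (continuous_finsetSum _ fun j _ => ?_)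
    refine (continuous_const.mul (by fun_prop)).mul (continuous_invF ?_)
    have := (hκ1 n j).comp_add_right (ξ j)
    simpa using this
  have hmain : eLpNorm (fun x => variationSeminorm q (Set.Iic K) (fun n => M n x)) 2 volume ≤
      2 * expSumConst q r * (lepingleConst r + 2) *
        ENNReal.ofReal ((N : ℝ) ^ (1 / 2 - 1 / r.toReal)) * A * eLpNorm h 2 volume := by
    rw [eLpNorm_two_le_iff]
    refine (lintegral_variationSeminorm_main_le hr2 hrq hq hξ K
      (h := fun j η => H j (η + ξ j)) (fun j => (hH1 j).comp_add_right (ξ j))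
      (fun j => (hH2 j).comp_measurePreserving (measurePreserving_add_right volume (ξ j)))
      ha hVa).trans ?_
    have e2 : ∀ j, ∫⁻ η, ‖H j (η + ξ j)‖ₑ ^ 2 = ∫⁻ η, ‖H j η‖ₑ ^ 2 := fun j =>
      lintegral_add_right_eq_self (fun η => ‖H j η‖ₑ ^ 2) (ξ j)
    simp only [e2]
    have e3 : 2 * (lepingleConst r ^ 2 + 4) * A ^ 2 ≤ (2 * (lepingleConst r + 2) * A) ^ 2 := by
      rw [mul_pow, mul_pow]
      refine mul_le_mul_left ?_ _
      calc 2 * (lepingleConst r ^ 2 + 4) ≤ 2 ^ 2 * (lepingleConst r ^ 2 + 4) := by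
            gcongr; norm_num
        _ ≤ 2 ^ 2 * (lepingleConst r + 2) ^ 2 := by
            gcongr
            calc lepingleConst r ^ 2 + 4 ≤ lepingleConst r ^ 2 + 4 + 4 * lepingleConst r :=
                  le_self_add
              _ = _ := by ring
    calc _ ≤ (expSumConst q r * ENNReal.ofReal ((N : ℝ) ^ (1 / 2 - 1 / r.toReal))) ^ 2 *
          (2 * (lepingleConst r + 2) * A) ^ 2 * ∫⁻ η, ‖h η‖ₑ ^ 2 := by
          rw [mainConst]
          gcongr
          exact sum_lintegral_indicator_sq_le hBm hB h1.aestronglyMeasurable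
      _ = _ := by
          rw [← eLpNorm_enorm h, mul_pow _ (eLpNorm _ _ _), eLpNorm_two_sq]
          ring
  have herr : eLpNorm (fun x => variationSeminorm q (Set.Iic K) (fun n => invF (E n) x)) 2 volume ≤
      52 * D * eLpNorm h 2 volume := by
    rw [eLpNorm_two_le_iff]
    refine (lintegral_variationSeminorm_error_le (hr2.le.trans hrq.le) hψ hbd hlip hsupp hBm hB
      h1 h2).trans_eq ?_
    rw [← eLpNorm_enorm h, mul_pow _ (eLpNorm _ _ _), eLpNorm_two_sq]
  have hEm : ∀ n, Measurable (fun x => if n ≤ K then invF (E n) x else 0) := by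
    intro n
    split_ifs with hn
    · exact (continuous_invF (hE1 n hn)).measurable
    · exact measurable_const
  have hEV : ∀ x, variationSeminorm q (Set.Iic K) (fun n => invF (E n) x) =
      variationSeminorm q (Set.Iic K) (fun n => if n ≤ K then invF (E n) x else 0) := fun x =>
    variationSeminorm_congr fun n hn => (if_pos hn).symm
  calc _ ≤ eLpNorm ((fun x => variationSeminorm q (Set.Iic K) (fun n => M n x)) +
        fun x => variationSeminorm q (Set.Iic K) (fun n => invF (E n) x)) 2 volume := by
        refine eLpNorm_mono_enorm fun x => ?_
        simp only [enorm_eq_self, Pi.add_apply]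
        refine le_trans (le_of_eq ?_) (variationSeminorm_add_le hq hq1 _ _ _)
        exact variationSeminorm_congr fun n hn => hdec x n hn
    _ ≤ _ := by
        refine (eLpNorm_add_le ?_ ?_ (by norm_num)).trans ?_
        · exact (measurable_variationSeminorm hq _ hMm).aestronglyMeasurable
        · simp only [hEV]
          exact (measurable_variationSeminorm hq _ hEm).aestronglyMeasurable
        · rw [add_mul]
          gcongr

end Multiplier

/-! ### Dyadic symbols and the operators `Δ_k` -/

section Dyadic

theorem mem_dyadic_iff {k n : ℤ} {x : ℝ} : x ∈ dyadic k n ↔ ⌊x / (2 : ℝ) ^ k⌋ = n := by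
  have h : (0 : ℝ) < (2 : ℝ) ^ k := by positivity
  rw [dyadic, Set.mem_Ico, Int.floor_eq_iff, le_div_iff₀ h, div_lt_iff₀ h, mul_comm,
    mul_comm ((2 : ℝ) ^ k)]

theorem abs_sub_lt_of_mem_dyadic {k n : ℤ} {x y : ℝ} (hx : x ∈ dyadic k n)
    (hy : y ∈ dyadic k n) : |x - y| < (2 : ℝ) ^ k := by
  rw [dyadic, mul_add, mul_one] at hx hy
  rw [abs_lt]
  constructor <;> linarith [hx.1, hx.2, hy.1, hy.2]

/-- Dyadic intervals of length at most `1` are contained in the unit intervals of the integer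
grid. -/
theorem floor_eq_of_mem_dyadic {k n : ℤ} (hk : k ≤ 0) {x y : ℝ} (hx : x ∈ dyadic k n)
    (hy : y ∈ dyadic k n) : ⌊x⌋ = ⌊y⌋ := by
  obtain ⟨m, rfl⟩ : ∃ m : ℕ, k = -m := ⟨k.natAbs, by omega⟩
  have key : ∀ z : ℝ, ⌊z⌋ = ⌊z / (2 : ℝ) ^ (-(m : ℤ))⌋ / ((2 ^ m : ℕ) : ℤ) := by
    intro z
    rw [← Int.floor_div_natCast]
    congr 1
    rw [zpow_neg, zpow_natCast]
    push_cast
    field_simp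
  rw [key x, key y, mem_dyadic_iff.1 hx, mem_dyadic_iff.1 hy]

theorem separated_of_consecutive {N : ℕ} {ξ : Fin N → ℝ}
    (h : ∀ (i : ℕ) (hi : i + 1 < N), ξ ⟨i, Nat.lt_of_succ_lt hi⟩ + 1 < ξ ⟨i + 1, hi⟩) :
    Separated ξ := by
  have key : ∀ (d i : ℕ) (hi : i + d + 1 < N), ξ ⟨i, by omega⟩ + 1 < ξ ⟨i + d + 1, hi⟩ := by
    intro d
    induction d with
    | zero => exact fun i hi => h i hi
    | succ d ih =>
      intro i hi
      have h1 := ih i (by omega)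
      have h2 := h (i + d + 1) hi
      have h3 : ξ ⟨i + d + 1 + 1, hi⟩ = ξ ⟨i + (d + 1) + 1, hi⟩ := rfl
      linarith
  have key2 : ∀ i j : Fin N, i < j → ξ i + 1 < ξ j := by
    intro i j hij
    have h1 : (i : ℕ) < j := hij
    have := key (j - i - 1) i (by omega)
    have e : (⟨i + (j - i - 1) + 1, by omega⟩ : Fin N) = j := Fin.ext (by dsimp only; omega)
    rwa [e] at this
  intro i j hij
  rcases lt_or_gt_of_ne hij with hlt | hlt
  · rw [abs_sub_comm]
    exact (by linarith [key2 i j hlt] : 1 < ξ j - ξ i).trans_le (le_abs_self _)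
  · exact (by linarith [key2 j i hlt] : 1 < ξ i - ξ j).trans_le (le_abs_self _)

theorem Separated.floor_injective {N : ℕ} {ξ : Fin N → ℝ} (hξ : Separated ξ) :
    Function.Injective fun j => ⌊ξ j⌋ := by
  intro i j hij
  by_contra hne
  exact absurd (Int.abs_sub_lt_one_of_floor_eq_floor hij) (hξ i j hne).le.not_gt

end Dyadic

section Symbol

variable {φ : ℤ → ℤ → 𝓢(ℝ, ℂ)}

theorem continuous_fourier (g : 𝓢(ℝ, ℂ)) : Continuous (𝓕 (g : ℝ → ℂ)) := by
  rw [← SchwartzMap.fourier_coe]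
  exact (𝓕 g).continuous

theorem norm_deriv_fourier_le {D : ℝ≥0} (hD : derivBound φ 1 ≤ D) (k n : ℤ) (x : ℝ) :
    ‖deriv (𝓕 (φ k n : ℝ → ℂ)) x‖ ≤ D * ((2 : ℝ) ^ k)⁻¹ := by
  have h1 : ENNReal.ofReal (((2 : ℝ) ^ k) ^ 1 * ‖iteratedDeriv 1 (𝓕 (φ k n : ℝ → ℂ)) x‖) ≤ D :=
    (iSup_le_iff.1 (iSup_le_iff.1 (iSup_le_iff.1 hD k) n) x)
  rw [ENNReal.ofReal_le_coe, pow_one, iteratedDeriv_one] at h1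
  have h : (0 : ℝ) < (2 : ℝ) ^ k := by positivity
  rw [← div_eq_mul_inv, le_div_iff₀ h]
  linarith

theorem norm_fourier_sub_le {D : ℝ≥0} (hD : derivBound φ 1 ≤ D) (k n : ℤ) (x y : ℝ) :
    ‖𝓕 (φ k n : ℝ → ℂ) x - 𝓕 (φ k n : ℝ → ℂ) y‖ ≤ D * (((2 : ℝ) ^ k)⁻¹ * |x - y|) := by
  rw [← mul_assoc, ← Real.norm_eq_abs]
  refine Convex.norm_image_sub_le_of_norm_deriv_le (s := Set.univ) (fun z _ => ?_)
    (fun z _ => norm_deriv_fourier_le hD k n z) convex_univ (Set.mem_univ _) (Set.mem_univ _)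
  rw [← SchwartzMap.fourier_coe]
  exact (𝓕 (φ k n)).differentiableAt

theorem fourier_eq_zero
    (hφ : ∀ k n : ℤ, Function.support (𝓕 (φ k n : ℝ → ℂ)) ⊆ dyadic k n) {k n : ℤ} {x : ℝ} (hx : x ∉ dyadic k n) : 𝓕 (φ k n : ℝ → ℂ) x = 0 := by
  by_contra h
  exact hx (hφ k n h)

/-- The bound on the derivative bounds the symbol, which vanishes off an interval of length `2 ^ k`. -/
theorem norm_fourier_le
    (hφ : ∀ k n : ℤ, Function.support (𝓕 (φ k n : ℝ → ℂ)) ⊆ dyadic k n)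
    {D : ℝ≥0} (hD : derivBound φ 1 ≤ D) (k n : ℤ) (x : ℝ) :
    ‖𝓕 (φ k n : ℝ → ℂ) x‖ ≤ D := by
  have h : (0 : ℝ) < (2 : ℝ) ^ k := by positivity
  by_cases hx : x ∈ dyadic k n
  · -- The symbol vanishes at the point at distance `2 ^ k` to the left of `x`.
    have hy : x - 2 ^ k ∉ dyadic k n := by
      intro hy
      have := abs_sub_lt_of_mem_dyadic hx hy
      rw [sub_sub_cancel, abs_of_pos h] at this
      exact lt_irrefl _ this
    have := norm_fourier_sub_le hD k n x (x - 2 ^ k)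
    rwa [fourier_eq_zero hφ hy, sub_zero, sub_sub_cancel, abs_of_pos h,
      inv_mul_cancel₀ h.ne', mul_one] at this
  · rw [fourier_eq_zero hφ hx, norm_zero]
    exact D.2

theorem symbolSum_eq
    (hφ : ∀ k n : ℤ, Function.support (𝓕 (φ k n : ℝ → ℂ)) ⊆ dyadic k n) (k : ℤ) (x : ℝ) :
    symbolSum φ k x = 𝓕 (φ k ⌊x / (2 : ℝ) ^ k⌋ : ℝ → ℂ) x := by
  refine finsum_eq_single _ _ fun n hn => fourier_eq_zero hφ fun hx => hn ?_
  exact (mem_dyadic_iff.1 hx).symm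

end Symbol

section DeltaFormula

variable {φ : ℤ → ℤ → 𝓢(ℝ, ℂ)}

/-- Distinct frequencies lie in distinct dyadic intervals of length at most `1`, so that the sum over
the dyadic intervals meeting the frequencies is a sum over the frequencies. -/
theorem Delta_eq_sum {N : ℕ} {ξ : Fin N → ℝ} (hξ : Separated ξ) {k : ℤ} (hk : k ≤ 0) (f : ℝ → ℂ)
    (x : ℝ) : Delta φ (Set.range ξ) k f x =
      ∑ j, convolution f (φ k ⌊ξ j / (2 : ℝ) ^ k⌋) (ContinuousLinearMap.mul ℂ ℂ) volume x := by
  have hinj : Function.Injective fun j => ⌊ξ j / (2 : ℝ) ^ k⌋ := by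
    intro i j hij
    exact hξ.floor_injective
      (floor_eq_of_mem_dyadic hk (mem_dyadic_iff.2 hij) (mem_dyadic_iff.2 rfl))
  have hset : ∀ n, (dyadic k n ∩ Set.range ξ).Nonempty ↔
      n ∈ Set.range fun j => ⌊ξ j / (2 : ℝ) ^ k⌋ := by
    intro n
    constructor
    · rintro ⟨_, hx, j, rfl⟩
      exact ⟨j, mem_dyadic_iff.1 hx⟩
    · rintro ⟨j, hj⟩
      exact ⟨ξ j, mem_dyadic_iff.2 hj, j, rfl⟩
  rw [Delta]
  simp only [hset]
  rw [finsum_mem_range hinj, finsum_eq_sum_of_fintype]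

theorem convolution_eq_invF (f g : 𝓢(ℝ, ℂ)) (x : ℝ) :
    convolution f g (ContinuousLinearMap.mul ℂ ℂ) volume x =
      invF (fun η => 𝓕 (g : ℝ → ℂ) η * 𝓕 (f : ℝ → ℂ) η) x := by
  rw [← SchwartzMap.convolution_apply, ← invF_fourier]
  congr 1
  funext η
  rw [← SchwartzMap.fourier_coe, SchwartzMap.fourier_convolution_apply,
    Real.fourier_mul_convolution_eq f.integrable g.integrable, mul_comm]

theorem integrable_fourier_mul (f g : 𝓢(ℝ, ℂ)) :
    Integrable fun η => 𝓕 (g : ℝ → ℂ) η * 𝓕 (f : ℝ → ℂ) η := by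
  have h : (fun η => 𝓕 (g : ℝ → ℂ) η * 𝓕 (f : ℝ → ℂ) η) =
      SchwartzMap.pairing (ContinuousLinearMap.mul ℂ ℂ) (𝓕 g) (𝓕 f) := by
    funext η
    simp [SchwartzMap.fourier_coe]
  rw [h]
  exact SchwartzMap.integrable _

theorem Delta_eq_invF {N : ℕ} {ξ : Fin N → ℝ} (hξ : Separated ξ) {k : ℤ} (hk : k ≤ 0)
    (f : 𝓢(ℝ, ℂ)) (x : ℝ) : Delta φ (Set.range ξ) k f x =
      invF (fun η => ∑ j, 𝓕 (φ k ⌊ξ j / (2 : ℝ) ^ k⌋ : ℝ → ℂ) η * 𝓕 (f : ℝ → ℂ) η) x := by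
  rw [Delta_eq_sum hξ hk, invF_sum _ fun j _ => integrable_fourier_mul _ _]
  exact Finset.sum_congr rfl fun j _ => convolution_eq_invF _ _ _

theorem measurable_Delta {X : Set ℝ} (hX : X.Finite) (k : ℤ) (f : 𝓢(ℝ, ℂ)) :
    Measurable (Delta φ X k f) := by
  have h : Delta φ X k f = fun x => ∑ n ∈ (finite_setOf_dyadic_inter_nonempty k hX).toFinset,
      SchwartzMap.convolution (ContinuousLinearMap.mul ℂ ℂ) f (φ k n) x := by
    funext x
    simp only [SchwartzMap.convolution_apply]
    exact finsum_mem_eq_finite_toFinset_sum _ (finite_setOf_dyadic_inter_nonempty k hX)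
  rw [h]
  exact Finset.measurable_fun_sum _ fun n _ => (SchwartzMap.continuous _).measurable

end DeltaFormula

/-! ### The variational estimate for `Δ_k` -/

section SchwartzEstimate

variable {φ : ℤ → ℤ → 𝓢(ℝ, ℂ)}

/-- The `L²` bound of `Δ_k` at a single scale: the symbol is bounded by `D`, since at most one
of the Fourier transforms involved is nonzero at each frequency. -/
theorem eLpNorm_Delta_le (hφ : ∀ k n : ℤ, Function.support (𝓕 (φ k n : ℝ → ℂ)) ⊆ dyadic k n)
    {D : ℝ≥0} (hD : derivBound φ 1 ≤ D) {N : ℕ} {ξ : Fin N → ℝ} (hξ : Separated ξ) {k : ℤ}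
    (hk : k ≤ 0) (f : 𝓢(ℝ, ℂ)) :
    eLpNorm (fun x => ‖Delta φ (Set.range ξ) k f x‖ₑ) 2 volume ≤ D * eLpNorm f 2 volume := by
  set F : ℝ → ℂ := fun η => ∑ j, 𝓕 (φ k ⌊ξ j / (2 : ℝ) ^ k⌋ : ℝ → ℂ) η * 𝓕 (f : ℝ → ℂ) η with hF
  have hF1 : Integrable F := integrable_finsetSum _ fun j _ => integrable_fourier_mul _ _
  have hptw : ∀ η, ‖F η‖ ≤ D * ‖𝓕 (f : ℝ → ℂ) η‖ := by
    intro η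
    by_cases h : ∃ j, ⌊ξ j / (2 : ℝ) ^ k⌋ = ⌊η / (2 : ℝ) ^ k⌋
    · obtain ⟨j, hj⟩ := h
      rw [hF]
      dsimp only
      rw [Finset.sum_eq_single j, norm_mul]
      · gcongr
        exact norm_fourier_le hφ hD _ _ _
      · intro i _ hi
        rw [fourier_eq_zero hφ, zero_mul]
        intro hi'
        refine hi (hξ.floor_injective (floor_eq_of_mem_dyadic hk (n := ⌊η / (2 : ℝ) ^ k⌋) ?_ ?_))
        · exact mem_dyadic_iff.2 (mem_dyadic_iff.1 hi').symm
        · exact mem_dyadic_iff.2 hj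
      · simp
    · push Not at h
      have h0 : F η = 0 := Finset.sum_eq_zero fun j _ => by
        rw [fourier_eq_zero hφ, zero_mul]
        exact fun hi' => h j (mem_dyadic_iff.1 hi').symm
      rw [h0, norm_zero]
      positivity
  have hf2 : MemLp (𝓕 (f : ℝ → ℂ)) 2 := by
    rw [← SchwartzMap.fourier_coe]
    exact (𝓕 f).memLp 2
  have hF2 : MemLp F 2 := MemLp.of_le_mul hf2 hF1.aestronglyMeasurable
    (Filter.Eventually.of_forall hptw)
  rw [eLpNorm_two_le_iff]
  calc ∫⁻ x, ‖Delta φ (Set.range ξ) k f x‖ₑ ^ 2 = ∫⁻ x, ‖invF F x‖ₑ ^ 2 := by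
        simp only [Delta_eq_invF hξ hk, hF]
    _ = ∫⁻ η, ‖F η‖ₑ ^ 2 := lintegral_invF_sq hF1 hF2
    _ ≤ ∫⁻ η, (D : ℝ≥0∞) ^ 2 * ‖𝓕 (f : ℝ → ℂ) η‖ₑ ^ 2 := by
        refine lintegral_mono fun η => ?_
        rw [← mul_pow]
        gcongr
        have := ENNReal.ofReal_le_ofReal (hptw η)
        rwa [ENNReal.ofReal_mul D.coe_nonneg, ofReal_norm, ofReal_norm, ENNReal.ofReal_coe_nnreal] at this
    _ = (D * eLpNorm f 2 volume) ^ 2 := by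
        rw [lintegral_const_mul' _ _ (by simp), lintegral_fourier_sq, mul_pow, ← eLpNorm_enorm f,
          eLpNorm_two_sq]

/-- The variation of `Δ_k[f]` over finitely many scales, for a Schwartz function `f`. -/
theorem eLpNorm_variationSeminorm_Delta_le {q r : ℝ≥0∞} (hr2 : 2 < r) (hrq : r < q) (hq : q ≠ ∞)
    (hφ : ∀ k n : ℤ, Function.support (𝓕 (φ k n : ℝ → ℂ)) ⊆ dyadic k n)
    {D : ℝ≥0} (hD : derivBound φ 1 ≤ D) {N : ℕ} {ξ : Fin N → ℝ} (hξ : Separated ξ)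
    {A : ℝ≥0∞} (hA : ∀ j, variationNorm r (Set.Iic (0 : ℤ)) (fun k => symbolSum φ k (ξ j)) ≤ A)
    (K : ℕ) (f : 𝓢(ℝ, ℂ)) :
    eLpNorm (fun x => variationSeminorm q (Set.Icc (-(K : ℤ)) 0)
        (fun k => Delta φ (Set.range ξ) k f x)) 2 volume ≤
      (2 * expSumConst q r * (lepingleConst r + 2) *
        ENNReal.ofReal ((N : ℝ) ^ (1 / 2 - 1 / r.toReal)) * A + 52 * D) * eLpNorm f 2 volume := by
  -- The scales `-K, …, 0` are numbered by `n = k + K`, so that `2 ^ (-k) = 2 ^ K / 2 ^ n`.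
  set ψ : ℕ → Fin N → ℝ → ℂ := fun n j =>
    𝓕 (φ ((n : ℤ) - K) ⌊ξ j / (2 : ℝ) ^ ((n : ℤ) - K)⌋ : ℝ → ℂ) with hψ
  have hscale : ∀ n : ℕ, (2 : ℝ) ^ K / 2 ^ n = ((2 : ℝ) ^ ((n : ℤ) - K))⁻¹ := by
    intro n
    rw [zpow_sub₀ two_ne_zero, zpow_natCast, zpow_natCast, inv_div]
  have hmem : ∀ n j, ξ j ∈ dyadic ((n : ℤ) - K) ⌊ξ j / (2 : ℝ) ^ ((n : ℤ) - K)⌋ := fun n j =>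
    mem_dyadic_iff.2 rfl
  have hsym : ∀ n j, ψ n j (ξ j) = symbolSum φ ((n : ℤ) - K) (ξ j) := fun n j =>
    (symbolSum_eq hφ _ _).symm
  have hf1 : Integrable (𝓕 (f : ℝ → ℂ)) := by
    rw [← SchwartzMap.fourier_coe]
    exact (𝓕 f).integrable
  have hf2 : MemLp (𝓕 (f : ℝ → ℂ)) 2 := by
    rw [← SchwartzMap.fourier_coe]
    exact (𝓕 f).memLp 2
  have hff : eLpNorm (𝓕 (f : ℝ → ℂ)) 2 volume = eLpNorm f 2 volume := by
    have h1 := lintegral_fourier_sq f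
    have h2 : eLpNorm (𝓕 (f : ℝ → ℂ)) 2 volume ^ 2 = eLpNorm f 2 volume ^ 2 := by
      rw [← eLpNorm_enorm f, ← eLpNorm_enorm (𝓕 (f : ℝ → ℂ)), eLpNorm_two_sq, eLpNorm_two_sq, h1]
    exact (ENNReal.pow_right_strictMono two_ne_zero).injective h2
  have main := eLpNorm_variationSeminorm_multiplier_le hr2 hrq hq (K := K) hξ (ψ := ψ)
    (fun n j => continuous_fourier _) (D := D) (fun n _ j η => norm_fourier_le hφ hD _ _ _)
    (fun n _ j η => by rw [hscale]; exact norm_fourier_sub_le hD _ _ _ _)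
    (fun n _ j η h => fourier_eq_zero hφ fun hη => by
      rw [hscale, ← div_eq_inv_mul, le_div_iff₀ (by positivity), one_mul] at h
      exact (abs_sub_lt_of_mem_dyadic hη (hmem n j)).not_ge h)
    (B := fun j => (fun η : ℝ => ⌊η⌋) ⁻¹' {⌊ξ j⌋})
    (fun j => Int.measurable_floor (measurableSet_singleton _))
    (fun i j hij => Set.disjoint_left.2 fun η hi hj =>
      hij (hξ.floor_injective ((Set.mem_singleton_iff.1 hi).symm.trans (Set.mem_singleton_iff.1 hj))))
    (fun n hn j η h => fourier_eq_zero hφ fun hη =>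
      h (floor_eq_of_mem_dyadic (by omega) hη (hmem n j)))
    hf1 hf2 (A := A)
    (fun j n hn => by
      rw [hsym]
      refine le_trans ?_ ((le_self_add).trans (hA j))
      exact le_iSup₂_of_le ((n : ℤ) - K) (by simp; omega) le_rfl)
    (fun j => by
      refine le_trans ?_ ((le_add_self).trans (hA j))
      refine variationSeminorm_comp_le hrq.ne_top (e := fun n : ℕ => (n : ℤ) - K) ?_ ?_ ?_
      · intro a _ b _ hab
        dsimp only
        omega
      · intro n hn
        simp only [Set.mem_Iic] at hn ⊢
        omega
      · exact fun n _ => hsym n j)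
  rw [hff] at main
  refine le_trans (eLpNorm_mono_enorm fun x => ?_) main
  simp only [enorm_eq_self]
  refine variationSeminorm_comp_le hq (e := fun k : ℤ => (k + K).toNat) ?_ ?_ ?_
  · intro a ha b hb hab
    simp only [Set.mem_Icc] at ha hb
    dsimp only
    omega
  · intro k hk
    simp only [Set.mem_Icc, Set.mem_Iic] at hk ⊢
    omega
  · intro k hk
    simp only [Set.mem_Icc] at hk
    have e : (((k + K).toNat : ℕ) : ℤ) - K = k := by omega
    simp only [hψ, e]
    exact Delta_eq_invF hξ hk.2 f x

end SchwartzEstimate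

section Density

variable {φ : ℤ → ℤ → 𝓢(ℝ, ℂ)}

theorem variationNorm_le {E : Type*} [NormedAddCommGroup E] {q : ℝ≥0∞} (hq : q ≠ ∞) (hq1 : 1 ≤ q)
    (g : ℤ → E) : variationNorm q (Set.Iic (0 : ℤ)) g ≤
      ‖g 0‖ₑ + 2 * variationSeminorm q (Set.Iic (0 : ℤ)) g := by
  rw [variationNorm, two_mul, ← add_assoc]
  gcongr
  refine iSup₂_le fun k hk => ?_
  calc ‖g k‖ₑ = ‖g 0 + (g k - g 0)‖ₑ := by rw [add_sub_cancel]
    _ ≤ ‖g 0‖ₑ + ‖g k - g 0‖ₑ := enorm_add_le _ _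
    _ ≤ _ := by
        gcongr
        exact enorm_sub_le_variationSeminorm hq hq1 g hk (by simp)

/-- Convolution with a Schwartz function is continuous from `L²` to pointwise convergence. -/
theorem tendsto_convolution {f : ℝ → ℂ} (hf : MemLp f 2) {F : ℕ → ℝ → ℂ} (hF : ∀ m, MemLp (F m) 2)
    (h : Filter.Tendsto (fun m => eLpNorm (F m - f) 2 volume) Filter.atTop (nhds 0))
    (g : 𝓢(ℝ, ℂ)) (x : ℝ) :
    Filter.Tendsto (fun m => convolution (F m) g (ContinuousLinearMap.mul ℂ ℂ) volume x)
      Filter.atTop (nhds (convolution f g (ContinuousLinearMap.mul ℂ ℂ) volume x)) := by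
  have hg : MemLp (fun t => g (x - t)) 2 :=
    (g.memLp 2).comp_measurePreserving (Measure.measurePreserving_sub_left volume x)
  simp only [convolution, ContinuousLinearMap.mul_apply']
  refine tendsto_integral_of_L1 _ (hf.integrable_mul hg).1
    (Filter.Eventually.of_forall fun m => (hF m).integrable_mul hg) ?_
  have h0 : Filter.Tendsto (fun m => eLpNorm (F m - f) 2 volume *
      eLpNorm (fun t => g (x - t)) 2 volume) Filter.atTop (nhds 0) := by
    have := ENNReal.Tendsto.mul_const h (b := eLpNorm (fun t => g (x - t)) 2 volume)
      (Or.inr hg.eLpNorm_ne_top)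
    rwa [zero_mul] at this
  refine tendsto_of_tendsto_of_tendsto_of_le_of_le tendsto_const_nhds h0 (fun m => zero_le)
    fun m => ?_
  have := eLpNorm_smul_le_mul_eLpNorm (p := 2) (q := 2) (r := 1) hg.1 ((hF m).sub hf).1
  rw [eLpNorm_one_eq_lintegral_enorm] at this
  refine le_trans (le_of_eq ?_) this
  refine lintegral_congr fun t => ?_
  simp [sub_mul]

theorem tendsto_Delta {N : ℕ} {ξ : Fin N → ℝ} (hξ : Separated ξ) {k : ℤ} (hk : k ≤ 0)
    {f : ℝ → ℂ} (hf : MemLp f 2) {F : ℕ → 𝓢(ℝ, ℂ)}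
    (h : Filter.Tendsto (fun m => eLpNorm (⇑(F m) - f) 2 volume) Filter.atTop (nhds 0)) (x : ℝ) :
    Filter.Tendsto (fun m => Delta φ (Set.range ξ) k (F m) x) Filter.atTop
      (nhds (Delta φ (Set.range ξ) k f x)) := by
  simp only [Delta_eq_sum hξ hk]
  exact tendsto_finsetSum _ fun j _ => tendsto_convolution hf (fun m => (F m).memLp 2) h _ x

theorem exists_schwartz_tendsto {f : ℝ → ℂ} (hf : MemLp f 2) : ∃ F : ℕ → 𝓢(ℝ, ℂ),
    Filter.Tendsto (fun m => eLpNorm (⇑(F m) - f) 2 volume) Filter.atTop (nhds 0) := by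
  have h : ∀ m : ℕ, ∃ g : 𝓢(ℝ, ℂ), eLpNorm (⇑g - f) 2 volume ≤ ENNReal.ofReal (1 / (m + 1)) := by
    intro m
    obtain ⟨g, h1, h2, h3⟩ := MemLp.exist_eLpNorm_sub_le (by norm_num) (by norm_num) hf
      (ε := 1 / ((m : ℝ) + 1)) (by positivity)
    refine ⟨h1.toSchwartzMap h2, ?_⟩
    rw [eLpNorm_sub_comm]
    exact h3
  choose F hF using h
  refine ⟨F, tendsto_of_tendsto_of_tendsto_of_le_of_le tendsto_const_nhds ?_
    (fun m => zero_le) hF⟩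
  rw [← ENNReal.ofReal_zero]
  exact ENNReal.tendsto_ofReal tendsto_one_div_add_atTop_nhds_zero_nat

theorem liminf_add_liminf_le (u v : ℕ → ℝ≥0∞) : Filter.liminf u Filter.atTop +
    Filter.liminf v Filter.atTop ≤ Filter.liminf (fun m => u m + v m) Filter.atTop := by
  have hmono : ∀ w : ℕ → ℝ≥0∞, Monotone fun n => ⨅ i ≥ n, w i := fun w a b hab =>
    le_iInf₂ fun i hi => iInf₂_le i (hab.trans hi)
  simp only [Filter.liminf_eq_iSup_iInf_of_nat]
  rw [ENNReal.iSup_add_iSup_of_monotone (hmono u) (hmono v)]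
  exact iSup_mono fun n => le_iInf₂ fun i hi => add_le_add (iInf₂_le i hi) (iInf₂_le i hi)

/-- The estimate for finite `q`, with the better power of `N`. -/
theorem eLpNorm_variationNorm_Delta_le {q r : ℝ≥0∞} (hr2 : 2 < r) (hrq : r < q) (hq : q ≠ ∞)
    (hφ : ∀ k n : ℤ, Function.support (𝓕 (φ k n : ℝ → ℂ)) ⊆ dyadic k n)
    {D : ℝ≥0} (hD : derivBound φ 1 ≤ D) {N : ℕ} {ξ : Fin N → ℝ} (hξ : Separated ξ)
    {A : ℝ≥0} (hA : ∀ j, variationNorm r (Set.Iic (0 : ℤ)) (fun k => symbolSum φ k (ξ j)) ≤ A)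
    {f : ℝ → ℂ} (hf : MemLp f 2) :
    eLpNorm (fun x => variationNorm q (Set.Iic (0 : ℤ))
        (fun k => Delta φ (Set.range ξ) k f x)) 2 volume ≤
      (D + 2 * (2 * expSumConst q r * (lepingleConst r + 2) *
        ENNReal.ofReal ((N : ℝ) ^ (1 / 2 - 1 / r.toReal)) * A + 52 * D)) *
        eLpNorm f 2 volume := by
  have hq1 : 1 ≤ q := (one_le_two.trans hr2.le).trans hrq.le
  obtain ⟨F, hF⟩ := exists_schwartz_tendsto hf
  set c : ℝ≥0∞ := 2 * expSumConst q r * (lepingleConst r + 2) *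
        ENNReal.ofReal ((N : ℝ) ^ (1 / 2 - 1 / r.toReal)) * A + 52 * D with hc
  have hct : D + 2 * c ≠ ∞ := by
    have h1 := (expSumConst_lt_top hr2 hrq hq).ne
    have h2 := (lepingleConst_lt_top hrq.ne_top hr2).ne
    rw [hc]
    finiteness
  -- Fatou's lemma is applied once, to the approximations of `f` and to the finite sets of scales
  -- simultaneously.
  set G : ℕ → ℝ → ℝ≥0∞ := fun m x => ‖Delta φ (Set.range ξ) 0 (F m) x‖ₑ +
    2 * variationSeminorm q (Set.Icc (-(m : ℤ)) 0) (fun k => Delta φ (Set.range ξ) k (F m) x) with hG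
  have hm1 : ∀ m, Measurable fun x => ‖Delta φ (Set.range ξ) 0 (F m) x‖ₑ := fun m =>
    (measurable_Delta (Set.finite_range ξ) 0 (F m)).enorm
  have hm2 : ∀ m : ℕ, Measurable fun x => variationSeminorm q (Set.Icc (-(m : ℤ)) 0)
      (fun k => Delta φ (Set.range ξ) k (F m) x) := fun m =>
    measurable_variationSeminorm hq _ fun k => measurable_Delta (Set.finite_range ξ) k (F m)
  have hGle : ∀ m, eLpNorm (G m) 2 volume ≤ (D + 2 * c) * eLpNorm (F m) 2 volume := by
    intro m
    refine (eLpNorm_add_le (hm1 m).aestronglyMeasurable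
      ((hm2 m).const_mul 2).aestronglyMeasurable (by norm_num)).trans ?_
    rw [add_mul]
    gcongr
    · exact eLpNorm_Delta_le hφ hD hξ le_rfl (F m)
    · rw [eLpNorm_two_le_iff]
      have h1 := eLpNorm_two_le_iff.1
        (eLpNorm_variationSeminorm_Delta_le hr2 hrq hq hφ hD hξ hA m (F m))
      simp only [mul_pow] at h1 ⊢
      rw [lintegral_const_mul _ ((hm2 m).pow_const 2)]
      rw [mul_assoc]
      gcongr
  have hpt : ∀ x, variationNorm q (Set.Iic (0 : ℤ)) (fun k => Delta φ (Set.range ξ) k f x) ≤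
      Filter.liminf (fun m => G m x) Filter.atTop := by
    intro x
    refine (variationNorm_le hq hq1 _).trans ?_
    have h0 : Filter.Tendsto (fun m => ‖Delta φ (Set.range ξ) 0 (F m) x‖ₑ) Filter.atTop
        (nhds ‖Delta φ (Set.range ξ) 0 f x‖ₑ) :=
      (tendsto_Delta hξ le_rfl hf hF x).enorm
    have h1 := variationSeminorm_le_liminf hq (K := Set.Iic (0 : ℤ))
      (K' := fun m : ℕ => Set.Icc (-(m : ℤ)) 0) (fun k hk => by
        filter_upwards [Filter.eventually_ge_atTop k.natAbs] with m hm
        simp only [Set.mem_Iic, Set.mem_Icc] at hk ⊢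
        omega)
      (G := fun m k => Delta φ (Set.range ξ) k (F m) x) (fun k hk => tendsto_Delta hξ hk hf hF x)
    rw [← h0.liminf_eq]
    refine le_trans ?_ (liminf_add_liminf_le _ _)
    gcongr
    calc _ ≤ 2 * Filter.liminf (fun m : ℕ => variationSeminorm q (Set.Icc (-(m : ℤ)) 0)
          fun k => Delta φ (Set.range ξ) k (F m) x) Filter.atTop := by gcongr
      _ = _ := by
        rw [ENNReal.liminf_const_mul_of_ne_top (by norm_num)]
  have hFn : ∀ m, eLpNorm (F m) 2 volume ≤ eLpNorm f 2 volume + eLpNorm (⇑(F m) - f) 2 volume := by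
    intro m
    have := eLpNorm_add_le hf.1 (((F m).memLp 2).sub hf).1 (p := 2) (by norm_num)
    rwa [add_sub_cancel] at this
  have hlim : Filter.Tendsto (fun m => (D + 2 * c) *
      (eLpNorm f 2 volume + eLpNorm (⇑(F m) - f) 2 volume)) Filter.atTop
      (nhds ((D + 2 * c) * eLpNorm f 2 volume)) := by
    have h1 := ENNReal.Tendsto.const_mul (hF.const_add (eLpNorm f 2 volume)) (Or.inr hct)
    rwa [add_zero] at h1
  calc _ ≤ Filter.liminf (fun m => eLpNorm (G m) 2 volume) Filter.atTop :=
        eLpNorm_two_le_liminf (fun m => (hm1 m).add ((hm2 m).const_mul 2)) hpt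
    _ ≤ Filter.liminf (fun m => (D + 2 * c) *
          (eLpNorm f 2 volume + eLpNorm (⇑(F m) - f) 2 volume)) Filter.atTop := by
        refine Filter.liminf_le_liminf (Filter.Eventually.of_forall fun m => ?_)
        exact (hGle m).trans (by gcongr; exact hFn m)
    _ = _ := hlim.liminf_eq

/-- The exponent in the final estimate is at least the one which the proof gives. -/
theorem le_growthExponent {q r : ℝ≥0∞} (hr2 : 2 < r) (hrq : r < q) :
    1 / 2 - 1 / r.toReal ≤ growthExponent q r := by
  have h2 : 2 < r.toReal := by
    simpa using (ENNReal.toReal_lt_toReal ENNReal.ofNat_ne_top hrq.ne_top).2 hr2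
  have h0 : 0 ≤ 1 / 2 - 1 / r.toReal := by
    rw [sub_nonneg]
    exact one_div_le_one_div_of_le two_pos h2.le
  rw [growthExponent]
  refine le_mul_of_one_le_right h0 ?_
  split_ifs with hq
  · exact le_rfl
  · have h3 : r.toReal < q.toReal := (ENNReal.toReal_lt_toReal hrq.ne_top hq).2 hrq
    rw [one_le_div (by linarith)]
    linarith

theorem variationNorm_anti {ι E : Type*} [LinearOrder ι] [NormedAddCommGroup E] {r q : ℝ≥0∞}
    (hr1 : 1 ≤ r) (hrq : r ≤ q) (K : Set ι) (g : ι → E) :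
    variationNorm q K g ≤ variationNorm r K g :=
  add_le_add le_rfl (variationSeminorm_anti hr1 hrq K g)

theorem Delta_congr_ae {X : Set ℝ} {f g : ℝ → ℂ} (h : f =ᵐ[volume] g) (k : ℤ) (x : ℝ) :
    Delta φ X k f x = Delta φ X k g x := by
  have : ∀ n, convolution f (φ k n) (ContinuousLinearMap.mul ℂ ℂ) volume x =
      convolution g (φ k n) (ContinuousLinearMap.mul ℂ ℂ) volume x := fun n =>
    integral_congr_ae (h.mono fun t ht => by simp only [ht])
  simp only [Delta, this]

end Density

end MultiFreq

theorem proposition4p1 (q r : ℝ≥0∞) (hr : 2 < r) (hrq : r < q) :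
    ∃ C : ℝ≥0, ∀ (N : ℕ) (ξ : Fin N → ℝ) (φ : ℤ → ℤ → 𝓢(ℝ, ℂ)) (f : ℝ → ℂ),
      (∀ (i : ℕ) (hi : i + 1 < N), ξ ⟨i, Nat.lt_of_succ_lt hi⟩ + 1 < ξ ⟨i + 1, hi⟩) →
      (∀ k n : ℤ, Function.support (𝓕 (φ k n : ℝ → ℂ)) ⊆ MultiFreq.dyadic k n) →
      MemLp f 2 volume →
      eLpNorm (fun x => MultiFreq.variationNorm q (Set.Iic (0 : ℤ))
          (fun k => MultiFreq.Delta φ (Set.range ξ) k f x)) 2 volume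
        ≤ C * (N : ℝ≥0∞) ^ MultiFreq.growthExponent q r
          * (MultiFreq.derivBound φ 1
              + ⨆ j : Fin N, MultiFreq.variationNorm r (Set.Iic (0 : ℤ))
                  (fun k => MultiFreq.symbolSum φ k (ξ j)))
          * eLpNorm f 2 volume := by
  -- For `q = ∞` the finite exponent `r + 1` gives a larger variation norm.
  obtain ⟨p, hrp, hpq, hp⟩ : ∃ p, r < p ∧ p ≤ q ∧ p ≠ ∞ := by
    by_cases hq : q = ∞
    · exact ⟨r + 1, ENNReal.lt_add_right hrq.ne_top one_ne_zero, hq ▸ le_top,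
        ENNReal.add_ne_top.2 ⟨hrq.ne_top, ENNReal.one_ne_top⟩⟩
    · exact ⟨q, hrq, le_rfl, hq⟩
  have hp1 : 1 ≤ p := (one_le_two.trans hr.le).trans hrp.le
  have hE := (MultiFreq.expSumConst_lt_top hr hrp hp).ne
  have hL := (MultiFreq.lepingleConst_lt_top hrq.ne_top hr).ne
  set c := 2 * MultiFreq.expSumConst p r * (MultiFreq.lepingleConst r + 2) with hc
  have hct : 105 + 2 * c ≠ ∞ := by
    rw [hc]
    finiteness
  have hzero : MultiFreq.variationNorm q (Set.Iic (0 : ℤ)) (fun _ => (0 : ℂ)) = 0 := by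
    refine le_antisymm ((MultiFreq.variationNorm_anti hp1 hpq _ _).trans ?_) zero_le
    simp [MultiFreq.variationNorm, MultiFreq.variationSeminorm_const hp hp1]
  refine ⟨(105 + 2 * c).toNNReal, fun N ξ φ f hξ hφ hf => ?_⟩
  rw [ENNReal.coe_toNNReal hct]
  by_cases hf0 : eLpNorm f 2 volume = 0
  · -- The right-hand side may be `∞ * 0`; here `f` vanishes almost everywhere.
    have hf' : f =ᵐ[volume] 0 := (eLpNorm_eq_zero_iff hf.1 two_ne_zero).1 hf0
    have h0 : ∀ k x, MultiFreq.Delta φ (Set.range ξ) k f x = 0 := by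
      intro k x
      rw [MultiFreq.Delta_congr_ae hf']
      simp [MultiFreq.Delta]
    simp only [h0, hzero]
    simp
  rcases Nat.eq_zero_or_pos N with rfl | hN
  · have h0 : ∀ k x, MultiFreq.Delta φ (Set.range ξ) k f x = 0 := by
      intro k x
      simp [MultiFreq.Delta, Set.range_eq_empty]
    simp only [h0, hzero]
    simp
  have hN1 : (1 : ℝ≥0∞) ≤ N := by exact_mod_cast hN
  have hexp := MultiFreq.le_growthExponent hr hrq
  have hr2 : 0 ≤ 1 / 2 - 1 / r.toReal := by
    have h2 : 2 < r.toReal := by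
      simpa using (ENNReal.toReal_lt_toReal ENNReal.ofNat_ne_top hrq.ne_top).2 hr
    rw [sub_nonneg]
    exact one_div_le_one_div_of_le two_pos h2.le
  have hNpow : (1 : ℝ≥0∞) ≤ (N : ℝ≥0∞) ^ MultiFreq.growthExponent q r :=
    ENNReal.rpow_zero (x := (N : ℝ≥0∞)) ▸
      ENNReal.rpow_le_rpow_of_exponent_le hN1 (hr2.trans hexp)
  set S := ⨆ j : Fin N, MultiFreq.variationNorm r (Set.Iic (0 : ℤ))
    (fun k => MultiFreq.symbolSum φ k (ξ j)) with hS
  by_cases hfin : MultiFreq.derivBound φ 1 + S = ∞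
  · rw [hfin, ENNReal.mul_top, ENNReal.top_mul hf0]
    · exact le_top
    · exact mul_ne_zero (by simp) (one_pos.trans_le hNpow).ne'
  obtain ⟨hDt, hSt⟩ := ENNReal.add_ne_top.1 hfin
  obtain ⟨D, hD⟩ := WithTop.ne_top_iff_exists.1 hDt
  obtain ⟨A, hA⟩ := WithTop.ne_top_iff_exists.1 hSt
  change (D : ℝ≥0∞) = _ at hD
  change (A : ℝ≥0∞) = _ at hA
  have main := MultiFreq.eLpNorm_variationNorm_Delta_le hr hrp hp hφ hD.ge
    (MultiFreq.separated_of_consecutive hξ) (A := A)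
    (fun j => (le_iSup (fun j : Fin N => MultiFreq.variationNorm r (Set.Iic (0 : ℤ))
      (fun k => MultiFreq.symbolSum φ k (ξ j))) j).trans hA.ge) hf
  refine (eLpNorm_mono_enorm fun x => ?_).trans (main.trans ?_)
  · simp only [enorm_eq_self]
    exact MultiFreq.variationNorm_anti hp1 hpq _ _
  · rw [← hD, ← hA, ← hc, ← ENNReal.ofReal_rpow_of_nonneg (Nat.cast_nonneg N) hr2,
      ENNReal.ofReal_natCast]
    gcongr
    calc D + 2 * (c * (N : ℝ≥0∞) ^ (1 / 2 - 1 / r.toReal) * A + 52 * D)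
        = 105 * 1 * D + 2 * c * (N : ℝ≥0∞) ^ (1 / 2 - 1 / r.toReal) * A := by ring
      _ ≤ 105 * (N : ℝ≥0∞) ^ MultiFreq.growthExponent q r * (D + A) +
          2 * c * (N : ℝ≥0∞) ^ MultiFreq.growthExponent q r * (D + A) := by
          gcongr
          · exact le_self_add
          · exact le_add_self
      _ = _ := by ring
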